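/- A reconfiguration schedule of length $\ell$ and cost $s$ (an $\ell$-batch schedule) between vertex covers $\alpha,\beta$ of a graph $G$ is a sequence $V_0=\alpha,V_1,\dots,V_\ell=\beta$ of vertex covers of $G$ such that, for all $0\le i<\ell$, $|V_i\cup V_{i+1}|\le s$ and the symmetric difference $V_i\oplus V_{i+1}$ is an independent set of $G$. It is an $(\eta,c)$-approximation if its cost is at most $\eta\max\{|\alpha|,|\beta|\}+c$. In the LOCAL model, the nodes of a connected $n$-node graph $G$ have distinct identifiers from a space whose size $N$ is polynomial in $n$ (that is, $N\le n^{a}$ for a fixed $a$) and is known to the nodes. In each synchronous round every node sends one message of unbounded size to each neighbour, and local computation is unlimited. Each node knows initially its own identifier and whether it belongs to $\alpha$ and to $\beta$. The nodes compute a schedule $V_0,\dots,V_\ell$ if every node outputs its membership in each $V_i$. There is a constant $L$, and for every $a$ there is a constant $C$, such that the following holds. For each $\varepsilon>0$ there is a deterministic LOCAL algorithm that, for every connected $n$-node graph $G$ with vertex covers $\alpha$ and $\beta$ and for all distinct identifiers from a space of size at most $n^{a}$, computes in at most $C\cdot\log^*(n)/\varepsilon$ rounds a $(1+\varepsilon,3)$-approximation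 schedule from $\alpha$ to $\beta$ with at most $L\lceil 1/\varepsilon\rceil$ batches, provided that $G$ belongs to one of the following classes: cycles, trees, forests, chordal graphs (no induced cycle with at least $4$ vertices), cactus graphs (every edge lies on at most one cycle), even-hole-free graphs (no induced cycle with an even number of vertices), claw-free graphs (no induced $K_{1,3}$). -/

import Mathlib

/-! ### Iterated logarithm -/

/-- `log* n`: how many times the binary logarithm has to be applied to `n` before the value is at
most `1`. -/
noncomputable def logStar (n : ℕ) : ℕ :=
  sInf {k : ℕ | (Real.logb 2)^[k] (n : ℝ) ≤ 1}

/-! ### Vertex cover reconfiguration schedules -/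

/-- `S 0, …, S ℓ` is a reconfiguration schedule of length `ℓ` (an `ℓ`-batch schedule) and cost `s`
from `α` to `β`; the values `S i` with `i > ℓ` play no role. -/
structure IsReconfigurationSchedule {V : Type*} [DecidableEq V] (G : SimpleGraph V)
    (α β : Finset V) (ℓ : ℕ) (s : ℝ) (S : ℕ → Finset V) : Prop where
  isVertexCover : ∀ i ≤ ℓ, G.IsVertexCover (S i : Set V)
  first : S 0 = α
  last : S ℓ = β
  cost : ∀ i < ℓ, ((S i ∪ S (i + 1)).card : ℝ) ≤ s
  batch : ∀ i < ℓ, G.IsIndepSet ((symmDiff (S i) (S (i + 1)) : Finset V) : Set V)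

/-- An `ℓ`-batch schedule from `α` to `β` that is an `(η, c)`-approximation. -/
def IsApproximationSchedule {V : Type*} [DecidableEq V] (G : SimpleGraph V)
    (α β : Finset V) (ℓ : ℕ) (η c : ℝ) (S : ℕ → Finset V) : Prop :=
  IsReconfigurationSchedule G α β ℓ (η * (max α.card β.card : ℕ) + c) S

/-! ### Graph classes -/

/-- `G` is a cycle graph. -/
def IsCycleGraph {V : Type*} (G : SimpleGraph V) : Prop :=
  ∃ k : ℕ, 3 ≤ k ∧ Nonempty (SimpleGraph.cycleGraph k ≃g G)

/-- No induced cycle with four or more vertices. -/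
def IsChordal {V : Type*} (G : SimpleGraph V) : Prop :=
  ∀ k : ℕ, 4 ≤ k → ¬ (SimpleGraph.cycleGraph k).IsIndContained G

/-- Every edge belongs to at most one cycle (a cycle being determined by its set of edges). -/
def IsCactus {V : Type*} (G : SimpleGraph V) : Prop :=
  ∀ (e : Sym2 V) (u v : V) (p : G.Walk u u) (q : G.Walk v v), p.IsCycle → q.IsCycle →
    e ∈ p.edgeSet → e ∈ q.edgeSet → p.edgeSet = q.edgeSet

/-- No induced cycle with an even number of vertices. -/
def IsEvenHoleFree {V : Type*} (G : SimpleGraph V) : Prop :=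
  ∀ k : ℕ, 3 ≤ k → Even k → ¬ (SimpleGraph.cycleGraph k).IsIndContained G

/-- No induced `K_{1,3}`. -/
def IsClawFree {V : Type*} (G : SimpleGraph V) : Prop :=
  ¬ (completeBipartiteGraph (Fin 1) (Fin 3)).IsIndContained G

/-! ### The LOCAL model -/

/-- A deterministic algorithm in the LOCAL model. Local computation and the size of states and
messages are unbounded. A node initially knows only the size `N` of the identifier space, its own
identifier and its own input. -/
structure LocalAlgorithm (Input Output : Type) where
  /-- states of a node -/
  State : Type
  /-- messages -/
  Msg : Type
  /-- the initial state, from the size of the identifier space, the own identifier, the input -/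
  init : ℕ → ℕ → Input → State
  /-- the message that a node in the given state sends to its neighbour with the given identifier -/
  send : State → ℕ → Msg
  /-- the new state, from the old state and the received messages, each of which comes with the
  identifier of its sender -/
  receive : State → Set (ℕ × Msg) → State
  /-- the output of a node, from its final state -/
  output : State → Output
  /-- the number of rounds, from the size of the identifier space -/
  rounds : ℕ → ℕ

namespace LocalAlgorithm

/-- The state of each node after `t` synchronous rounds on the network `G` with identifiers `ident`
from a space of size `N`. -/
def stateAt {Input Output : Type} (A : LocalAlgorithm Input Output) {V : Type*} (G : SimpleGraph V)
    (N : ℕ) (ident : V → ℕ) (input : V → Input) : ℕ → V → A.State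
  | 0, v => A.init N (ident v) (input v)
  | t + 1, v => A.receive (stateAt A G N ident input t v)
      {m | ∃ w, G.Adj w v ∧ m = (ident w, A.send (stateAt A G N ident input t w) (ident v))}

/-- The output of each node at the end of the execution. -/
def run {Input Output : Type} (A : LocalAlgorithm Input Output) {V : Type*} (G : SimpleGraph V)
    (N : ℕ) (ident : V → ℕ) (input : V → Input) (v : V) : Output :=
  A.output (A.stateAt G N ident input (A.rounds N) v)

end LocalAlgorithm

/-! Every edge of `G` either has an end in `α ∩ β`, which is never removed, or joins `α \ β` to `β \
α`. So only the exchange graph `H` of the latter edges matters, and in each listed class `H` is a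
cactus (`isCactus_exchangeGraph`): a shortest cycle of `H` is even and induced in `G`, so chordal
and even-hole-free graphs give a forest, while cycles and claw-free graphs give maximum degree two.

In a cactus with sides `A`, `B` and `|B| ≤ |A|`, the vertices of `B` can be inserted one by one so
that the insertions never exceed the removable vertices of `A` by more than one
(`IsCactus.reflTransGen_exchangeStep`). Inserting in `k` chunks gives `2 * k + 1` batches with
overhead about `(|A| + |B|) / k`; the case `|A| ≤ |B|` is the same backwards in time.

To work locally, `α ∪ β` is split into clusters of radius `O(k)` with at least `k` vertices, `k =
Θ(1/ε)`. Cluster sizes are doubled repeatedly: small clusters point to a neighbour, Cole–Vishkin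
colours break the pointer paths, and what remains is contracted (`IsClustering.coarsen`). Pointers
prefer edges of `H`, so the boundary of a cluster stays `H`-connected. In a cactus this allows at
most two `H`-edges between two clusters, and contracting clusters one at a time bounds all crossing
edges by twice the number of clusters (`IsCactus.card_cutPairs_le`). The ends of crossing edges in
`β \ α` are inserted at the start. Then the clusters are independent of each other and are exchanged
in parallel, shrinking ones before growing ones. The excess is at most `5 * |α ∪ β| / k`, or at most
`2` if a single cluster holds everything (`error_le`).

All of this is determined by balls of radius `O(log* n / ε)` (`isLocal_clustering`,
`isLocal_schedule`). The algorithm gathers such a ball and evaluates the schedule on any instance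
over `Fin N` that explains it. -/

/-! ### Cactus graphs -/

section Cactus

open SimpleGraph

variable {V : Type*}

/-- No vertex has three neighbours. -/
def MaxDegreeLETwo (G : SimpleGraph V) : Prop :=
  ∀ v a b c, G.Adj v a → G.Adj v b → G.Adj v c → a = b ∨ a = c ∨ b = c

theorem IsCactus.mono {G H : SimpleGraph V} (hle : H ≤ G) (hG : IsCactus G) : IsCactus H := by
  intro e u v p q hp hq he he'
  have := hG e u v (p.mapLe hle) (q.mapLe hle) (hp.mapLe hle) (hq.mapLe hle)
  simpa only [Walk.edgeSet_mapLe_eq_edgeSet] using this (by simpa using he) (by simpa using he')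

theorem SimpleGraph.IsAcyclic.isCactus {G : SimpleGraph V} (hG : G.IsAcyclic) : IsCactus G :=
  fun _ _ _ p _ hp => (hG p hp).elim

theorem SimpleGraph.Walk.IsCycle.exists_two_mem_edges {G : SimpleGraph V} {u v : V}
    {p : G.Walk u u} (hp : p.IsCycle) (hv : v ∈ p.support) :
    ∃ a b, a ≠ b ∧ s(v, a) ∈ p.edges ∧ s(v, b) ∈ p.edges ∧
      ∀ w, s(v, w) ∈ p.edges → w = a ∨ w = b := by
  obtain ⟨a, b, hab, h⟩ := Set.ncard_eq_two.mp (hp.ncard_neighborSet_toSubgraph_eq_two hv)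
  have key : ∀ w, s(v, w) ∈ p.edges ↔ w = a ∨ w = b := by
    intro w
    have : w ∈ p.toSubgraph.neighborSet v ↔ w ∈ ({a, b} : Set V) := by rw [h]
    rwa [Subgraph.mem_neighborSet, ← Subgraph.mem_edgeSet, Walk.mem_edges_toSubgraph] at this
  exact ⟨a, b, hab, (key a).2 (Or.inl rfl), (key b).2 (Or.inr rfl), fun w hw => (key w).1 hw⟩

/-- A cycle uses two edges at each of its vertices, hence all of them. So a walk that starts on a
cycle stays on it, and two cycles with a common edge contain each other. -/
theorem MaxDegreeLETwo.isCactus {G : SimpleGraph V} (hG : MaxDegreeLETwo G) : IsCactus G := by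
  classical
  have adj_mem : ∀ {u : V} (p : G.Walk u u), p.IsCycle → ∀ v ∈ p.support, ∀ w, G.Adj v w →
      s(v, w) ∈ p.edges := by
    intro u p hp v hv w hw
    obtain ⟨a, b, hab, ha, hb, -⟩ := hp.exists_two_mem_edges hv
    rcases hG v a b w (p.adj_of_mem_edges ha) (p.adj_of_mem_edges hb) hw with h | rfl | rfl
    · exact (hab h).elim
    · exact ha
    · exact hb
  have walk_sub : ∀ {u : V} (p : G.Walk u u), p.IsCycle → ∀ {x y : V} (q : G.Walk x y),
      x ∈ p.support → ∀ e ∈ q.edges, e ∈ p.edges := by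
    intro u p hp x y q
    induction q with
    | nil => simp
    | cons h q ih =>
      intro hx e he
      have h1 := adj_mem p hp _ hx _ h
      rw [Walk.edges_cons, List.mem_cons] at he
      rcases he with rfl | he
      · exact h1
      · exact ih (p.snd_mem_support_of_mem_edges h1) e he
  have main : ∀ {u v : V} (e : Sym2 V) (p : G.Walk u u) (q : G.Walk v v), p.IsCycle →
      e ∈ p.edges → e ∈ q.edges → ∀ e' ∈ q.edges, e' ∈ p.edges := by
    intro u v e p q hp he he' e' h'
    induction e with | h x y
    have hx := q.fst_mem_support_of_mem_edges he'
    refine walk_sub p hp (q.rotate x hx) (p.fst_mem_support_of_mem_edges he) e' ?_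
    exact (q.rotate_edges x hx).mem_iff.2 h'
  intro e u v p q hp hq he he'
  ext e'
  exact ⟨main e q p hq he' he e', main e p q hp he he' e'⟩

theorem SimpleGraph.Walk.exists_map_eq {W : Type*} {G : SimpleGraph V} (f : V ↪ W) {x y : W}
    (p : (G.map f).Walk x y) : ∀ u, f u = x → ∃ v, ∃ q : G.Walk u v, ∃ hx hy,
      p = (q.map (Embedding.map f G).toHom).copy hx hy := by
  induction p with
  | nil => exact fun u hu => ⟨u, .nil, hu, hu, by subst hu; rfl⟩
  | cons h p ih =>
    intro u hu
    obtain ⟨-, u', w, hadj, hu', hw⟩ := id h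
    obtain ⟨v, q, hx, hy, hq⟩ := ih w hw
    obtain rfl := f.injective (hu'.trans hu.symm)
    refine ⟨v, .cons hadj q, hu, hy, ?_⟩
    subst hu; subst hy; subst hw
    rw [hq]; rfl

theorem IsCactus.map {W : Type*} {G : SimpleGraph V} (f : V ↪ W) (hG : IsCactus G) :
    IsCactus (G.map f) := by
  have key : ∀ {x : W} (p : (G.map f).Walk x x), p.IsCycle →
      ∃ u, ∃ q : G.Walk u u, q.IsCycle ∧ p.edgeSet = Sym2.map f '' q.edgeSet := by
    intro x p hp
    cases hp' : p with
    | nil => exact (hp.ne_nil hp').elim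
    | cons h p' =>
      obtain ⟨-, u, w, hadj, hu, hw⟩ := id h
      obtain ⟨v, q, hx, hy, hq⟩ := p.exists_map_eq f u hu
      obtain rfl := f.injective (hu.trans hy.symm)
      subst hu
      replace hq : p = q.map (Embedding.map f G).toHom := hq
      refine ⟨u, q, ?_, ?_⟩
      · rw [hq] at hp
        exact hp.of_map
      · rw [← hp', hq]
        ext e
        change e ∈ (q.map (Embedding.map f G).toHom).edges ↔ _
        rw [Walk.edges_map, List.mem_map]
        rfl
  intro e u v p q hp hq he he'
  obtain ⟨u', p', hp', ep⟩ := key p hp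
  obtain ⟨v', q', hq', eq⟩ := key q hq
  rw [ep] at he
  rw [eq] at he'
  obtain ⟨e1, he1, rfl⟩ := he
  obtain ⟨e2, he2, h12⟩ := he'
  obtain rfl := Sym2.map.injective f.injective h12
  rw [ep, eq, hG _ _ _ p' q' hp' hq' he1 he2]

/-- A cycle of length equal to the girth has no chord, since a chord would cut off a shorter cycle.
-/
theorem SimpleGraph.exists_cycleGraph_isIndContained {G : SimpleGraph V} (hG : ¬ G.IsAcyclic) :
    ∃ n, 3 ≤ n ∧ (cycleGraph n).IsIndContained G := by
  classical
  obtain ⟨u, p, hp, hlen⟩ := exists_girth_eq_length.2 hG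
  have chordless : ∀ i j, i < j → j < p.length → G.Adj (p.getVert i) (p.getVert j) →
      j = i + 1 ∨ (i = 0 ∧ j + 1 = p.length) := by
    intro i j hij hj hadj
    by_contra! hcon
    have hpath : ((p.take j).drop i).IsPath := (hp.isPath_take hj).drop i
    have e1 : (p.take j).getVert i = p.getVert i := by rw [Walk.take_getVert]; congr 1; omega
    set q : G.Walk (p.getVert i) (p.getVert j) := ((p.take j).drop i).copy e1 rfl with hq
    have hqp : q.IsPath := by simpa [hq] using hpath
    have hql : q.length = j - i := by simp [hq]; omega
    have hne : s(p.getVert j, p.getVert i) ∉ q.edges := by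
      intro hmem
      rw [Sym2.eq_swap] at hmem
      have h1 := hqp.eq_snd_of_mem_edges hmem
      have h2 : q.getVert 1 = q.getVert q.length := by
        rw [Walk.getVert_length]; exact h1.symm
      have := hqp.getVert_injOn (by simp; omega) (by simp) h2
      omega
    -- This cycle has length `j - i + 1`; being at least the girth, it leaves only `i = 0` and `j +
    -- 1 = p.length`.
    have hc : (Walk.cons hadj.symm q).IsCycle := (Walk.cons_isCycle_iff q hadj.symm).2 ⟨hqp, hne⟩
    have := girth_le_length hc
    rw [Walk.length_cons] at this
    omega
  have h3 := hp.three_le_length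
  obtain ⟨n, hn⟩ : ∃ n, p.length = n + 2 := ⟨p.length - 2, by omega⟩
  refine ⟨n + 2, by omega, ⟨⟨⟨fun i => p.getVert i, ?_⟩, ?_⟩⟩⟩
  · intro i j hij
    have := hp.getVert_injOn' (by simp; omega) (by simp; omega) hij
    exact Fin.ext this
  · intro i j
    have adj_iff : ∀ i j : Fin (n + 2), i < j → ((cycleGraph (n + 2)).Adj i j ↔
        ((j : ℕ) = i + 1 ∨ ((i : ℕ) = 0 ∧ (j : ℕ) + 1 = n + 2))) := by
      intro i j hij
      have hij' : (i : ℕ) < j := hij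
      rw [cycleGraph_adj', Fin.sub_val_of_le hij.le, Fin.coe_sub_iff_lt.2 hij]
      omega
    have key : ∀ i j : Fin (n + 2), i < j →
        (G.Adj (p.getVert i) (p.getVert j) ↔ (cycleGraph (n + 2)).Adj i j) := by
      intro i j hij
      rw [adj_iff i j hij]
      constructor
      · intro h
        have := chordless i j hij (by omega) h
        omega
      · rintro (h | ⟨h, h'⟩)
        · rw [h]; exact p.adj_getVert_succ (by omega)
        · have := p.adj_getVert_succ (i := j) (by omega)
          rw [show (j : ℕ) + 1 = p.length by omega, Walk.getVert_length] at this
          rw [h, Walk.getVert_zero]; exact this.symm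
    rcases lt_trichotomy i j with h | rfl | h
    · exact key i j h
    · simp
    · exact (G.adj_comm _ _).trans ((key j i h).trans (adj_comm _ _ _))

/-! ### The exchange graph of two vertex covers and its shape in each graph class. -/

/-- The edges of `G` between `α \ β` and `β \ α`. -/
def exchangeGraph (G : SimpleGraph V) (α β : Finset V) : SimpleGraph V where
  Adj x y := G.Adj x y ∧ ((x ∈ α ∧ x ∉ β ∧ y ∈ β ∧ y ∉ α) ∨ (x ∈ β ∧ x ∉ α ∧ y ∈ α ∧ y ∉ β))
  symm := ⟨fun _ _ h => ⟨h.1.symm, by tauto⟩⟩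
  loopless := ⟨fun _ h => h.1.ne rfl⟩

theorem exchangeGraph_le (G : SimpleGraph V) (α β : Finset V) : exchangeGraph G α β ≤ G :=
  fun _ _ h => h.1

theorem SimpleGraph.IsVertexCover.mem_or {G : SimpleGraph V} {α : Finset V}
    (h : G.IsVertexCover (α : Set V)) {x y : V} (hxy : G.Adj x y) : x ∈ α ∨ y ∈ α := by
  simpa using h hxy

section Covers

variable {G : SimpleGraph V} {α β : Finset V}


/-- Vertices that are not isolated in the exchange graph lie in exactly one cover. An edge between
two of them must be hit by both covers, so its ends are on opposite sides. Hence subgraphs without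
isolated vertices that are induced in the exchange graph are induced in `G`. -/
theorem exchangeGraph_adj_of_adj (hα : G.IsVertexCover (α : Set V))
    (hβ : G.IsVertexCover (β : Set V)) {x y x' y' : V} (hx : (exchangeGraph G α β).Adj x x')
    (hy : (exchangeGraph G α β).Adj y y') (h : G.Adj x y) : (exchangeGraph G α β).Adj x y := by
  have h1 := hα.mem_or h
  have h2 := hβ.mem_or h
  have h3 := hx.2
  have h4 := hy.2
  exact ⟨h, by tauto⟩

/-- The exchange graph is bipartite, so its induced cycle is even, and it remains induced in `G`
because every vertex of a cycle has an exchange neighbour. -/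
theorem exists_even_cycle_isIndContained (hα : G.IsVertexCover (α : Set V))
    (hβ : G.IsVertexCover (β : Set V)) (h : ¬ (exchangeGraph G α β).IsAcyclic) :
    ∃ n, 4 ≤ n ∧ Even n ∧ (cycleGraph n).IsIndContained G := by
  classical
  obtain ⟨n, hn, ⟨f⟩⟩ := exists_cycleGraph_isIndContained h
  have hcol : (exchangeGraph G α β).Colorable 2 :=
    ⟨Coloring.mk (fun v => if v ∈ α then (0 : Fin 2) else 1) (by
      rintro x y ⟨-, h | h⟩ <;> simp [h])⟩
  have heven : Even n := by
    by_contra hodd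
    rw [Nat.not_even_iff_odd] at hodd
    have h1 : (cycleGraph n).Colorable 2 := Colorable.of_hom f.toHom hcol
    have h2 := h1.chromaticNumber_le
    rw [chromaticNumber_cycleGraph_of_odd n (by omega) hodd] at h2
    norm_cast at h2
  have h4 : 4 ≤ n := by
    rcases heven with ⟨m, hm⟩
    omega
  refine ⟨n, h4, heven, ⟨⟨f.toEmbedding, ?_⟩⟩⟩
  have nbr : ∀ i : Fin n, ∃ j, (cycleGraph n).Adj i j := by
    obtain ⟨m, rfl⟩ : ∃ m, n = m + 2 := ⟨n - 2, by omega⟩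
    intro i
    exact ⟨i + 1, by simp [cycleGraph_adj]⟩
  intro i j
  rw [← f.map_adj_iff]
  refine ⟨fun hij => ?_, fun hij => exchangeGraph_le _ _ _ hij⟩
  obtain ⟨i', hi⟩ := nbr i
  obtain ⟨j', hj⟩ := nbr j
  exact exchangeGraph_adj_of_adj hα hβ (f.map_adj_iff.2 hi) (f.map_adj_iff.2 hj) hij

/-- The exchange neighbours of a vertex all avoid the same cover, hence are pairwise non-adjacent;
three of them would form a claw. -/
theorem IsClawFree.maxDegreeLETwo_exchangeGraph (hα : G.IsVertexCover (α : Set V))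
    (hβ : G.IsVertexCover (β : Set V)) 
    (hG : IsClawFree G) :
    MaxDegreeLETwo (exchangeGraph G α β) := by
  intro v a b c ha hb hc
  by_contra! hcon
  obtain ⟨hab, hac, hbc⟩ := hcon
  have hind : ∀ x y, (exchangeGraph G α β).Adj v x → (exchangeGraph G α β).Adj v y →
      ¬ G.Adj x y := by
    intro x y hx hy hxy
    have h1 := hα.mem_or hxy
    have h2 := hβ.mem_or hxy
    have h3 := hx.2
    have h4 := hy.2
    tauto
  refine hG ⟨⟨⟨Sum.elim (fun _ => v) ![a, b, c], ?_⟩, ?_⟩⟩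
  · have ha' := ha.1.ne
    have hb' := hb.1.ne
    have hc' := hc.1.ne
    rintro (x | x) (y | y) hxy <;> fin_cases x <;> fin_cases y <;> simp_all
  · have hadj : ∀ x, (exchangeGraph G α β).Adj v (![a, b, c] x) := by
      intro x; fin_cases x <;> assumption
    rintro (x | x) (y | y)
    · exact iff_of_false (G.irrefl (v := v)) (by simp)
    · simpa using! (hadj y).1
    · simpa using! (hadj x).1.symm
    · simpa using! hind _ _ (hadj x) (hadj y)

theorem isCactus_exchangeGraph (hα : G.IsVertexCover (α : Set V))
    (hβ : G.IsVertexCover (β : Set V)) 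
    (h : IsCycleGraph G ∨ G.IsTree ∨ G.IsAcyclic ∨ IsChordal G ∨ IsCactus G ∨
      IsEvenHoleFree G ∨ IsClawFree G) : IsCactus (exchangeGraph G α β) := by
  rcases h with ⟨k, hk, ⟨f⟩⟩ | h | h | h | h | h | h
  · obtain ⟨n, rfl⟩ : ∃ n, k = n + 2 := ⟨k - 2, by omega⟩
    refine IsCactus.mono (exchangeGraph_le _ _ _) (MaxDegreeLETwo.isCactus ?_)
    intro v a b c ha hb hc
    have key : ∀ x, G.Adj v x → f.symm x = f.symm v + 1 ∨ f.symm x = f.symm v - 1 := by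
      intro x hx
      have := f.symm.map_adj_iff.2 hx
      rw [cycleGraph_adj] at this
      rcases this with h | h
      · right; rw [← h]; abel
      · left; rw [← h]; abel
    have inj := f.symm.injective
    rcases key a ha with h1 | h1 <;> rcases key b hb with h2 | h2 <;>
      rcases key c hc with h3 | h3
    all_goals first
      | exact Or.inl (inj (h1.trans h2.symm))
      | exact Or.inr (Or.inl (inj (h1.trans h3.symm)))
      | exact Or.inr (Or.inr (inj (h2.trans h3.symm)))
  · exact (h.isAcyclic.anti (exchangeGraph_le _ _ _)).isCactus
  · exact (h.anti (exchangeGraph_le _ _ _)).isCactus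
  · refine SimpleGraph.IsAcyclic.isCactus ?_
    by_contra hcon
    obtain ⟨n, hn, -, hc⟩ := exists_even_cycle_isIndContained hα hβ hcon
    exact h n hn hc
  · exact h.mono (exchangeGraph_le _ _ _)
  · refine SimpleGraph.IsAcyclic.isCactus ?_
    by_contra hcon
    obtain ⟨n, hn, he, hc⟩ := exists_even_cycle_isIndContained hα hβ hcon
    exact h n (by omega) he hc
  · exact (IsClawFree.maxDegreeLETwo_exchangeGraph hα hβ h).isCactus

end Covers

end Cactus

/-! ### Exchanging the sides of a bipartite cactus -/

section Exchange

open SimpleGraph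
open scoped Classical in
/-- The vertices of `A` all of whose neighbours in `B` lie in `X`. -/
noncomputable def freed {V : Type*} (H : SimpleGraph V) (A B X : Finset V) : Finset V :=
  A.filter fun a => ∀ b ∈ B, H.Adj a b → b ∈ X

variable {V : Type*}

/-- Two edges per vertex of `A` give `2 * |A|` edges of a forest on `|A| + |B|` vertices. The forest
is extended to a spanning tree of the complete graph, whose edge count is known. -/
theorem card_lt_of_isAcyclic {G : SimpleGraph V} (hG : G.IsAcyclic) {A B : Finset V}
    (hd : Disjoint A B) (hA : A.Nonempty) (b₁ b₂ : V → V)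
    (h₁ : ∀ a ∈ A, b₁ a ∈ B ∧ G.Adj a (b₁ a)) (h₂ : ∀ a ∈ A, b₂ a ∈ B ∧ G.Adj a (b₂ a))
    (hne : ∀ a ∈ A, b₁ a ≠ b₂ a) : A.card < B.card := by
  classical
  obtain ⟨a₀, ha₀⟩ := hA
  let S : Finset V := A ∪ B
  have memA : ∀ a ∈ A, a ∈ S := fun a h => Finset.mem_union_left _ h
  have memB : ∀ a ∈ B, a ∈ S := fun a h => Finset.mem_union_right _ h
  have : Nonempty S := ⟨⟨a₀, memA _ ha₀⟩⟩
  have hac : (G.induce (S : Set V)).IsAcyclic := hG.induce _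
  obtain ⟨F, hF, -, hT⟩ := (connected_top (V := S)).exists_isTree_le_of_le_of_isAcyclic
    le_top hac
  have hcard := hT.card_edgeFinset
  rw [Fintype.card_coe, Finset.card_union_of_disjoint hd] at hcard
  let g : A × Bool → Sym2 S := fun x =>
    s(⟨x.1, memA _ x.1.2⟩, if x.2 then ⟨b₁ x.1, memB _ (h₁ _ x.1.2).1⟩
      else ⟨b₂ x.1, memB _ (h₂ _ x.1.2).1⟩)
  have hg : Function.Injective g := by
    rintro ⟨⟨a, ha⟩, i⟩ ⟨⟨a', ha'⟩, i'⟩ h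
    have hAB : ∀ x ∈ A, ∀ y ∈ B, x ≠ y := fun x hx y hy e =>
      Finset.disjoint_left.1 hd hx (e ▸ hy)
    have e1 := hAB a ha _ (h₁ a' ha').1
    have e2 := hAB a ha _ (h₂ a' ha').1
    have e3 := hne a ha
    rcases i <;> rcases i' <;> simp [g] at h <;> grind
  have hmem : ∀ x, g x ∈ F.edgeFinset := by
    rintro ⟨⟨a, ha⟩, i⟩
    rw [mem_edgeFinset]
    refine hF (?_ : (G.induce (S : Set V)).Adj _ _)
    rcases i
    · simpa using (h₂ a ha).2
    · simpa using (h₁ a ha).2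
  have := Finset.card_le_card_of_injOn g (s := Finset.univ) (t := F.edgeFinset)
    (fun x _ => hmem x) hg.injOn
  rw [Finset.card_univ, Fintype.card_prod, Fintype.card_coe, Fintype.card_bool] at this
  omega

open scoped Classical in
-- Among three edges at `a`, some two lie on no common cycle: if `x` and `y` share a cycle, a cycle
-- through `x` and `z` would be the same one and would have three edges at `a`.
theorem IsCactus.exists_two_neighbors {H : SimpleGraph V} (hH : IsCactus H) {B : Finset V} {a : V}
    (hdeg : 2 ≤ (B.filter (H.Adj a)).card) :
    ∃ x y, x ≠ y ∧ (x ∈ B ∧ H.Adj a x) ∧ (y ∈ B ∧ H.Adj a y) ∧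
      (3 ≤ (B.filter (H.Adj a)).card → ∀ (u : V) (p : H.Walk u u), p.IsCycle →
        s(a, x) ∈ p.edges → s(a, y) ∉ p.edges) := by
  by_cases h3 : 3 ≤ (B.filter (H.Adj a)).card
  · obtain ⟨x, y, z, hx, hy, hz, hxy, hxz, hyz⟩ := Finset.two_lt_card_iff.1 h3
    simp only [Finset.mem_filter] at hx hy hz
    by_cases hc : ∃ (u : V) (p : H.Walk u u), p.IsCycle ∧ s(a, x) ∈ p.edges ∧ s(a, y) ∈ p.edges
    · obtain ⟨u, p, hp, hpx, hpy⟩ := hc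
      refine ⟨x, z, hxz, hx, hz, fun _ v q hq hqx hqz => ?_⟩
      have hpq := hH s(a, x) u v p q hp hq hpx hqx
      have hpz : s(a, z) ∈ p.edgeSet := hpq ▸ hqz
      obtain ⟨c, d, -, -, -, h⟩ := hp.exists_two_mem_edges (p.fst_mem_support_of_mem_edges hpx)
      have := h x hpx
      have := h y hpy
      have := h z hpz
      grind
    · refine ⟨x, y, hxy, hx, hy, fun _ v q hq hqx hqy => hc ⟨v, q, hq, hqx, hqy⟩⟩
  · obtain ⟨x, hx, y, hy, hxy⟩ := Finset.one_lt_card.1 hdeg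
    simp only [Finset.mem_filter] at hx hy
    exact ⟨x, y, hxy, hx, hy, fun h => (h3 h).elim⟩

open scoped Classical in
/-- If a cycle of a graph between `A` and `B` passes only through vertices of `A` that have two
neighbours in `B`, then its vertices can be listed alternately. -/
theorem SimpleGraph.Walk.IsCycle.exists_alternating {H F : SimpleGraph V} (hF : F ≤ H)
    {A B : Finset V} (hd : Disjoint A B)
    (hbip : ∀ x y, F.Adj x y → (x ∈ A ∧ y ∈ B) ∨ (x ∈ B ∧ y ∈ A)) {u : V} {p : F.Walk u u}
    (hp : p.IsCycle) (hu : u ∈ B)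
    (hdeg : ∀ a ∈ p.support, a ∈ A → (B.filter (H.Adj a)).card ≤ 2) :
    ∃ (n : ℕ) (a b : ℕ → V), 0 < n ∧ (∀ i < n, a i ∈ A) ∧ (∀ i < n, b i ∈ B) ∧
      Set.InjOn a (Set.Iio n) ∧ Set.InjOn b (Set.Iio n) ∧ b n = b 0 ∧
      ∀ i < n, ∀ x ∈ B, H.Adj (a i) x → x = b i ∨ x = b (i + 1) := by
  have hAB : ∀ x ∈ A, x ∉ B := fun x hx => Finset.disjoint_left.1 hd hx
  have alt : ∀ i, (2 * i ≤ p.length → p.getVert (2 * i) ∈ B) ∧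
      (2 * i + 1 ≤ p.length → p.getVert (2 * i + 1) ∈ A) := by
    have step : ∀ j, j < p.length → p.getVert j ∈ B → p.getVert (j + 1) ∈ A := fun j hj h => by
      rcases hbip _ _ (p.adj_getVert_succ hj) with h' | h'
      · exact (hAB _ h'.1 h).elim
      · exact h'.2
    have step' : ∀ j, j < p.length → p.getVert j ∈ A → p.getVert (j + 1) ∈ B := fun j hj h => by
      rcases hbip _ _ (p.adj_getVert_succ hj) with h' | h'
      · exact h'.2
      · exact (hAB _ h h'.1).elim
    intro i
    induction i with
    | zero => exact ⟨fun _ => by simpa using hu, fun h => step 0 (by omega) (by simpa using hu)⟩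
    | succ i ih =>
      have h1 : 2 * (i + 1) ≤ p.length → p.getVert (2 * (i + 1)) ∈ B := fun h =>
        step' (2 * i + 1) (by omega) (ih.2 (by omega))
      exact ⟨h1, fun h => step _ (by omega) (h1 (by omega))⟩
  have h3 := hp.three_le_length
  obtain ⟨n, hn⟩ | ⟨n, hn⟩ := p.length.even_or_odd
  · refine ⟨n, fun i => p.getVert (2 * i + 1), fun i => p.getVert (2 * i), by omega,
      fun i hi => (alt i).2 (by omega), fun i hi => (alt i).1 (by omega), ?_, ?_, ?_, ?_⟩
    · intro i hi j hj hij
      simp only [Set.mem_Iio] at hi hj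
      have := hp.getVert_injOn' (by simp; omega) (by simp; omega) hij
      omega
    · intro i hi j hj hij
      simp only [Set.mem_Iio] at hi hj
      have := hp.getVert_injOn' (by simp; omega) (by simp; omega) hij
      omega
    · simp [show 2 * n = p.length by omega]
    · intro i hi x hx hadj
      have hne := hp.getVert_sub_one_ne_getVert_add_one (i := 2 * i + 1) (by omega)
      have hsub : ({p.getVert (2 * i), p.getVert (2 * (i + 1))} : Finset V) ⊆
          B.filter (H.Adj (p.getVert (2 * i + 1))) := by
        intro y hy
        rw [Finset.mem_insert, Finset.mem_singleton] at hy
        rcases hy with rfl | rfl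
        · exact Finset.mem_filter.2 ⟨(alt i).1 (by omega),
            (hF (p.adj_getVert_succ (by omega))).symm⟩
        · exact Finset.mem_filter.2 ⟨(alt (i + 1)).1 (by omega),
            hF (p.adj_getVert_succ (i := 2 * i + 1) (by omega))⟩
      have hle := hdeg _ (p.getVert_mem_support (2 * i + 1)) ((alt i).2 (by omega))
      have hcard : ({p.getVert (2 * i), p.getVert (2 * (i + 1))} : Finset V).card = 2 :=
        Finset.card_pair hne
      -- The two cycle neighbours already exhaust the at most two neighbours in `B`.
      have heq := Finset.eq_of_subset_of_card_le hsub (by omega)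
      have : x ∈ B.filter (H.Adj (p.getVert (2 * i + 1))) := Finset.mem_filter.2 ⟨hx, hadj⟩
      rw [← heq, Finset.mem_insert, Finset.mem_singleton] at this
      exact this
  -- An odd closed walk would return to `u` on the wrong side.
  · have := (alt n).2 (by omega)
    rw [← hn, Walk.getVert_length] at this
    exact (hAB _ this hu).elim

open scoped Classical in
-- Two edges are selected at each vertex of `A`. Since `|B| ≤ |A|`, these are too many for a forest,
-- so they contain a cycle. At a vertex with three or more neighbours the selected pair lies on no
-- common cycle, so the cycle meets only vertices of degree two.
theorem IsCactus.exists_alternating_cycle {H : SimpleGraph V} (hH : IsCactus H) {A B : Finset V}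
    (hd : Disjoint A B) (hA : A.Nonempty) (hcard : B.card ≤ A.card)
    (hdeg : ∀ a ∈ A, 2 ≤ (B.filter (H.Adj a)).card) :
    ∃ (n : ℕ) (a b : ℕ → V), 0 < n ∧ (∀ i < n, a i ∈ A) ∧ (∀ i < n, b i ∈ B) ∧
      Set.InjOn a (Set.Iio n) ∧ Set.InjOn b (Set.Iio n) ∧ b n = b 0 ∧
      ∀ i < n, ∀ x ∈ B, H.Adj (a i) x → x = b i ∨ x = b (i + 1) := by
  have hAB : ∀ x ∈ A, x ∉ B := fun x hx => Finset.disjoint_left.1 hd hx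
  have hpick := fun a : A => hH.exists_two_neighbors (hdeg a a.2)
  have hpick' : ∀ a, ∃ x y, a ∈ A → (x ≠ y ∧ (x ∈ B ∧ H.Adj a x) ∧ (y ∈ B ∧ H.Adj a y) ∧
      (3 ≤ (B.filter (H.Adj a)).card → ∀ (u : V) (p : H.Walk u u), p.IsCycle →
        s(a, x) ∈ p.edges → s(a, y) ∉ p.edges)) := by
    intro a
    by_cases ha : a ∈ A
    · obtain ⟨x, y, h⟩ := hpick ⟨a, ha⟩
      exact ⟨x, y, fun _ => h⟩
    · exact ⟨a, a, fun h => (ha h).elim⟩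
  choose b₁ b₂ hb using hpick'
  let F : SimpleGraph V :=
    { Adj := fun x y => (x ∈ A ∧ (y = b₁ x ∨ y = b₂ x)) ∨ (y ∈ A ∧ (x = b₁ y ∨ x = b₂ y))
      symm := ⟨fun x y h => h.symm⟩
      loopless := ⟨fun x h => by
        have : ∀ x ∈ A, x ≠ b₁ x ∧ x ≠ b₂ x := fun x hx =>
          ⟨(hb x hx).2.1.2.ne, (hb x hx).2.2.1.2.ne⟩
        grind⟩ }
  have hFB : ∀ x y, F.Adj x y → x ∈ A → y ∈ B ∧ H.Adj x y ∧ (y = b₁ x ∨ y = b₂ x) := by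
    intro x y h hx
    have h1 := hb x hx
    have h2 := hb y
    have h3 := hAB x hx
    rcases h with ⟨-, rfl | rfl⟩ | ⟨hy, rfl | rfl⟩ <;> grind
  have hbip : ∀ x y, F.Adj x y → (x ∈ A ∧ y ∈ B) ∨ (x ∈ B ∧ y ∈ A) := by
    intro x y h
    rcases id h with ⟨hx, -⟩ | ⟨hx, -⟩
    · exact Or.inl ⟨hx, (hFB x y h hx).1⟩
    · exact Or.inr ⟨(hFB y x h.symm hx).1, hx⟩
  have hFH : F ≤ H := by
    intro x y h
    rcases id h with ⟨hx, -⟩ | ⟨hx, -⟩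
    · exact (hFB x y h hx).2.1
    · exact (hFB y x h.symm hx).2.1.symm
  have hcyc : ∃ (u : V) (p : F.Walk u u), p.IsCycle := by
    by_contra! hcon
    have hac : F.IsAcyclic := fun u p hp => hcon u p hp
    have := card_lt_of_isAcyclic hac hd hA b₁ b₂
      (fun a ha => ⟨(hb a ha).2.1.1, Or.inl ⟨ha, Or.inl rfl⟩⟩)
      (fun a ha => ⟨(hb a ha).2.2.1.1, Or.inl ⟨ha, Or.inr rfl⟩⟩) (fun a ha => (hb a ha).1)
    omega
  obtain ⟨u, p, hp, hu⟩ : ∃ (u : V) (p : F.Walk u u), p.IsCycle ∧ u ∈ B := by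
    obtain ⟨u, p, hp⟩ := hcyc
    have hadj : F.Adj u p.snd := p.adj_snd hp.not_nil
    rcases hbip _ _ hadj with ⟨-, h⟩ | ⟨h, -⟩
    · have hs : p.snd ∈ p.support := p.getVert_mem_support 1
      exact ⟨p.snd, p.rotate _ hs, hp.rotate hs, h⟩
    · exact ⟨u, p, hp, h⟩
  -- Both cycle edges at `a` belong to the selected pair, which for degree at least three is
  -- forbidden by the choice of `b₁` and `b₂`.
  refine hp.exists_alternating hFH hd hbip hu fun a ha haA => ?_
  by_contra! h3
  obtain ⟨x, y, hxy, hx, hy, -⟩ := hp.exists_two_mem_edges ha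
  have h1 := (hFB a x (p.adj_of_mem_edges hx) haA).2.2
  have h2 := (hFB a y (p.adj_of_mem_edges hy) haA).2.2
  have hnot := (hb a haA).2.2.2 h3 u (p.mapLe hFH) (hp.mapLe hFH)
  rw [Walk.edges_mapLe_eq_edges] at hnot
  rcases h1 with rfl | rfl <;> rcases h2 with rfl | rfl
  · exact hxy rfl
  · exact hnot hx hy
  · exact hnot hy hx
  · exact hxy rfl

theorem mem_freed {H : SimpleGraph V} {A B X : Finset V} {a : V} :
    a ∈ freed H A B X ↔ a ∈ A ∧ ∀ b ∈ B, H.Adj a b → b ∈ X := by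
  classical
  simp [freed]

theorem freed_mono {H : SimpleGraph V} {A B X Y : Finset V} (h : X ⊆ Y) :
    freed H A B X ⊆ freed H A B Y := fun a ha => by
  rw [mem_freed] at ha ⊢
  exact ⟨ha.1, fun b hb hab => h (ha.2 b hb hab)⟩

/-- Adding one vertex of `B`, such that at most one more vertex of `B` is present than vertices
of `A` are freed. -/
def ExchangeStep (H : SimpleGraph V) (A B X Y : Finset V) : Prop :=
  X ⊆ Y ∧ Y ⊆ B ∧ Y.card = X.card + 1 ∧ Y.card ≤ (freed H A B Y).card + 1

open Relation in
-- With slack, any vertex can be inserted. Without slack, either an unfreed vertex lacks a single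
-- neighbour, whose insertion pays for itself, or all lack at least two, and then an alternating
-- cycle is inserted in cyclic order: the debt is at most one on the way and is repaid when the
-- cycle closes.
theorem IsCactus.exists_exchangeStep_chain {H : SimpleGraph V} (hH : IsCactus H) {A B : Finset V}
    (hd : Disjoint A B) (hcard : B.card ≤ A.card) {X : Finset V} (hX : X ⊆ B) (hXB : X ≠ B)
    (hfree : X.card ≤ (freed H A B X).card) :
    ∃ Y, Y ⊆ B ∧ X.card < Y.card ∧ Y.card ≤ (freed H A B Y).card ∧
      ReflTransGen (ExchangeStep H A B) X Y := by
  classical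
  have hss : X ⊂ B := hX.ssubset_of_ne hXB
  rcases hfree.lt_or_eq with hlt | heq
  · obtain ⟨b, hb, hbX⟩ := Finset.exists_of_ssubset hss
    have h1 : (insert b X).card = X.card + 1 := Finset.card_insert_of_notMem hbX
    have h2 := Finset.card_le_card (freed_mono (H := H) (A := A) (B := B)
      (Finset.subset_insert b X))
    have h3 : insert b X ⊆ B := Finset.insert_subset hb hX
    exact ⟨insert b X, h3, by omega, by omega,
      .single ⟨Finset.subset_insert b X, h3, h1, by omega⟩⟩
  · set A' := A \ freed H A B X with hA'
    set B' := B \ X with hB'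
    have hsubA : freed H A B X ⊆ A := fun a ha => (mem_freed.1 ha).1
    have cA := Finset.card_sdiff_add_card_eq_card hsubA
    have cB := Finset.card_sdiff_add_card_eq_card hX
    have hlt := Finset.card_lt_card hss
    rw [← hA'] at cA
    rw [← hB'] at cB
    have hA'ne : A'.Nonempty := Finset.card_pos.1 (by omega)
    by_cases hdeg : ∀ a ∈ A', 2 ≤ (B'.filter (H.Adj a)).card
    · have hd' : Disjoint A' B' :=
        Finset.disjoint_of_subset_left Finset.sdiff_subset
          (Finset.disjoint_of_subset_right Finset.sdiff_subset hd)
      obtain ⟨n, a, b, hn, ha, hb, ainj, binj, hbn, hnbr⟩ :=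
        hH.exists_alternating_cycle hd' hA'ne (by omega) hdeg
      let Y : ℕ → Finset V := fun j => X ∪ (Finset.range j).image b
      have imgcard : ∀ (f : ℕ → V), Set.InjOn f (Set.Iio n) → ∀ j ≤ n,
          ((Finset.range j).image f).card = j := fun f hf j hj => by
        rw [Finset.card_image_of_injOn, Finset.card_range]
        exact hf.mono fun i hi => by
          have := Finset.mem_range.1 (Finset.mem_coe.1 hi)
          simp only [Set.mem_Iio]; omega
      have Ycard : ∀ j ≤ n, (Y j).card = X.card + j := fun j hj => by
        rw [Finset.card_union_of_disjoint, imgcard b binj j hj]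
        rw [Finset.disjoint_right]
        intro x hx
        obtain ⟨i, hi, rfl⟩ := Finset.mem_image.1 hx
        exact (Finset.mem_sdiff.1 (hb i (by have := Finset.mem_range.1 hi; omega))).2
      have Ysub : ∀ j ≤ n, Y j ⊆ B := fun j hj => by
        refine Finset.union_subset hX fun x hx => ?_
        obtain ⟨i, hi, rfl⟩ := Finset.mem_image.1 hx
        exact (Finset.mem_sdiff.1 (hb i (by have := Finset.mem_range.1 hi; omega))).1
      have Yfreed : ∀ j m, m ≤ n → (∀ i < m, b i ∈ Y j ∧ b (i + 1) ∈ Y j) →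
          X.card + m ≤ (freed H A B (Y j)).card := by
        intro j m hm hmem
        have hdis : Disjoint (freed H A B X) ((Finset.range m).image a) := by
          rw [Finset.disjoint_right]
          intro x hx
          obtain ⟨i, hi, rfl⟩ := Finset.mem_image.1 hx
          exact (Finset.mem_sdiff.1 (ha i (by have := Finset.mem_range.1 hi; omega))).2
        rw [heq, ← imgcard a ainj m hm, ← Finset.card_union_of_disjoint hdis]
        refine Finset.card_le_card (Finset.union_subset
          (freed_mono Finset.subset_union_left) fun x hx => ?_)
        obtain ⟨i, hi, rfl⟩ := Finset.mem_image.1 hx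
        have hi' := Finset.mem_range.1 hi
        have hai := ha i (by omega)
        refine mem_freed.2 ⟨(Finset.mem_sdiff.1 hai).1, fun y hy hadj => ?_⟩
        by_cases hyX : y ∈ X
        · exact Finset.mem_union_left _ hyX
        · rcases hnbr i (by omega) y (Finset.mem_sdiff.2 ⟨hy, hyX⟩) hadj with rfl | rfl
          · exact (hmem i hi').1
          · exact (hmem i hi').2
      have memY : ∀ i j, i < j → b i ∈ Y j := fun i j hij =>
        Finset.mem_union_right _ (Finset.mem_image_of_mem _ (Finset.mem_range.2 hij))
      have chain : ∀ j ≤ n, ReflTransGen (ExchangeStep H A B) X (Y j) := by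
        intro j
        induction j with
        | zero => intro _; simp only [Y, Finset.range_zero, Finset.image_empty,
            Finset.union_empty]; exact .refl
        | succ j ih =>
          intro hj
          refine (ih (by omega)).tail ⟨?_, Ysub _ hj, ?_, ?_⟩
          · exact Finset.union_subset_union_right (Finset.image_subset_image
              (Finset.range_subset_range.2 (by omega)))
          · rw [Ycard _ hj, Ycard _ (by omega)]; omega
          -- Inserting `b 0, …, b j` frees `a 0, …, a (j - 1)`, so the count is one behind.
          · have := Yfreed (j + 1) j (by omega) fun i hi =>
              ⟨memY _ _ (by omega), memY _ _ (by omega)⟩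
            rw [Ycard _ hj]; omega
      refine ⟨Y n, Ysub n le_rfl, by rw [Ycard n le_rfl]; omega, ?_, chain n le_rfl⟩
      rw [Ycard n le_rfl]
      -- The last vertex `a (n - 1)` needs `b n = b 0`, which is present already.
      refine Yfreed n n le_rfl fun i hi => ⟨memY _ _ hi, ?_⟩
      rcases Nat.lt_or_ge (i + 1) n with h | h
      · exact memY _ _ h
      · rw [show i + 1 = n by omega, hbn]; exact memY _ _ hn
    · push Not at hdeg
      obtain ⟨a, ha, hle⟩ := hdeg
      obtain ⟨haA, haf⟩ := Finset.mem_sdiff.1 ha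
      rw [mem_freed] at haf
      push Not at haf
      obtain ⟨b, hb, hab, hbX⟩ := haf haA
      have hbf : b ∈ B'.filter (H.Adj a) :=
        Finset.mem_filter.2 ⟨Finset.mem_sdiff.2 ⟨hb, hbX⟩, hab⟩
      have h1 : (insert b X).card = X.card + 1 := Finset.card_insert_of_notMem hbX
      have h3 : insert b X ⊆ B := Finset.insert_subset hb hX
      have h4 : insert a (freed H A B X) ⊆ freed H A B (insert b X) := by
        refine Finset.insert_subset ?_ (freed_mono (Finset.subset_insert b X))
        refine mem_freed.2 ⟨haA, fun y hy hay => ?_⟩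
        by_cases hyX : y ∈ X
        · exact Finset.mem_insert_of_mem hyX
        · have hyf : y ∈ B'.filter (H.Adj a) :=
            Finset.mem_filter.2 ⟨Finset.mem_sdiff.2 ⟨hy, hyX⟩, hay⟩
          rw [Finset.card_le_one.1 (by omega) y hyf b hbf]
          exact Finset.mem_insert_self _ _
      have h5 := Finset.card_le_card h4
      rw [Finset.card_insert_of_notMem (Finset.mem_sdiff.1 ha).2] at h5
      exact ⟨insert b X, h3, by omega, by omega,
        .single ⟨Finset.subset_insert b X, h3, h1, by omega⟩⟩

open Relation in
theorem IsCactus.reflTransGen_exchangeStep {H : SimpleGraph V} (hH : IsCactus H) {A B : Finset V}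
    (hd : Disjoint A B) (hcard : B.card ≤ A.card) :
    ReflTransGen (ExchangeStep H A B) ∅ B := by
  have key : ∀ m, ∀ X ⊆ B, B.card - X.card ≤ m → X.card ≤ (freed H A B X).card →
      ReflTransGen (ExchangeStep H A B) X B := by
    intro m
    induction m with
    | zero =>
      intro X hX h0 _
      rw [Finset.eq_of_subset_of_card_le hX (by omega)]
    | succ m ih =>
      intro X hX hm hf
      by_cases hXB : X = B
      · rw [hXB]
      · obtain ⟨Y, hY, hlt, hf', hXY⟩ := hH.exists_exchangeStep_chain hd hcard hX hXB hf
        exact hXY.trans (ih Y hY (by omega) hf')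
  exact key _ ∅ (Finset.empty_subset _) le_rfl (by simp)

open Relation in
-- Indexing the chain by time, constant from `|Y|` on, lets it be sampled at multiples of a chunk
-- size: `d` further steps add at most `d` vertices.
theorem exists_seq_of_exchangeStep {H : SimpleGraph V} {A B Y : Finset V}
    (h : ReflTransGen (ExchangeStep H A B) ∅ Y) :
    ∃ X : ℕ → Finset V, X 0 = ∅ ∧ (∀ i, Y.card ≤ i → X i = Y) ∧ Monotone X ∧
      (∀ i d, (X (i + d)).card ≤ (X i).card + d) ∧
      ∀ i, (X i).card ≤ (freed H A B (X i)).card + 1 := by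
  suffices ∃ X : ℕ → Finset V, X 0 = ∅ ∧ (∀ i, Y.card ≤ i → X i = Y) ∧ Monotone X ∧
      (∀ i, (X (i + 1)).card ≤ (X i).card + 1) ∧
      ∀ i, (X i).card ≤ (freed H A B (X i)).card + 1 by
    obtain ⟨X, h0, h1, h2, h3, h4⟩ := this
    refine ⟨X, h0, h1, h2, fun i d => ?_, h4⟩
    induction d with
    | zero => simp
    | succ d ih => have := h3 (i + d); rw [← add_assoc]; omega
  induction h with
  | refl =>
    exact ⟨fun _ => ∅, rfl, fun _ _ => rfl, monotone_const, by simp, by simp⟩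
  | @tail Y Z _ hYZ ih =>
    obtain ⟨X, h0, h1, h2, h3, h4⟩ := ih
    obtain ⟨hsub, -, hc, hf⟩ := hYZ
    refine ⟨fun i => if i ≤ Y.card then X i else Z, by simpa using h0, fun i hi => ?_, ?_, ?_, ?_⟩
    · simp [show ¬ i ≤ Y.card by omega]
    · refine monotone_nat_of_le_succ fun i => ?_
      rcases lt_trichotomy i Y.card with h | h | h
      · simp only [show i ≤ Y.card by omega, show i + 1 ≤ Y.card by omega, if_true]
        exact h2 (by omega)
      · simp only [h, le_refl, if_true, show ¬ Y.card + 1 ≤ Y.card by omega, if_false]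
        rw [h1 _ le_rfl]; exact hsub
      · simp [show ¬ i ≤ Y.card by omega, show ¬ i + 1 ≤ Y.card by omega]
    · intro i
      rcases lt_trichotomy i Y.card with h | h | h
      · simp only [show i ≤ Y.card by omega, show i + 1 ≤ Y.card by omega, if_true]
        exact h3 i
      · simp only [h, le_refl, if_true, show ¬ Y.card + 1 ≤ Y.card by omega, if_false]
        rw [h1 _ le_rfl]; omega
      · simp [show ¬ i ≤ Y.card by omega, show ¬ i + 1 ≤ Y.card by omega]
    · intro i
      by_cases h : i ≤ Y.card
      · simp only [h, if_true]; exact h4 i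
      · simp only [h, if_false]; exact hf

/-! ### From single insertions to batches. -/

/-- `S 0, …, S m` replaces `A` by `B`, in batches within `A` or within `B`, covering all edges
of `H` between `A` and `B`, and keeping at most `c` vertices in the union of consecutive sets. -/
structure IsExchange {V : Type*} [DecidableEq V] (H : SimpleGraph V) (A B : Finset V) (m c : ℕ)
    (S : ℕ → Finset V) : Prop where
  zero : S 0 = A
  eq_of_le : ∀ i, m ≤ i → S i = B
  subset : ∀ i, S i ⊆ A ∪ B
  cover : ∀ i, ∀ a ∈ A, ∀ b ∈ B, H.Adj a b → a ∈ S i ∨ b ∈ S i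
  batch : ∀ i, (∀ x ∈ B, x ∈ S i ↔ x ∈ S (i + 1)) ∨ (∀ x ∈ A, x ∈ S i ↔ x ∈ S (i + 1))
  cost : ∀ i, (S i ∪ S (i + 1)).card ≤ c

/-- Insertions of chunks of `s` vertices alternate with removals of everything freed. During a chunk
at most `|A| + 1` vertices are present beforehand and at most `s` are added. -/
theorem IsCactus.exists_isExchange_of_card_le [DecidableEq V] {H : SimpleGraph V} (hH : IsCactus H)
    {A B : Finset V} (hd : Disjoint A B) (hcard : B.card ≤ A.card) {k s : ℕ}
    (hk : B.card ≤ s * k) : ∃ S, IsExchange H A B (2 * k + 1) (A.card + 1 + s) S := by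
  obtain ⟨X, h0, h1, h2, h3, h4⟩ :=
    exists_seq_of_exchangeStep (hH.reflTransGen_exchangeStep hd hcard)
  have hXB : ∀ i, X i ⊆ B := fun i => by
    have := h2 (le_max_left i B.card)
    rwa [h1 _ (le_max_right _ _)] at this
  have hAB : ∀ x ∈ A, x ∉ B := fun x hx => Finset.disjoint_left.1 hd hx
  -- Even indices follow a removal and odd ones an insertion. The schedule is `T` shifted by one,
  -- because its first step removes the vertices of `A` without any neighbour in `B`.
  let T : ℕ → Finset V := fun i => (A \ freed H A B (X (s * (i / 2)))) ∪ X (s * ((i + 1) / 2))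
  have hfA : ∀ i, freed H A B (X i) ⊆ A := fun i a ha => (mem_freed.1 ha).1
  have memT : ∀ i x, x ∈ T i ↔ (x ∈ A ∧ x ∉ freed H A B (X (s * (i / 2)))) ∨
      x ∈ X (s * ((i + 1) / 2)) := by
    intro i x; simp [T]
  have cost : ∀ i, (T i ∪ T (i + 1)).card ≤ A.card + 1 + s := by
    intro i
    have hsub : T i ∪ T (i + 1) ⊆
        (A \ freed H A B (X (s * (i / 2)))) ∪ X (s * (i / 2) + s) := by
      intro x hx
      rw [Finset.mem_union, memT, memT] at hx
      rw [Finset.mem_union, Finset.mem_sdiff]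
      have m1 : freed H A B (X (s * (i / 2))) ⊆ freed H A B (X (s * ((i + 1) / 2))) :=
        freed_mono (h2 (Nat.mul_le_mul_left _ (by omega)))
      have m2 : X (s * ((i + 1) / 2)) ⊆ X (s * (i / 2) + s) := h2 (by
        rw [← Nat.mul_succ]; exact Nat.mul_le_mul_left _ (by omega))
      have m3 : X (s * ((i + 1 + 1) / 2)) ⊆ X (s * (i / 2) + s) := h2 (by
        rw [← Nat.mul_succ]; exact Nat.mul_le_mul_left _ (by omega))
      rcases hx with (hx | hx) | (hx | hx)
      · exact Or.inl hx
      · exact Or.inr (m2 hx)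
      · exact Or.inl ⟨hx.1, fun h => hx.2 (m1 h)⟩
      · exact Or.inr (m3 hx)
    have c1 := (Finset.card_le_card hsub).trans (Finset.card_union_le _ _)
    have c2 := Finset.card_sdiff_add_card_eq_card (hfA (s * (i / 2)))
    have c3 := h3 (s * (i / 2)) s
    have c4 := h4 (s * (i / 2))
    omega
  refine ⟨fun i => if i = 0 then A else T (i - 1), by simp, ?_, ?_, ?_, ?_, ?_⟩
  · intro i hi
    simp only [show i ≠ 0 by omega, if_false]
    have e1 : B.card ≤ s * ((i - 1) / 2) := hk.trans (Nat.mul_le_mul_left _ (by omega))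
    have e2 : B.card ≤ s * ((i - 1 + 1) / 2) := hk.trans (Nat.mul_le_mul_left _ (by omega))
    ext x
    rw [memT, h1 _ e1, h1 _ e2, mem_freed]
    exact ⟨fun h => h.elim (fun h => (h.2 ⟨h.1, fun b hb _ => hb⟩).elim) id, Or.inr⟩
  · intro i x hx
    by_cases hi : i = 0
    · simp only [hi, if_true] at hx; exact Finset.mem_union_left _ hx
    · simp only [hi, if_false, memT] at hx
      rcases hx with hx | hx
      · exact Finset.mem_union_left _ hx.1
      · exact Finset.mem_union_right _ (hXB _ hx)
  · intro i a ha b hb hab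
    by_cases hi : i = 0
    · simp [hi, ha]
    · simp only [hi, if_false, memT]
      by_cases hf : a ∈ freed H A B (X (s * ((i - 1) / 2)))
      · exact Or.inr (Or.inr (h2 (Nat.mul_le_mul_left _ (by omega)) ((mem_freed.1 hf).2 b hb hab)))
      · exact Or.inl (Or.inl ⟨ha, hf⟩)
  · intro i
    rcases i with _ | i
    · left
      intro x hx
      have hxA : x ∉ A := fun h => hAB x h hx
      simp [memT, hxA, h0]
    · simp only [Nat.succ_ne_zero, if_false, Nat.add_sub_cancel, memT]
      rcases Nat.even_or_odd' i with ⟨j, rfl | rfl⟩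
      · right
        intro x hx
        have : ∀ n, x ∉ X n := fun n h => hAB x hx (hXB n h)
        simp only [this, or_false, show (2 * j + 1) / 2 = 2 * j / 2 by omega]
      · left
        intro x hx
        have hxA : x ∉ A := fun h => hAB x h hx
        simp only [hxA, false_and, false_or,
          show (2 * j + 1 + 1 + 1) / 2 = (2 * j + 1 + 1) / 2 by omega]
  · intro i
    rcases i with _ | i
    · simp only [if_true, Nat.succ_ne_zero, if_false, Nat.add_sub_cancel]
      refine le_trans (Finset.card_le_card (t := A) ?_) (by omega)
      refine Finset.union_subset le_rfl fun x hx => ?_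
      rw [memT] at hx
      exact hx.elim And.left (by simp [h0])
    · simp only [Nat.succ_ne_zero, if_false, Nat.add_sub_cancel]
      exact cost i

theorem IsExchange.reverse [DecidableEq V] {H : SimpleGraph V} {A B : Finset V} {m c : ℕ} {S : ℕ → Finset V}
    (h : IsExchange H A B m c S) : IsExchange H B A m c fun i => S (m - i) where
  zero := h.eq_of_le _ (by omega)
  eq_of_le i hi := by rw [Nat.sub_eq_zero_of_le hi]; exact h.zero
  subset i := (h.subset _).trans (Finset.union_comm A B).subset
  cover i b hb a ha hba := (h.cover _ a ha b hb hba.symm).symm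
  batch i := by
    rcases Nat.lt_or_ge i m with hi | hi
    · have := h.batch (m - (i + 1))
      rw [show m - (i + 1) + 1 = m - i by omega] at this
      rcases this with this | this
      · exact Or.inr fun x hx => (this x hx).symm
      · exact Or.inl fun x hx => (this x hx).symm
    · left; intro x _; rw [Nat.sub_eq_zero_of_le hi, Nat.sub_eq_zero_of_le (by omega)]
  cost i := by
    rcases Nat.lt_or_ge i m with hi | hi
    · have := h.cost (m - (i + 1))
      rw [show m - (i + 1) + 1 = m - i by omega, Finset.union_comm] at this
      exact this
    · have := h.cost 0
      refine le_trans (Finset.card_le_card ?_) this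
      rw [Nat.sub_eq_zero_of_le hi, Nat.sub_eq_zero_of_le (by omega), Finset.union_self]
      exact Finset.subset_union_left

theorem IsCactus.exists_isExchange [DecidableEq V] {H : SimpleGraph V} (hH : IsCactus H) {A B : Finset V}
    (hd : Disjoint A B) {k s : ℕ} (hA : A.card ≤ s * k) (hB : B.card ≤ s * k) :
    ∃ S, IsExchange H A B (2 * k + 1) (max A.card B.card + 1 + s) S := by
  rcases le_total B.card A.card with h | h
  · rw [max_eq_left h]
    exact hH.exists_isExchange_of_card_le hd h hB
  · rw [max_eq_right h]
    obtain ⟨S, hS⟩ := hH.exists_isExchange_of_card_le hd.symm h hA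
    exact ⟨_, hS.reverse⟩

end Exchange

/-! ### Edges between connected parts of a cactus -/

section Clusters

open SimpleGraph

variable {V W : Type*}

/-- The edges of `G` between vertices with the same label. -/
def clusterGraph (G : SimpleGraph V) (cl : V → W) : SimpleGraph V where
  Adj x y := G.Adj x y ∧ cl x = cl y
  symm := ⟨fun _ _ h => ⟨h.1.symm, h.2.symm⟩⟩
  loopless := ⟨fun _ h => h.1.ne rfl⟩

theorem clusterGraph_le (G : SimpleGraph V) (cl : V → W) : clusterGraph G cl ≤ G :=
  fun _ _ h => h.1

theorem clusterGraph_mono {U : Type*} (G : SimpleGraph V) {cl : V → W} {cl' : V → U}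
    (h : ∀ x y, cl x = cl y → cl' x = cl' y) : clusterGraph G cl ≤ clusterGraph G cl' :=
  fun _ _ hxy => ⟨hxy.1, h _ _ hxy.2⟩

theorem clusterGraph_label_eq {G : SimpleGraph V} {cl : V → W} {x y : V}
    (h : (clusterGraph G cl).Reachable x y) : cl x = cl y := by
  obtain ⟨p⟩ := h
  induction p with
  | nil => rfl
  | cons h _ ih => exact h.2.trans ih

/-- Vertices with the same label that have neighbours with other labels are connected by vertices
with this label. -/
def BoundaryConnected (G : SimpleGraph V) (cl : V → W) : Prop :=
  ∀ x y x' y', cl x = cl x' → G.Adj x y → cl y ≠ cl x → G.Adj x' y' → cl y' ≠ cl x' →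
    (clusterGraph G cl).Reachable x x'

/-- Two distinct edges between the same two clusters are closed up to a cycle inside the clusters,
since their ends are boundary vertices. That no further crossing edge occurs on it is what limits
the number of such edges. -/
theorem BoundaryConnected.exists_isCycle {H : SimpleGraph V} {cl : V → W}
    (hJ : BoundaryConnected H cl) {x₁ y₁ x₂ y₂ : V} (h₁ : H.Adj x₁ y₁) (h₂ : H.Adj x₂ y₂)
    (hx : cl x₁ = cl x₂) (hy : cl y₁ = cl y₂) (hxy : cl x₁ ≠ cl y₁)
    (hne : (x₁, y₁) ≠ (x₂, y₂)) :
    ∃ (u : V) (p : H.Walk u u), p.IsCycle ∧ s(x₁, y₁) ∈ p.edges ∧ s(x₂, y₂) ∈ p.edges ∧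
      ∀ e ∈ p.edges, e = s(x₁, y₁) ∨ e = s(x₂, y₂) ∨ e ∈ (clusterGraph H cl).edgeSet := by
  classical
  set C := clusterGraph H cl
  let Z : SimpleGraph V := C ⊔ edge y₂ x₂
  have hCZ : C ≤ Z := le_sup_left
  have hedge : Z.Adj y₂ x₂ := Or.inr (by simp [edge_adj, h₂.ne'])
  have hZe : ∀ e ∈ Z.edgeSet, e = s(x₂, y₂) ∨ e ∈ C.edgeSet := by
    intro e he
    induction e with | h a b
    rcases he with he | he
    · exact Or.inr he
    · rw [edge_adj] at he
      left
      rcases he.1 with ⟨rfl, rfl⟩ | ⟨rfl, rfl⟩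
      · exact Sym2.eq_swap
      · rfl
  have hZH : Z ≤ H := sup_le (clusterGraph_le H cl) (by rw [edge_le_iff]; exact Or.inr h₂.symm)
  have hreach : Z.Reachable y₁ x₁ :=
    ((hJ y₁ x₁ y₂ x₂ hy h₁.symm hxy h₂.symm (by rwa [← hx, ← hy])).mono hCZ).trans
      (hedge.reachable.trans ((hJ x₂ y₂ x₁ y₁ hx.symm h₂ (by rw [← hx, ← hy]; exact hxy.symm)
        h₁ hxy.symm).mono hCZ))
  obtain ⟨p, hp⟩ := hreach.exists_isPath
  have h12 : s(x₁, y₁) ≠ s(x₂, y₂) := by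
    intro h
    rw [Sym2.eq_iff] at h
    rcases h with ⟨rfl, rfl⟩ | ⟨rfl, rfl⟩
    · exact hne rfl
    · exact hxy hx
  have he1 : s(x₁, y₁) ∉ p.edges := fun h => by
    rcases hZe _ (p.edges_subset_edgeSet h) with h | h
    · exact h12 h
    · exact hxy h.2
  -- Without the second edge the path would stay within one cluster.
  have he2 : s(x₂, y₂) ∈ p.edges := by
    by_contra hcon
    have : C.Reachable y₁ x₁ := ⟨p.transfer C fun e he => by
      rcases hZe e (p.edges_subset_edgeSet he) with rfl | h
      · exact (hcon he).elim
      · exact h⟩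
    exact hxy (clusterGraph_label_eq this).symm
  refine ⟨x₁, .cons h₁ (p.mapLe hZH), ?_, ?_, ?_, ?_⟩
  · rw [Walk.cons_isCycle_iff, Walk.edges_mapLe_eq_edges]
    exact ⟨hp.mapLe hZH, he1⟩
  · simp
  · simp [he2]
  · intro e he
    rw [Walk.edges_cons, Walk.edges_mapLe_eq_edges, List.mem_cons] at he
    rcases he with rfl | he
    · exact Or.inl rfl
    · exact Or.inr (hZe e (p.edges_subset_edgeSet he))

/-- The cycle through the first two edges and the cycle through the first and third share an edge,
hence coincide; but the latter crosses between clusters only at the first and third edge. -/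
theorem IsCactus.not_three_edges_between {H : SimpleGraph V} (hH : IsCactus H) {cl : V → W}
    (hJ : BoundaryConnected H cl) {r r' : W} (hr : r ≠ r') {e₁ e₂ e₃ : V × V}
    (h₁ : H.Adj e₁.1 e₁.2 ∧ cl e₁.1 = r ∧ cl e₁.2 = r')
    (h₂ : H.Adj e₂.1 e₂.2 ∧ cl e₂.1 = r ∧ cl e₂.2 = r')
    (h₃ : H.Adj e₃.1 e₃.2 ∧ cl e₃.1 = r ∧ cl e₃.2 = r')
    (h12 : e₁ ≠ e₂) (h13 : e₁ ≠ e₃) (h23 : e₂ ≠ e₃) : False := by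
  obtain ⟨x₁, y₁⟩ := e₁
  obtain ⟨x₂, y₂⟩ := e₂
  obtain ⟨x₃, y₃⟩ := e₃
  obtain ⟨a1, b1, c1⟩ := h₁
  obtain ⟨a2, b2, c2⟩ := h₂
  obtain ⟨a3, b3, c3⟩ := h₃
  simp only at a1 b1 c1 a2 b2 c2 a3 b3 c3
  have hr1 : cl x₁ ≠ cl y₁ := by rw [b1, c1]; exact hr
  obtain ⟨u, p, hp, hp1, hp2, -⟩ :=
    hJ.exists_isCycle a1 a2 (b1.trans b2.symm) (c1.trans c2.symm) hr1 h12
  obtain ⟨v, q, hq, hq1, -, hq3⟩ :=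
    hJ.exists_isCycle a1 a3 (b1.trans b3.symm) (c1.trans c3.symm) hr1 h13
  have heq := hH _ u v p q hp hq hp1 hq1
  have hq2 : s(x₂, y₂) ∈ q.edgeSet := heq ▸ hp2
  have hne : ∀ x y, cl x = r → cl y = r' → s(x₂, y₂) = s(x, y) → (x₂, y₂) = (x, y) := by
    intro x y hx hy h
    rw [Sym2.eq_iff] at h
    rcases h with ⟨rfl, rfl⟩ | ⟨rfl, rfl⟩
    · rfl
    · exact (hr (b2.symm.trans hy)).elim
  rcases hq3 _ hq2 with h | h | h
  · exact h12 (hne _ _ b1 c1 h).symm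
  · exact h23 (hne _ _ b3 c3 h)
  · have h' : cl x₂ = cl y₂ := h.2
    rw [b2, c2] at h'
    exact hr h'

open scoped Classical in
/-- The edges of `H` from `A` to the complement of `A` between differently labelled vertices. -/
noncomputable def cutPairs [Fintype V] (H : SimpleGraph V) (A : Finset V) (cl : V → W) :
    Finset (V × V) :=
  Finset.univ.filter fun p => p.1 ∈ A ∧ p.2 ∉ A ∧ H.Adj p.1 p.2 ∧ cl p.1 ≠ cl p.2

open scoped Classical in
/-- The labels of vertices with differently labelled neighbours. -/
noncomputable def openLabels [Fintype V] (H : SimpleGraph V) (cl : V → W) : Finset W :=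
  (Finset.univ.filter fun x => ∃ y, H.Adj x y ∧ cl y ≠ cl x).image cl

theorem mem_openLabels [Fintype V] {H : SimpleGraph V} {cl : V → W} {r : W} :
    r ∈ openLabels H cl ↔ ∃ x y, H.Adj x y ∧ cl y ≠ cl x ∧ cl x = r := by
  simp only [openLabels, Finset.mem_image, Finset.mem_filter, Finset.mem_univ, true_and]
  constructor
  · rintro ⟨x, ⟨y, h1, h2⟩, h3⟩; exact ⟨x, y, h1, h2, h3⟩
  · rintro ⟨x, y, h1, h2, h3⟩; exact ⟨x, ⟨y, h1, h2⟩, h3⟩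

theorem mem_cutPairs [Fintype V] {H : SimpleGraph V} {A : Finset V} {cl : V → W} {p : V × V} :
    p ∈ cutPairs H A cl ↔ p.1 ∈ A ∧ p.2 ∉ A ∧ H.Adj p.1 p.2 ∧ cl p.1 ≠ cl p.2 := by
  simp [cutPairs]

/-- Merging two clusters joined by an edge removes one open label and at most two crossing edges,
and keeps boundaries connected. Without open labels there is no crossing edge. -/
theorem IsCactus.card_cutPairs_le [Fintype V] {H : SimpleGraph V} (hH : IsCactus H)
    (A : Finset V) {cl : V → W} (hJ : BoundaryConnected H cl) :
    (cutPairs H A cl).card ≤ 2 * (openLabels H cl).card := by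
  classical
  suffices ∀ n, ∀ cl : V → W, BoundaryConnected H cl → (openLabels H cl).card ≤ n →
      (cutPairs H A cl).card ≤ 2 * n from this _ cl hJ le_rfl
  intro n
  induction n with
  | zero =>
    intro cl _ h0
    have h0 : openLabels H cl = ∅ := Finset.card_eq_zero.1 (by omega)
    rw [Finset.card_eq_zero.2, mul_zero]
    refine Finset.eq_empty_of_forall_notMem fun p hp => ?_
    obtain ⟨-, -, h1, h2⟩ := mem_cutPairs.1 hp
    have := mem_openLabels.2 ⟨p.1, p.2, h1, h2.symm, rfl⟩
    simp [h0] at this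
  | succ n ih =>
    intro cl hJ hn
    rcases (cutPairs H A cl).eq_empty_or_nonempty with h0 | ⟨⟨a, b⟩, hab⟩
    · simp [h0]
    obtain ⟨-, -, hadj, hlab⟩ := mem_cutPairs.1 hab
    simp only at hadj hlab
    let cl' : V → W := fun v => if cl v = cl b then cl a else cl v
    have hmono : ∀ x y, cl x = cl y → cl' x = cl' y := fun x y h => by simp only [cl', h]
    have hle : clusterGraph H cl ≤ clusterGraph H cl' := clusterGraph_mono H hmono
    have ha' : cl' a = cl a := by simp [cl']
    have hb' : cl' b = cl a := by simp [cl']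
    have hbdry : ∀ x y, cl' y ≠ cl' x → cl y ≠ cl x := fun x y h h' => h (hmono _ _ h')
    have hJ' : BoundaryConnected H cl' := by
      have key : ∀ x y, cl' x = cl a → H.Adj x y → cl' y ≠ cl' x →
          (clusterGraph H cl').Reachable x a := by
        intro x y hx hxy hy
        have hab : (clusterGraph H cl').Reachable b a :=
          Adj.reachable ⟨hadj.symm, hb'.trans ha'.symm⟩
        by_cases h : cl x = cl b
        · exact ((hJ x y b a h hxy (hbdry _ _ hy) hadj.symm hlab).mono hle).trans hab
        · simp only [cl', h, if_false] at hx
          exact (hJ x y a b hx hxy (hbdry _ _ hy) hadj hlab.symm).mono hle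
      intro x y x' y' hxx hxy hy hxy' hy'
      by_cases h : cl' x = cl a
      · exact (key x y h hxy hy).trans (key x' y' (hxx ▸ h) hxy' hy').symm
      · have h1 : cl x ≠ cl b := fun e => h (by simp [cl', e])
        have h2 : cl x' ≠ cl b := fun e => h (by rw [hxx]; simp [cl', e])
        have : cl x = cl x' := by simpa [cl', h1, h2] using hxx
        exact (hJ x y x' y' this hxy (hbdry _ _ hy) hxy' (hbdry _ _ hy')).mono hle
    have hopen : openLabels H cl' ⊆ (openLabels H cl).erase (cl b) := by
      intro r hr
      obtain ⟨x, y, hxy, hne, rfl⟩ := mem_openLabels.1 hr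
      rw [Finset.mem_erase]
      by_cases h : cl x = cl b
      · rw [show cl' x = cl a by simp [cl', h]]
        exact ⟨hlab, mem_openLabels.2 ⟨a, b, hadj, hlab.symm, rfl⟩⟩
      · rw [show cl' x = cl x by simp [cl', h]]
        exact ⟨h, mem_openLabels.2 ⟨x, y, hxy, hbdry _ _ hne, rfl⟩⟩
    have hb : cl b ∈ openLabels H cl := mem_openLabels.2 ⟨b, a, hadj.symm, hlab, rfl⟩
    have hcard := Finset.card_le_card hopen
    rw [Finset.card_erase_of_mem hb] at hcard
    have hrec := ih cl' hJ' (by omega)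
    have hD : (cutPairs H A cl \ cutPairs H A cl').card ≤ 2 := by
      by_contra! h3
      obtain ⟨e₁, e₂, e₃, h1, h2, h3, h12, h13, h23⟩ := Finset.two_lt_card_iff.1 h3
      -- Lost edges are reoriented from the cluster of `a` to that of `b`. This is injective because
      -- an edge has only one orientation that leaves `A`.
      let φ : V × V → V × V := fun e => if cl e.1 = cl a then e else e.swap
      have hφ : ∀ e ∈ cutPairs H A cl \ cutPairs H A cl',
          H.Adj (φ e).1 (φ e).2 ∧ cl (φ e).1 = cl a ∧ cl (φ e).2 = cl b := by
        rintro ⟨x, y⟩ he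
        rw [Finset.mem_sdiff, mem_cutPairs, mem_cutPairs] at he
        obtain ⟨⟨hx, hy, hxy, hc⟩, hn⟩ := he
        simp only at hx hy hxy hc hn
        have hc' : cl' x = cl' y := by tauto
        by_cases h : cl x = cl a
        · simp only [φ, h, if_true]
          refine ⟨hxy, trivial, ?_⟩
          simp only [cl'] at hc'
          grind
        · simp only [φ, h, if_false, Prod.fst_swap, Prod.snd_swap]
          refine ⟨hxy.symm, ?_⟩
          simp only [cl'] at hc'
          grind
      have hinj : ∀ e ∈ cutPairs H A cl \ cutPairs H A cl',
          ∀ e' ∈ cutPairs H A cl \ cutPairs H A cl', e ≠ e' → φ e ≠ φ e' := by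
        rintro ⟨x, y⟩ he ⟨x', y'⟩ he' hne heq
        rw [Finset.mem_sdiff, mem_cutPairs] at he he'
        simp only [φ, Prod.swap] at heq
        grind
      exact hH.not_three_edges_between hJ hlab (hφ _ h1) (hφ _ h2) (hφ _ h3)
        (hinj _ h1 _ h2 h12) (hinj _ h1 _ h3 h13) (hinj _ h2 _ h3 h23)
    have := Finset.card_le_card_sdiff_add_card (s := cutPairs H A cl) (t := cutPairs H A cl')
    omega

end Clusters

/-! ### Bounded distance -/

section Within

open SimpleGraph

variable {V : Type*}

/-- `y` can be reached from `x` in at most `r` steps. -/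
def Within (G : SimpleGraph V) (r : ℕ) (x y : V) : Prop := ∃ p : G.Walk x y, p.length ≤ r

namespace Within

variable {G : SimpleGraph V} {r d : ℕ} {x y z : V}

theorem refl (G : SimpleGraph V) (r : ℕ) (x : V) : Within G r x x := ⟨.nil, by simp⟩

theorem symm (h : Within G r x y) : Within G r y x := by
  obtain ⟨p, hp⟩ := h
  exact ⟨p.reverse, by simpa using hp⟩

theorem mono (h : Within G r x y) (hrd : r ≤ d) : Within G d x y := by
  obtain ⟨p, hp⟩ := h
  exact ⟨p, hp.trans hrd⟩

theorem trans (h : Within G r x y) (h' : Within G d y z) : Within G (r + d) x z := by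
  obtain ⟨p, hp⟩ := h
  obtain ⟨q, hq⟩ := h'
  exact ⟨p.append q, by rw [Walk.length_append]; omega⟩

theorem of_adj (h : G.Adj x y) : Within G 1 x y := ⟨h.toWalk, by simp⟩

theorem eq_of_zero (h : Within G 0 x y) : x = y := by
  obtain ⟨p, hp⟩ := h
  exact Walk.eq_of_length_eq_zero (p := p) (by omega)

theorem succ_iff : Within G (r + 1) x y ↔ x = y ∨ ∃ z, G.Adj x z ∧ Within G r z y := by
  constructor
  · rintro ⟨p, hp⟩
    cases p with
    | nil => exact Or.inl rfl
    | cons h p => exact Or.inr ⟨_, h, p, by simpa using hp⟩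
  · rintro (rfl | ⟨z, h, p, hp⟩)
    · exact refl _ _ _
    · exact ⟨.cons h p, by simpa using hp⟩

end Within

/-- A path inside the cluster has no more vertices than the cluster. -/
theorem Within.of_clusterGraph_reachable [Finite V] {W : Type*} {G : SimpleGraph V} {cl : V → W}
    {x y : V} (h : (clusterGraph G cl).Reachable x y) {n : ℕ}
    (hn : {z | cl z = cl x}.ncard ≤ n + 1) : Within G n x y := by
  classical
  obtain ⟨p, hp⟩ := h.exists_isPath
  refine ⟨p.mapLe (clusterGraph_le G cl), ?_⟩
  have hsub : (p.support.toFinset : Set V) ⊆ {z | cl z = cl x} := by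
    intro z hz
    have hz : z ∈ p.support := by simpa using hz
    exact (clusterGraph_label_eq ⟨p.takeUntil z hz⟩).symm
  have := Set.ncard_le_ncard hsub (Set.toFinite _)
  rw [Set.ncard_coe_finset, List.toFinset_card_of_nodup hp.support_nodup,
    Walk.length_support] at this
  rw [Walk.length_map]
  omega

end Within

/-! ### Cutting pointer paths -/

section Pointers

variable {V : Type*}

open scoped Classical in
/-- Follow the pointer `P` if it leads to a smaller rank, or if no vertex of larger rank points
here. -/
noncomputable def follow (P : V → V) (rank : V → ℕ) (r : V) : V :=
  if rank (P r) < rank r ∨ ¬ ∃ u, P u = r ∧ u ≠ r ∧ rank r < rank u then P r else r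

variable {P : V → V} {rank : V → ℕ} {q : ℕ}

theorem follow_eq (P : V → V) (rank : V → ℕ) (r : V) :
    follow P rank r = r ∨ follow P rank r = P r := by
  unfold follow
  split_ifs
  · exact Or.inr rfl
  · exact Or.inl rfl

theorem follow_eq_self {r : V} (h : P r = r) : follow P rank r = r := by
  rcases follow_eq P rank r with h' | h'
  · exact h'
  · exact h'.trans h

/-- A vertex that refuses its pointer is in turn joined by another vertex, so no cluster with a
pointer remains alone. -/
theorem exists_follow_eq {r : V} (h : follow P rank r = r) (hP : P r ≠ r) :
    ∃ u, u ≠ r ∧ P u = r ∧ follow P rank u = r := by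
  unfold follow at h
  split_ifs at h with h1
  · exact (hP h).elim
  · push Not at h1
    obtain ⟨-, u, hu, hur, hlt⟩ := h1
    refine ⟨u, hur, hu, ?_⟩
    unfold follow
    rw [if_pos (Or.inl (by rw [hu]; exact hlt)), hu]

/-- After a descending step, the new vertex has a predecessor of larger rank and can only descend or
stop. So a path first ascends and then descends, with at most `q` steps of each kind. -/
theorem follow_iterate_fixed (hq : ∀ r, rank r ≤ q)
    (hne : ∀ r, P r ≠ r → rank (P r) ≠ rank r) (r : V) :
    follow P rank ((follow P rank)^[2 * q] r) = (follow P rank)^[2 * q] r := by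
  classical
  set f := follow P rank with hf
  -- The potential bounds the remaining steps: a descending vertex has at most its rank left; an
  -- ascending one has `q - rank r` ascents and then up to `q` descents.
  let μ : V → ℕ := fun r => if f r = r then 0 else if rank (f r) < rank r then rank r
    else q + (q - rank r)
  have hdec : ∀ r, f r ≠ r → μ (f r) < μ r := by
    intro r hr
    have hP : f r = P r := (follow_eq P rank r).resolve_left hr
    have hPr : P r ≠ r := hP ▸ hr
    have hrank := hne r hPr
    by_cases hd : rank (f r) < rank r
    · have e1 : μ r = rank r := by simp [μ, hr, hd]
      rw [e1]
      by_cases hfix : f (f r) = f r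
      · simp only [μ, hfix, if_true]; omega
      · have hdesc : rank (f (f r)) < rank (f r) := by
          have h1 := (follow_eq P rank (f r)).resolve_left hfix
          have h2 : follow P rank (f r) ≠ f r := hfix
          unfold follow at h2
          split_ifs at h2 with h3
          · rcases h3 with h3 | h3
            · rw [hf, h1]; exact h3
            · exact (h3 ⟨r, hP.symm, hr.symm, hd⟩).elim
          · exact (h2 rfl).elim
        simp only [μ, hfix, hdesc, if_true, if_false]
        exact hd
    · have hasc : rank r < rank (f r) := by rw [hP] at hd ⊢; omega
      have e1 : μ r = q + (q - rank r) := by simp [μ, hr, hd]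
      have h1 := hq (f r)
      rw [e1]
      simp only [μ]
      split_ifs <;> omega
  have hμ : ∀ r, μ r ≤ 2 * q := by
    intro r
    have := hq r
    simp only [μ]
    split_ifs <;> omega
  have key : ∀ m r, μ r ≤ m → f (f^[m] r) = f^[m] r := by
    intro m
    induction m with
    | zero =>
      intro r h0
      by_contra h
      have := hdec r h
      omega
    | succ m ih =>
      intro r hm
      rw [Function.iterate_succ_apply]
      by_cases h : f r = r
      · rw [h]; rw [Function.iterate_fixed h]; exact h
      · exact ih (f r) (by have := hdec r h; omega)
  exact key _ r (hμ r)

end Pointers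

/-! ### Merging small clusters -/

section Coarsen

open SimpleGraph

variable {V : Type*}

/-- An edge of `G` leads from the cluster `r` to another cluster `r'`. -/
def LeadsTo (G : SimpleGraph V) (cl : V → V) (r r' : V) : Prop :=
  ∃ x y, cl x = r ∧ G.Adj x y ∧ cl y = r' ∧ r' ≠ r

open scoped Classical in
/-- Clusters with fewer than `m` vertices point to a neighbouring cluster, along an edge of `H` if
possible, and along an edge of `K` otherwise. -/
noncomputable def target (H K : SimpleGraph V) (cl : V → V) (m : ℕ) (r : V) : V :=
  if {x | cl x = r}.ncard < m then
    if h : ∃ r', LeadsTo H cl r r' then h.choose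
    else if h : ∃ r', LeadsTo K cl r r' then h.choose else r
  else r

variable {H K : SimpleGraph V} {cl : V → V} {m s : ℕ} {r : V}

theorem target_spec (hHK : H ≤ K) (h : target H K cl m r ≠ r) :
    {x | cl x = r}.ncard < m ∧ LeadsTo K cl r (target H K cl m r) ∧
      ((∃ r', LeadsTo H cl r r') → LeadsTo H cl r (target H K cl m r)) := by
  unfold target at h ⊢
  split_ifs at h ⊢ with h1 h2 h3
  · obtain ⟨x, y, a, b, c⟩ := h2.choose_spec
    exact ⟨h1, ⟨x, y, a, hHK b, c⟩, fun _ => h2.choose_spec⟩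
  · exact ⟨h1, h3.choose_spec, fun h => (h2 h).elim⟩
  · exact (h rfl).elim
  · exact (h rfl).elim

theorem le_ncard_of_target_eq (h : target H K cl m r = r) (hK : ∃ r', LeadsTo K cl r r') :
    m ≤ {x | cl x = r}.ncard := by
  unfold target at h
  split_ifs at h with h1 h2
  · obtain ⟨x, y, a, b, c, d⟩ := h2.choose_spec
    exact (d h).elim
  · obtain ⟨x, y, a, b, c, d⟩ := hK.choose_spec
    exact (d h).elim
  · omega

/-- Clusters with named leaders, connected in `K`, with at least `s` vertices unless they are
components of `K`, and such that the vertices of a cluster with `H`-edges that leave the cluster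
are connected by `H` inside of the cluster. -/
structure IsClustering (H K : SimpleGraph V) (cl : V → V) (s : ℕ) : Prop where
  idem : ∀ v, cl (cl v) = cl v
  reachable : ∀ v, (clusterGraph K cl).Reachable v (cl v)
  boundaryConnected : BoundaryConnected H cl
  card : ∀ x y, K.Adj x y → cl x ≠ cl y → s ≤ {z | cl z = cl x}.ncard

theorem isClustering_id (H K : SimpleGraph V) : IsClustering H K id 1 where
  idem _ := rfl
  reachable _ := .refl _
  boundaryConnected x y x' y' h _ _ _ _ := by obtain rfl : x = x' := h; exact .refl _
  card x _ _ _ := by simp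

/-- The clustering in which the cluster with leader `r` is joined to that with leader
`follow P rank r`, repeatedly. -/
noncomputable def coarsen (P : V → V) (rank : V → ℕ) (q : ℕ) (cl : V → V) (v : V) : V :=
  (follow P rank)^[2 * q] (cl v)

variable {rank : V → ℕ} {q : ℕ}

/-- A merged cluster is large because its leader either had no pointer, and thus `2 * s` vertices
already, or was joined by another cluster, each of the two having at least `s`. Boundary
connectivity survives because a cluster with outgoing `H`-edges merges only along such an edge. -/
theorem IsClustering.coarsen [Finite V] (hHK : H ≤ K) (hcl : IsClustering H K cl s)
    (hq : ∀ r, rank r ≤ q)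
    (hne : ∀ r, target H K cl (2 * s) r ≠ r → rank (target H K cl (2 * s) r) ≠ rank r) :
    IsClustering H K (coarsen (target H K cl (2 * s)) rank q cl) (2 * s) := by
  set P := target H K cl (2 * s) with hP
  set f := follow P rank with hf
  set cl' := _root_.coarsen P rank q cl with hcl'
  have hfix : ∀ r, f (f^[2 * q] r) = f^[2 * q] r := follow_iterate_fixed hq hne
  have hdef : ∀ v, cl' v = f^[2 * q] (cl v) := fun _ => rfl
  have hmono : ∀ x y, cl x = cl y → cl' x = cl' y := fun x y h => by rw [hdef, hdef, h]
  have hff : ∀ r, f^[2 * q] (f r) = f^[2 * q] r := fun r => by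
    rw [← Function.iterate_succ_apply, Function.iterate_succ_apply', hfix]
  have hPlead : ∀ r, P r ≠ r → cl (P r) = P r := fun r h => by
    obtain ⟨-, ⟨x, y, -, -, hy, -⟩, -⟩ := target_spec hHK h
    rw [hP, ← hy, hcl.idem]
  have hflead : ∀ r, cl r = r → cl (f r) = f r := fun r hr => by
    by_cases h : f r = r
    · rw [h, hr]
    · have h1 := (follow_eq P rank r).resolve_left h
      rw [← hf] at h1
      rw [h1]
      exact hPlead r (h1 ▸ h)
  have hilead : ∀ m r, cl r = r → cl (f^[m] r) = f^[m] r := by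
    intro m
    induction m with
    | zero => exact fun r h => h
    | succ m ih => exact fun r h => by rw [Function.iterate_succ_apply]; exact ih _ (hflead r h)
  have hle : ∀ G : SimpleGraph V, clusterGraph G cl ≤ clusterGraph G cl' :=
    fun G => clusterGraph_mono G hmono
  have hcr : ∀ x, cl' x = f^[2 * q] (cl x) := hdef
  refine ⟨?_, ?_, ?_, ?_⟩
  · intro v
    rw [hdef (cl' v), hdef v, hilead _ _ (hcl.idem v), Function.iterate_fixed (hfix _)]
  · have step : ∀ r, (clusterGraph K cl').Reachable r (f r) := by
      intro r
      by_cases h : f r = r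
      · rw [h]
      · have h1 : f r = P r := (follow_eq P rank r).resolve_left h
        obtain ⟨-, ⟨x, y, hx, hxy, hy, -⟩, -⟩ := target_spec hHK (h1 ▸ h)
        have a1 := (hcl.reachable x).mono (hle K)
        have a2 := (hcl.reachable y).mono (hle K)
        rw [hx] at a1
        rw [hy, ← hP, ← h1] at a2
        have : (clusterGraph K cl').Adj x y := by
          refine ⟨hxy, ?_⟩
          rw [hcr, hcr, hx, hy, ← hP, ← h1, hff]
        exact a1.symm.trans (this.reachable.trans a2)
    have iter : ∀ m r, (clusterGraph K cl').Reachable r (f^[m] r) := by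
      intro m
      induction m with
      | zero => exact fun r => .refl _
      | succ m ih =>
        intro r
        rw [Function.iterate_succ_apply]
        exact (step r).trans (ih _)
    intro v
    exact ((hcl.reachable v).mono (hle K)).trans (iter _ _)
  -- A boundary vertex of a cluster that moves on is `H`-connected to the edge along which the
  -- cluster merges, hence to a boundary vertex of the next cluster.
  · have step : ∀ r x, cl x = r → (∃ w, H.Adj x w ∧ cl w ≠ r) →
        ∃ z, cl z = f r ∧ (∃ w, H.Adj z w ∧ cl w ≠ f r) ∧ (clusterGraph H cl').Reachable x z := by
      rintro r x hx ⟨w, hxw, hw⟩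
      by_cases h : f r = r
      · exact ⟨x, by rw [h, hx], by rw [h]; exact ⟨w, hxw, hw⟩, .refl _⟩
      · have h1 : f r = P r := (follow_eq P rank r).resolve_left h
        obtain ⟨-, -, hH⟩ := target_spec hHK (h1 ▸ h)
        obtain ⟨x₀, y₀, hx₀, hadj, hy₀, hne₀⟩ := hH ⟨cl w, x, w, hx, hxw, rfl, hw⟩
        rw [← hP, ← h1] at hy₀ hne₀
        refine ⟨y₀, hy₀, ⟨x₀, hadj.symm, by rw [hx₀]; exact hne₀.symm⟩, ?_⟩
        have a1 := (hcl.boundaryConnected x w x₀ y₀ (hx.trans hx₀.symm) hxw (by rwa [hx]) hadj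
          (by rw [hy₀, hx₀]; exact hne₀)).mono (hle H)
        have : (clusterGraph H cl').Adj x₀ y₀ := by
          refine ⟨hadj, ?_⟩
          rw [hcr, hcr, hx₀, hy₀, hff]
        exact a1.trans this.reachable
    have iter : ∀ m r x, cl x = r → (∃ w, H.Adj x w ∧ cl w ≠ r) →
        ∃ z, cl z = f^[m] r ∧ (∃ w, H.Adj z w ∧ cl w ≠ f^[m] r) ∧
          (clusterGraph H cl').Reachable x z := by
      intro m
      induction m with
      | zero => exact fun r x hx hw => ⟨x, hx, hw, .refl _⟩
      | succ m ih =>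
        intro r x hx hw
        obtain ⟨z, hz, hzw, hreach⟩ := step r x hx hw
        obtain ⟨z', hz', hzw', hreach'⟩ := ih (f r) z hz hzw
        exact ⟨z', hz', hzw', hreach.trans hreach'⟩
    intro x y x' y' hxx hxy hy hxy' hy'
    obtain ⟨z, hz, ⟨w, hzw, hw⟩, hr⟩ := iter (2 * q) (cl x) x rfl
      ⟨y, hxy, fun h => hy (hmono _ _ h)⟩
    obtain ⟨z', hz', ⟨w', hzw', hw'⟩, hr'⟩ := iter (2 * q) (cl x') x' rfl
      ⟨y', hxy', fun h => hy' (hmono _ _ h)⟩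
    have hzz : f^[2 * q] (cl x) = f^[2 * q] (cl x') := hxx
    have := (hcl.boundaryConnected z w z' w' (by rw [hz, hz', hzz]) hzw (by rwa [hz]) hzw'
      (by rwa [hz'])).mono (hle H)
    exact hr.trans (this.trans hr'.symm)
  · intro x y hxy hxy'
    set R := cl' x with hR
    have hRR : f R = R := hfix _
    have hRiter : f^[2 * q] R = R := Function.iterate_fixed hRR _
    have hsub : ∀ r, f^[2 * q] r = R → {z | cl z = r} ⊆ {z | cl' z = R} := by
      intro r hr z hz
      have hz : cl z = r := hz
      change cl' z = R
      rw [hcr, hz, hr]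
    by_cases hPR : P R = R
    · have hlead : ∃ r', LeadsTo K cl R r' := by
        by_cases hx : cl x = R
        · exact ⟨cl y, x, y, hx, hxy, rfl, fun h => hxy' (hmono _ _ (hx.trans h.symm))⟩
        -- The last cluster before `R` on the way from `cl x` points to `R`, so the reversed edge
        -- leads out of `R`.
        · obtain ⟨j, hj, hj'⟩ : ∃ j, f^[j] (cl x) ≠ R ∧ f^[j + 1] (cl x) = R := by
            by_contra! hcon
            have : ∀ j, f^[j] (cl x) ≠ R := by
              intro j
              induction j with
              | zero => exact hx
              | succ j ih => exact hcon j ih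
            exact this (2 * q) rfl
          rw [Function.iterate_succ_apply'] at hj'
          set u := f^[j] (cl x)
          have h1 : f u = P u := (follow_eq P rank u).resolve_left (by
            intro h; exact hj (h.symm.trans hj'))
          obtain ⟨-, ⟨x₀, y₀, hx₀, hadj, hy₀, hne₀⟩, -⟩ :=
            target_spec hHK (m := 2 * s) (r := u) (by
              rw [← hP, ← h1, hj']; exact hj.symm)
          rw [← hP, ← h1, hj'] at hy₀ hne₀
          exact ⟨u, y₀, x₀, hy₀, hadj.symm, hx₀, hne₀.symm⟩
      exact (le_ncard_of_target_eq hPR hlead).trans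
        (Set.ncard_le_ncard (hsub R hRiter) (Set.toFinite _))
    · obtain ⟨u, huR, hPu, hfu⟩ := exists_follow_eq hRR hPR
      obtain ⟨-, ⟨x₀, y₀, hx₀, hadj, hy₀, hne₀⟩, -⟩ :=
        target_spec hHK (m := 2 * s) (r := u) (by rw [← hP, hPu]; exact huR.symm)
      rw [← hP, hPu] at hy₀ hne₀
      have c1 := hcl.card x₀ y₀ hadj (by rw [hx₀, hy₀]; exact huR)
      have c2 := hcl.card y₀ x₀ hadj.symm (by rw [hx₀, hy₀]; exact huR.symm)
      rw [hx₀] at c1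
      rw [hy₀] at c2
      have hdis : Disjoint {z | cl z = u} {z | cl z = R} := by
        rw [Set.disjoint_left]
        intro z (hz : cl z = u) (hz' : cl z = R)
        exact huR (hz.symm.trans hz')
      have hun := Set.ncard_union_eq hdis (Set.toFinite _) (Set.toFinite _)
      have hle' := Set.ncard_le_ncard (Set.union_subset
        (hsub u (by rw [← hff, hf, hfu, ← hf, hRiter])) (hsub R hRiter)) (Set.toFinite _)
      omega

theorem within_target [Finite V] (hHK : H ≤ K) (hcl : IsClustering H K cl s) {D : ℕ}
    (hD : ∀ v, Within K D v (cl v)) (r : V) :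
    Within K (2 * s + 1 + D) r (target H K cl (2 * s) r) := by
  by_cases h : target H K cl (2 * s) r = r
  · rw [h]; exact .refl _ _ _
  · obtain ⟨hc, ⟨x, y, hx, hxy, hy, -⟩, -⟩ := target_spec hHK h
    have h1 : Within K (2 * s) x r := hx ▸ Within.of_clusterGraph_reachable (hcl.reachable x)
      (by rw [hx]; omega)
    have h2 := hD y
    rw [hy] at h2
    exact (h1.symm.trans (.of_adj hxy)).trans h2

/-- Only clusters with fewer than `2 * s` vertices have pointers, so each step costs at most `4 * s
+ 1`. The old radius `D` enters just once, in the final cluster. This keeps the radius proportional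
to the cluster size over all doublings. -/
theorem within_coarsen [Finite V] (hHK : H ≤ K) (hcl : IsClustering H K cl s) {D : ℕ}
    (hD : ∀ v, Within K D v (cl v)) (v : V) :
    Within K (D + (2 * q + 1) * (4 * s + 1)) v
      (coarsen (target H K cl (2 * s)) rank q cl v) := by
  set P := target H K cl (2 * s) with hP
  set f := follow P rank with hf
  have hsmall : ∀ r, P r ≠ r → ∀ x, cl x = r → Within K (2 * s) x r := fun r h x hx => by
    have := (target_spec hHK h).1
    exact hx ▸ Within.of_clusterGraph_reachable (hcl.reachable x) (by rw [hx]; omega)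
  have iter : ∀ m r, P r ≠ r → Within K (m * (4 * s + 1) + 2 * s + 1 + D) r (f^[m] r) := by
    intro m
    induction m with
    | zero => exact fun r _ => .refl _ _ _
    | succ m ih =>
      intro r hr
      rw [Function.iterate_succ_apply]
      rcases follow_eq P rank r with h | h
      · rw [← hf] at h
        rw [h, Function.iterate_fixed h]
        exact .refl _ _ _
      · rw [← hf] at h
        rw [h]
        by_cases hPP : P (P r) = P r
        · have : f (P r) = P r := follow_eq_self hPP
          rw [Function.iterate_fixed this]
          exact (within_target hHK hcl hD r).mono (by nlinarith)
        · obtain ⟨-, ⟨x, y, hx, hxy, hy, -⟩, -⟩ := target_spec hHK hr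
          have h1 := hsmall r hr x hx
          have h2 := hsmall (P r) hPP y hy
          refine (((h1.symm.trans (.of_adj hxy)).trans h2).trans (ih _ hPP)).mono ?_
          ring_nf; omega
  by_cases h : P (cl v) = cl v
  · have : f (cl v) = cl v := follow_eq_self h
    change Within K _ v (f^[2 * q] (cl v))
    rw [Function.iterate_fixed this]
    exact (hD v).mono (by omega)
  · refine ((hsmall _ h v rfl).trans (iter (2 * q) _ h)).mono ?_
    ring_nf; omega

end Coarsen

/-! ### Colour reduction along pointers -/

section Colors

/-- Twice the first position at which the binary digits of `a` and `b` differ, plus the digit of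
`a` there. -/
noncomputable def bitColor (a b : ℕ) : ℕ :=
  2 * sInf {i | a.testBit i ≠ b.testBit i} + (a.testBit (sInf {i | a.testBit i ≠ b.testBit i})).toNat

/-- Equal colours would name the same position and the same digit there, but `a` and `b` differ at
that position. Nothing is assumed on `c`, so roots that point to themselves need no special
treatment. -/
theorem bitColor_ne {a b : ℕ} (c : ℕ) (h : a ≠ b) : bitColor a b ≠ bitColor b c := by
  have hne : {i | a.testBit i ≠ b.testBit i}.Nonempty := by
    by_contra hcon
    rw [Set.not_nonempty_iff_eq_empty] at hcon
    refine h (Nat.eq_of_testBit_eq fun i => ?_)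
    by_contra hi
    have : i ∈ {i | a.testBit i ≠ b.testBit i} := hi
    rw [hcon] at this
    exact this
  have hmem : a.testBit (sInf _) ≠ b.testBit (sInf _) := Nat.sInf_mem hne
  unfold bitColor
  generalize sInf {i | a.testBit i ≠ b.testBit i} = i at hmem ⊢
  generalize sInf {i | b.testBit i ≠ c.testBit i} = j
  intro heq
  have h1 := Bool.toNat_le (a.testBit i)
  have h2 := Bool.toNat_le (b.testBit j)
  obtain rfl : i = j := by omega
  refine hmem ?_
  cases ha : a.testBit i <;> cases hb : b.testBit i <;> simp_all

theorem bitColor_lt {a b M : ℕ} (ha : a < M) (hb : b < M) :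
    bitColor a b < 2 * (Nat.log 2 M + 1) := by
  have hM : M < 2 ^ (Nat.log 2 M + 1) := Nat.lt_pow_succ_log_self (by norm_num) M
  have hle : sInf {i | a.testBit i ≠ b.testBit i} ≤ Nat.log 2 M := by
    rcases Set.eq_empty_or_nonempty {i | a.testBit i ≠ b.testBit i} with h | h
    · rw [h, Nat.sInf_empty]; omega
    · have hmem : a.testBit (sInf _) ≠ b.testBit (sInf _) := Nat.sInf_mem h
      by_contra! hlt
      have hp := Nat.pow_le_pow_right (n := 2) (by norm_num) (Nat.succ_le_of_lt hlt)
      refine hmem ?_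
      rw [Nat.testBit_lt_two_pow ((ha.trans hM).trans_le hp),
        Nat.testBit_lt_two_pow ((hb.trans hM).trans_le hp)]
  have h1 := Bool.toNat_le (a.testBit (sInf {i | a.testBit i ≠ b.testBit i}))
  unfold bitColor
  omega

/-- The colours after some rounds of the colour reduction of Cole and Vishkin. -/
noncomputable def reduceColor {V : Type*} (P : V → V) (c : V → ℕ) : ℕ → V → ℕ
  | 0, r => c r
  | j + 1, r => bitColor (reduceColor P c j r) (reduceColor P c j (P r))

/-- A bound for the number of colours after some rounds of the colour reduction. -/
def palette (N : ℕ) : ℕ → ℕ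
  | 0 => N
  | j + 1 => 2 * (Nat.log 2 (palette N j) + 1)

variable {V : Type*} {P : V → V} {c : V → ℕ}

theorem reduceColor_ne (hc : Function.Injective c) {r : V} (h : P r ≠ r) (j : ℕ) :
    reduceColor P c j r ≠ reduceColor P c j (P r) := by
  cases j with
  | zero => exact fun h' => h (hc h').symm
  | succ j => exact bitColor_ne _ (reduceColor_ne hc h j)

theorem reduceColor_lt {N : ℕ} (hc : ∀ r, c r < N) (j : ℕ) (r : V) :
    reduceColor P c j r < palette N j := by
  induction j generalizing r with
  | zero => exact hc r
  | succ j ih => exact bitColor_lt (ih _) (ih _)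

open scoped Classical in
/-- The rank is positive unless the vertex is a root. -/
noncomputable def pointerRank (P : V → V) (c : V → ℕ) (t : ℕ) (r : V) : ℕ :=
  if P r = r then 0 else reduceColor P c t r + 1

theorem pointerRank_le {N q t : ℕ} (hc : ∀ r, c r < N) (hq : palette N t ≤ q) (r : V) :
    pointerRank P c t r ≤ q := by
  have := reduceColor_lt (P := P) hc t r
  unfold pointerRank
  split_ifs <;> omega

theorem pointerRank_ne (hc : Function.Injective c) {t : ℕ} {r : V} (h : P r ≠ r) :
    pointerRank P c t (P r) ≠ pointerRank P c t r := by
  have := reduceColor_ne hc h t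
  unfold pointerRank
  split_ifs <;> omega

end Colors

/-! ### The number of rounds of the colour reduction -/

section LogStar

theorem logb_two_le_sub_one {x : ℝ} (hx : 2 ≤ x) : Real.logb 2 x ≤ x - 1 := by
  rw [Real.logb_le_iff_le_rpow (by norm_num) (by linarith)]
  have := one_add_mul_self_le_rpow_one_add (s := 1) (by norm_num) (p := x - 1) (by linarith)
  norm_num at this ⊢
  linarith

theorem exists_iterate_logb_le_one (x : ℝ) : ∃ k, (Real.logb 2)^[k] x ≤ 1 := by
  have key : ∀ m : ℕ, ∀ x : ℝ, x ≤ m → ∃ k, (Real.logb 2)^[k] x ≤ 1 := by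
    intro m
    induction m with
    | zero => exact fun x hx => ⟨0, by simp at hx ⊢; linarith⟩
    | succ m ih =>
      intro x hx
      push_cast at hx
      by_cases h1 : x ≤ 1
      · exact ⟨0, h1⟩
      · push Not at h1
        by_cases h2 : x < 2
        · refine ⟨1, ?_⟩
          rw [Function.iterate_one, Real.logb_le_iff_le_rpow (by norm_num) (by linarith)]
          simpa using h2.le
        · push Not at h2
          obtain ⟨k, hk⟩ := ih (Real.logb 2 x) (by linarith [logb_two_le_sub_one h2])
          exact ⟨k + 1, by rwa [Function.iterate_succ_apply]⟩
  obtain ⟨m, hm⟩ := exists_nat_ge x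
  exact key m x hm

theorem iterate_logStar_le_one (n : ℕ) : (Real.logb 2)^[logStar n] (n : ℝ) ≤ 1 :=
  Nat.sInf_mem (exists_iterate_logb_le_one n)

theorem one_le_logStar {n : ℕ} (hn : 2 ≤ n) : 1 ≤ logStar n := by
  by_contra h
  have h0 : logStar n = 0 := by omega
  have := iterate_logStar_le_one n
  rw [h0, Function.iterate_zero, id] at this
  have h2 : (2 : ℝ) ≤ n := by exact_mod_cast hn
  linarith

theorem natLog_le_logb {m : ℕ} (hm : 0 < m) : (Nat.log 2 m : ℝ) ≤ Real.logb 2 m := by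
  rw [Real.le_logb_iff_rpow_le (by norm_num) (by exact_mod_cast hm), Real.rpow_natCast]
  exact_mod_cast Nat.pow_log_le_self 2 hm.ne'

/-- While the palette exceeds `2 * K` with `K = 2 ^ (c + 4)`, it is at most `K` times the iterated
logarithm of `n`. After `logStar n` rounds that logarithm is at most one, a contradiction. -/
theorem exists_palette_le_pow {n c N : ℕ} (hn : 2 ≤ n) (hN : N ≤ n ^ c) :
    ∃ t ≤ logStar n, palette N t ≤ 2 * 2 ^ (c + 4) := by
  by_contra! hcon
  have h2n : (2 : ℝ) ≤ n := by exact_mod_cast hn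
  set K : ℝ := 2 ^ (c + 4) with hK
  have hK0 : 0 < K := by positivity
  have hlogK : Real.logb 2 K = c + 4 := by
    rw [hK, ← Real.rpow_natCast, Real.logb_rpow (by norm_num) (by norm_num)]
    push_cast; ring
  have hc16 : (c : ℝ) + 1 ≤ 2 ^ c := by
    exact_mod_cast Nat.lt_two_pow_self (n := c)
  have hKc : K = 16 * 2 ^ c := by rw [hK, pow_add]; norm_num; ring
  have hbig : ∀ t ≤ logStar n, 2 * K < (palette N t : ℝ) := by
    intro t ht
    have := hcon t ht
    rw [hK]; exact_mod_cast this
  have claim : ∀ i, i + 1 ≤ logStar n →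
      (palette N (i + 1) : ℝ) ≤ K * (Real.logb 2)^[i + 1] (n : ℝ) := by
    intro i
    induction i with
    | zero =>
      intro _
      have hlog1 : 1 ≤ Real.logb 2 n := by
        rw [Real.le_logb_iff_rpow_le (by norm_num) (by linarith)]; simpa using h2n
      have hN0 : 0 < N := by
        have := hcon 0 (Nat.zero_le _)
        simp only [palette] at this; omega
      have h1 : (Nat.log 2 N : ℝ) ≤ c * Real.logb 2 n := by
        refine (natLog_le_logb hN0).trans ?_
        rw [← Real.logb_pow]
        refine Real.logb_le_logb_of_le (by norm_num) (by exact_mod_cast hN0) ?_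
        exact_mod_cast hN
      simp only [palette, Function.iterate_succ, Function.iterate_zero, Function.comp, id]
      push_cast
      have hc0 : (0 : ℝ) ≤ c := by positivity
      nlinarith
    | succ i ih =>
      intro hi
      have ih := ih (by omega)
      have hb := hbig (i + 1) (by omega)
      have hb' := hbig (i + 1 + 1) hi
      rw [Function.iterate_succ_apply' (Real.logb 2) (i + 1)]
      set x := (Real.logb 2)^[i + 1] (n : ℝ)
      -- The palette lies above `2 * K` and at most at `K * x`.
      have hx : 2 ≤ x := by nlinarith
      have hy : 1 ≤ Real.logb 2 x := by
        rw [Real.le_logb_iff_rpow_le (by norm_num) (by linarith)]; simpa using hx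
      have hM : (0 : ℝ) < palette N (i + 1) := by linarith
      have h1 : (Nat.log 2 (palette N (i + 1)) : ℝ) ≤ c + 4 + Real.logb 2 x := by
        refine (natLog_le_logb (by exact_mod_cast hM)).trans ?_
        rw [← hlogK, ← Real.logb_mul hK0.ne' (by linarith)]
        exact Real.logb_le_logb_of_le (by norm_num) hM ih
      rw [palette]
      push_cast
      nlinarith
  have h1 := one_le_logStar hn
  have h2 := claim (logStar n - 1) (by omega)
  rw [show logStar n - 1 + 1 = logStar n by omega] at h2
  have h3 := hbig (logStar n) le_rfl
  have h4 := iterate_logStar_le_one n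
  nlinarith

/-- The number of rounds in which the colour reduction produces a palette of size `q`. -/
noncomputable def colorRounds (q N : ℕ) : ℕ := sInf {t | palette N t ≤ q}

theorem palette_colorRounds_le {n c N : ℕ} (hn : 2 ≤ n) (hN : N ≤ n ^ c) :
    palette N (colorRounds (2 * 2 ^ (c + 4)) N) ≤ 2 * 2 ^ (c + 4) := by
  obtain ⟨t, -, h⟩ := exists_palette_le_pow hn hN
  exact Nat.sInf_mem (s := {t | palette N t ≤ 2 * 2 ^ (c + 4)}) ⟨t, h⟩

theorem colorRounds_le_logStar {n c N : ℕ} (hn : 2 ≤ n) (hN : N ≤ n ^ c) :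
    colorRounds (2 * 2 ^ (c + 4)) N ≤ logStar n := by
  obtain ⟨t, ht, h⟩ := exists_palette_le_pow hn hN
  exact (Nat.sInf_le (s := {t | palette N t ≤ 2 * 2 ^ (c + 4)}) h).trans ht

end LogStar

/-! ### Locality -/

section Locality

open SimpleGraph

/-- A graph with two sets of vertices. -/
structure CoverInstance (V : Type*) where
  /-- the network -/
  graph : SimpleGraph V
  /-- the initial vertex cover -/
  α : Finset V
  /-- the final vertex cover -/
  β : Finset V

variable {V : Type*}

namespace CoverInstance

/-- The instances look alike within distance `r` of `v`. -/
def Agree (r : ℕ) (I J : CoverInstance V) (v : V) : Prop :=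
  ∀ x, Within I.graph r v x → (x ∈ I.α ↔ x ∈ J.α) ∧ (x ∈ I.β ↔ x ∈ J.β) ∧
    ∀ y, I.graph.Adj x y ↔ J.graph.Adj x y

namespace Agree

variable {r d : ℕ} {I J : CoverInstance V} {v x : V}

theorem mono (h : Agree r I J v) (hd : d ≤ r) : Agree d I J v := fun x hx => h x (hx.mono hd)

theorem of_within (h : Agree r I J v) (hx : Within I.graph d v x) {r' : ℕ} (hr : r' + d ≤ r) :
    Agree r' I J x := fun y hy => h y ((hx.trans hy).mono (by omega))

/-- Edges at vertices within distance `r` are shared, so even the balls of radius `r + 1` coincide;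
this makes agreement symmetric. -/
theorem within_of_within (h : Agree r I J v) (hd : d ≤ r + 1) (hx : Within J.graph d v x) :
    Within I.graph d v x := by
  induction d generalizing r v with
  | zero => rw [hx.eq_of_zero]; exact .refl _ _ _
  | succ d ih =>
    rw [Within.succ_iff] at hx ⊢
    rcases hx with rfl | ⟨z, hz, hzx⟩
    · exact Or.inl rfl
    · have hz' := ((h v (.refl _ _ _)).2.2 z).2 hz
      refine Or.inr ⟨z, hz', ?_⟩
      cases r with
      | zero =>
        obtain rfl : d = 0 := by omega
        rw [hzx.eq_of_zero]; exact .refl _ _ _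
      | succ r => exact ih (h.of_within (.of_adj hz') le_rfl) (by omega) hzx

theorem symm (h : Agree r I J v) : Agree r J I v := fun x hx => by
  obtain ⟨h1, h2, h3⟩ := h x (h.within_of_within (by omega) hx)
  exact ⟨h1.symm, h2.symm, fun y => (h3 y).symm⟩

end Agree

/-- The edges between `α \ β` and `β \ α`. -/
def exchange (I : CoverInstance V) : SimpleGraph V := exchangeGraph I.graph I.α I.β

/-- Vertices of `α ∪ β` at distance at most two. -/
def coverGraph (I : CoverInstance V) : SimpleGraph V where
  Adj x y := x ≠ y ∧ (x ∈ I.α ∨ x ∈ I.β) ∧ (y ∈ I.α ∨ y ∈ I.β) ∧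
    (I.graph.Adj x y ∨ ∃ z, I.graph.Adj x z ∧ I.graph.Adj z y)
  symm := ⟨fun _ _ h => ⟨h.1.symm, h.2.2.1, h.2.1, h.2.2.2.imp Adj.symm
    fun ⟨z, h1, h2⟩ => ⟨z, h2.symm, h1.symm⟩⟩⟩
  loopless := ⟨fun _ h => h.1 rfl⟩

theorem exchange_le_coverGraph (I : CoverInstance V) : I.exchange ≤ I.coverGraph := by
  intro x y h
  exact ⟨h.1.ne, by have := h.2; tauto, by have := h.2; tauto, Or.inl h.1⟩

theorem within_of_coverGraph_adj {I : CoverInstance V} {x y : V} (h : I.coverGraph.Adj x y) :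
    Within I.graph 2 x y := by
  rcases h.2.2.2 with h | ⟨z, h1, h2⟩
  · exact (Within.of_adj h).mono (by norm_num)
  · exact (Within.of_adj h1).trans (.of_adj h2)

theorem within_of_within_coverGraph {I : CoverInstance V} {r : ℕ} {x y : V}
    (h : Within I.coverGraph r x y) : Within I.graph (2 * r) x y := by
  induction r generalizing x with
  | zero => rw [h.eq_of_zero]; exact .refl _ _ _
  | succ r ih =>
    rcases Within.succ_iff.1 h with rfl | ⟨z, h1, h2⟩
    · exact .refl _ _ _
    · exact ((within_of_coverGraph_adj h1).trans (ih h2)).mono (by omega)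

/-- A graph whose edges are determined by the vicinity of their ends. -/
def IsLocalGraph (G : CoverInstance V → SimpleGraph V) : Prop :=
  (∀ I J x y, Agree 2 I J x → (G I).Adj x y → (G J).Adj x y) ∧
    ∀ I x y, (G I).Adj x y → Within I.graph 2 x y

theorem isLocalGraph_coverGraph : IsLocalGraph (V := V) coverGraph := by
  refine ⟨fun I J x y h hxy => ?_, fun I x y => within_of_coverGraph_adj⟩
  have hx := h x (.refl _ _ _)
  have hy := h y (within_of_coverGraph_adj hxy)
  obtain ⟨h1, h2, h3, h4⟩ := hxy
  refine ⟨h1, by rwa [← hx.1, ← hx.2.1], by rwa [← hy.1, ← hy.2.1], ?_⟩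
  rcases h4 with h4 | ⟨z, h4, h5⟩
  · exact Or.inl ((hx.2.2 y).1 h4)
  · have hz := h z ((Within.of_adj h4).mono (by norm_num))
    exact Or.inr ⟨z, (hx.2.2 z).1 h4, (hz.2.2 y).1 h5⟩

theorem isLocalGraph_exchange : IsLocalGraph (V := V) exchange := by
  refine ⟨fun I J x y h hxy => ?_,
    fun I x y h => within_of_coverGraph_adj (exchange_le_coverGraph I h)⟩
  have hx := h x (.refl _ _ _)
  have hy := h y ((Within.of_adj hxy.1).mono (by norm_num))
  refine ⟨(hx.2.2 y).1 hxy.1, ?_⟩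
  rw [← hx.1, ← hx.2.1, ← hy.1, ← hy.2.1]
  exact hxy.2

/-- The value at a vertex depends only on its vicinity of radius `R`. -/
def IsLocal {X : Type*} (R : ℕ) (F : CoverInstance V → V → X) : Prop :=
  ∀ I J v, Agree R I J v → F I v = F J v

theorem IsLocal.mono {X : Type*} {R R' : ℕ} {F : CoverInstance V → V → X} (h : IsLocal R F)
    (hR : R ≤ R') : IsLocal R' F := fun I J v hv => h I J v (hv.mono hR)

/-! ### Locality radii of the operations on pointers. -/

section Pointers

variable {P : CoverInstance V → V → V} {R δ : ℕ} (c : V → ℕ)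

theorem IsLocal.reduceColor (hP : IsLocal R P) (hδ : ∀ I v, Within I.graph δ v (P I v)) (j : ℕ) :
    IsLocal (R + j * δ) fun I => reduceColor (P I) c j := by
  induction j with
  | zero => exact fun I J v _ => rfl
  | succ j ih =>
    intro I J v h
    have e : P I v = P J v := hP I J v (h.mono (by nlinarith))
    have h1 := ih I J v (h.mono (by nlinarith))
    have h2 := ih I J (P I v) (h.of_within (hδ I v) (by nlinarith))
    simp only at h1 h2
    simp only [_root_.reduceColor]
    rw [h1, h2, e]

theorem IsLocal.pointerRank (hP : IsLocal R P) (hδ : ∀ I v, Within I.graph δ v (P I v)) (t : ℕ) :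
    IsLocal (R + t * δ) fun I => pointerRank (P I) c t := by
  intro I J v h
  have e : P I v = P J v := hP I J v (h.mono (by nlinarith))
  have h1 := hP.reduceColor c hδ t I J v h
  simp only at h1
  simp only [_root_.pointerRank]
  rw [h1, e]

/-- The vertices that point to `v` lie within `δ` of `v`, so their pointers and ranks can be
inspected at the cost of an additional `δ`. -/
theorem IsLocal.follow {rank : CoverInstance V → V → ℕ} (hP : IsLocal R P)
    (hδ : ∀ I v, Within I.graph δ v (P I v)) (hrank : IsLocal R rank) :
    IsLocal (R + δ) fun I => follow (P I) (rank I) := by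
  have key : ∀ I J v, Agree (R + δ) I J v → (∃ u, P I u = v ∧ u ≠ v ∧ rank I v < rank I u) →
      ∃ u, P J u = v ∧ u ≠ v ∧ rank J v < rank J u := by
    rintro I J v h ⟨u, h1, h2, h3⟩
    have hu : Agree R I J u := h.of_within (h1 ▸ (hδ I u).symm) le_rfl
    exact ⟨u, by rw [← hP I J u hu, h1], h2, by
      rwa [← hrank I J v (h.mono (by omega)), ← hrank I J u hu]⟩
  intro I J v h
  have e : P I v = P J v := hP I J v (h.mono (by omega))
  have e1 : rank I v = rank J v := hrank I J v (h.mono (by omega))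
  have e2 : rank I (P I v) = rank J (P I v) := hrank I J _ (h.of_within (hδ I v) le_rfl)
  have e3 : (∃ u, P I u = v ∧ u ≠ v ∧ rank I v < rank I u) =
      ∃ u, P J u = v ∧ u ≠ v ∧ rank J v < rank J u :=
    propext ⟨key I J v h, key J I v h.symm⟩
  simp only [_root_.follow]
  rw [e3, e2, e1, e]

theorem IsLocal.iterate (hP : IsLocal R P) (hδ : ∀ I v, Within I.graph δ v (P I v)) (m : ℕ) :
    IsLocal (R + m * δ) fun I => (P I)^[m] := by
  induction m with
  | zero => exact fun I J v _ => rfl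
  | succ m ih =>
    intro I J v h
    have h2 := ih I J (P I v) (h.of_within (hδ I v) (by nlinarith))
    simp only at h2
    simp only [Function.iterate_succ_apply]
    rw [h2, hP I J v (h.mono (by nlinarith))]

theorem within_follow (rank : CoverInstance V → V → ℕ) (hδ : ∀ I v, Within I.graph δ v (P I v))
    (I : CoverInstance V) (v : V) : Within I.graph δ v (follow (P I) (rank I) v) := by
  rcases follow_eq (P I) (rank I) v with h | h
  · rw [h]; exact .refl _ _ _
  · rw [h]; exact hδ I v

theorem IsLocal.coarsen {cl : CoverInstance V → V → V} {T D : ℕ} (hcl : IsLocal T cl)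
    (hD : ∀ I v, Within I.graph D v (cl I v)) (hT : T ≤ R) (hP : IsLocal R P)
    (hδ : ∀ I v, Within I.graph δ v (P I v)) (t q : ℕ) :
    IsLocal (R + (t + 2 * q + 1) * δ + D) fun I =>
      coarsen (P I) (_root_.pointerRank (P I) c t) q (cl I) := by
  have h1 := hP.pointerRank c hδ t
  have h2 := (hP.mono (by nlinarith : R ≤ R + t * δ)).follow hδ h1
  have h3 := h2.iterate (within_follow _ hδ) (2 * q)
  intro I J v h
  have e : cl I v = cl J v := hcl I J v (h.mono (by nlinarith))
  have e2 := h3 I J (cl I v) (h.of_within (hD I v) (by ring_nf; omega))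
  simp only at e2
  simp only [_root_.coarsen]
  rw [e2, e]

end Pointers

section Target

variable {cl : CoverInstance V → V → V} {T D : ℕ}

theorem leadsTo_of_agree {G : CoverInstance V → SimpleGraph V} (hG : IsLocalGraph G)
    (hcl : IsLocal T cl) (hT : 2 ≤ T) (hD : ∀ I v, Within I.graph D v (cl I v))
    {I J : CoverInstance V} {r r' : V} (h : Agree (T + D + 2) I J r)
    (hr : LeadsTo (G I) (cl I) r r') : LeadsTo (G J) (cl J) r r' := by
  obtain ⟨x, y, hx, hxy, hy, hne⟩ := hr
  have hrx : Within I.graph D r x := hx ▸ (hD I x).symm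
  refine ⟨x, y, ?_, hG.1 I J x y (h.of_within hrx (by omega)) hxy, ?_, hne⟩
  · rw [← hcl I J x (h.of_within hrx (by omega)), hx]
  · rw [← hcl I J y (h.of_within (hrx.trans (hG.2 I x y hxy)) (by omega)), hy]

theorem IsLocal.target (hcl : IsLocal T cl) (hT : 2 ≤ T)
    (hD : ∀ I v, Within I.graph D v (cl I v)) (m : ℕ) :
    IsLocal (T + D + 2) fun I => target I.exchange I.coverGraph (cl I) m := by
  intro I J r h
  have hset : ∀ I J, Agree (T + D + 2) I J r → {x | cl I x = r} ⊆ {x | cl J x = r} := by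
    intro I J h x (hx : cl I x = r)
    have hrx : Within I.graph D r x := hx ▸ (hD I x).symm
    change cl J x = r
    rw [← hcl I J x (h.of_within hrx (by omega)), hx]
  have e1 : {x | cl I x = r} = {x | cl J x = r} := (hset I J h).antisymm (hset J I h.symm)
  have e2 : ∀ G : CoverInstance V → SimpleGraph V, IsLocalGraph G →
      LeadsTo (G I) (cl I) r = LeadsTo (G J) (cl J) r := fun G hG => funext fun r' =>
    propext ⟨leadsTo_of_agree hG hcl hT hD h, leadsTo_of_agree hG hcl hT hD h.symm⟩
  simp only [_root_.target]
  rw [e1, e2 _ isLocalGraph_exchange, e2 _ isLocalGraph_coverGraph]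

end Target

/-- The clustering after `i` rounds of merging, with colours `c`, `t` rounds of colour reduction
and a final palette of size `q`. -/
noncomputable def clustering (c : V → ℕ) (t q : ℕ) : ℕ → CoverInstance V → V → V
  | 0, _ => id
  | i + 1, I =>
    coarsen (target I.exchange I.coverGraph (clustering c t q i I) (2 * 2 ^ i))
      (_root_.pointerRank (target I.exchange I.coverGraph (clustering c t q i I) (2 * 2 ^ i)) c t)
      q (clustering c t q i I)

variable [Finite V] {c : V → ℕ} {N t q : ℕ}

theorem isClustering_clustering (hinj : Function.Injective c) (hc : ∀ r, c r < N)
    (hq : palette N t ≤ q) (i : ℕ) (I : CoverInstance V) :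
    IsClustering I.exchange I.coverGraph (clustering c t q i I) (2 ^ i) := by
  induction i with
  | zero => exact isClustering_id _ _
  | succ i ih =>
    rw [pow_succ']
    exact ih.coarsen I.exchange_le_coverGraph (pointerRank_le hc hq)
      fun r hr => pointerRank_ne hinj hr

theorem within_coverGraph_clustering (hinj : Function.Injective c) (hc : ∀ r, c r < N)
    (hq : palette N t ≤ q) (i : ℕ) (I : CoverInstance V) (v : V) :
    Within I.coverGraph (5 * (2 * q + 1) * 2 ^ i) v (clustering c t q i I v) := by
  induction i generalizing v with
  | zero => exact .refl _ _ _
  | succ i ih =>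
    refine (within_coarsen I.exchange_le_coverGraph (isClustering_clustering hinj hc hq i I) ih
      v).mono ?_
    have : 1 ≤ 2 ^ i := Nat.one_le_two_pow
    have h2 : (2 * q + 1) * 1 ≤ (2 * q + 1) * 2 ^ i := Nat.mul_le_mul_left _ this
    rw [pow_succ]
    nlinarith

theorem within_clustering (hinj : Function.Injective c) (hc : ∀ r, c r < N)
    (hq : palette N t ≤ q) (i : ℕ) (I : CoverInstance V) (v : V) :
    Within I.graph (10 * (2 * q + 1) * 2 ^ i) v (clustering c t q i I v) :=
  (within_of_within_coverGraph (within_coverGraph_clustering hinj hc hq i I v)).mono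
    (by ring_nf; omega)

/-- Each level adds a radius proportional to `(t + 2 * q + 1) * 2 ^ i`, and the geometric sum is
dominated by the last level. The summand `2` covers the radius on which the edges of both graphs
depend. -/
theorem isLocal_clustering (hinj : Function.Injective c) (hc : ∀ r, c r < N)
    (hq : palette N t ≤ q) (i : ℕ) :
    IsLocal (2 + 40 * (2 * q + 1) * (t + 2 * q + 1) * 2 ^ i) (clustering c t q i) := by
  induction i with
  | zero => exact fun I J v _ => rfl
  | succ i ih =>
    have hD := within_clustering hinj hc hq i
    have htar := ih.target (by omega) hD (2 * 2 ^ i)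
    have hδ : ∀ (I : CoverInstance V) v, Within I.graph (16 * (2 * q + 1) * 2 ^ i) v
        (_root_.target I.exchange I.coverGraph (clustering c t q i I) (2 * 2 ^ i) v) := by
      intro I v
      refine (within_of_within_coverGraph (within_target I.exchange_le_coverGraph
        (isClustering_clustering hinj hc hq i I)
        (within_coverGraph_clustering hinj hc hq i I) v)).mono ?_
      have : 1 ≤ 2 ^ i := Nat.one_le_two_pow
      have h2 : 0 ≤ q * 2 ^ i := Nat.zero_le _
      nlinarith
    refine (ih.coarsen c hD (by omega) htar hδ t q).mono ?_
    have h1 : 1 ≤ 2 ^ i := Nat.one_le_two_pow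
    set S := 2 ^ i
    have hA : 2 * q + 1 ≤ (2 * q + 1) * (t + 2 * q + 1) := Nat.le_mul_of_pos_right _ (by omega)
    have hB : (2 * q + 1) * S ≤ (2 * q + 1) * (t + 2 * q + 1) * S := Nat.mul_le_mul_right _ hA
    have hC : S ≤ (2 * q + 1) * S := Nat.le_mul_of_pos_left _ (by omega)
    rw [pow_succ]
    have e : (t + 2 * q + 1) * (16 * (2 * q + 1) * S) = 16 * ((2 * q + 1) * (t + 2 * q + 1) * S) := by
      ring
    have e2 : 40 * (2 * q + 1) * (t + 2 * q + 1) * S = 40 * ((2 * q + 1) * (t + 2 * q + 1) * S) := by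
      ring
    have e3 : 40 * (2 * q + 1) * (t + 2 * q + 1) * (S * 2) =
        80 * ((2 * q + 1) * (t + 2 * q + 1) * S) := by ring
    have e4 : 10 * (2 * q + 1) * S = 10 * ((2 * q + 1) * S) := by ring
    rw [e, e2, e3, e4]
    omega

end CoverInstance

end Locality

/-! ### Schedules from clusterings -/

section Schedule

open SimpleGraph

variable {V : Type*} [DecidableEq V]

/-- A schedule that replaces `A` by `B` in `2 * k + 1` steps. -/
noncomputable def exchangeSchedule (H : SimpleGraph V) (A B : Finset V) (k : ℕ) :
    ℕ → Finset V :=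
  open scoped Classical in
  if h : ∃ S, IsExchange H A B (2 * k + 1)
      (max A.card B.card + 1 + ((A.card + B.card) / k + 1)) S then h.choose else fun _ => ∅

theorem IsCactus.isExchange_exchangeSchedule {H : SimpleGraph V} (hH : IsCactus H)
    {A B : Finset V} (hd : Disjoint A B) {k : ℕ} (hk : 0 < k) :
    IsExchange H A B (2 * k + 1) (max A.card B.card + 1 + ((A.card + B.card) / k + 1))
      (exchangeSchedule H A B k) := by
  have hlt := Nat.lt_mul_div_succ (A.card + B.card) hk
  rw [mul_comm] at hlt
  have h := hH.exists_isExchange hd (k := k) (s := (A.card + B.card) / k + 1) (by omega) (by omega)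
  rw [exchangeSchedule, dif_pos h]
  exact h.choose_spec

namespace IsExchange

variable {H : SimpleGraph V} {A B : Finset V} {m c : ℕ} {S : ℕ → Finset V}

theorem batch_sub (h : IsExchange H A B m c S) (i d : ℕ) :
    (∀ x ∈ B, x ∈ S (i - d) ↔ x ∈ S (i + 1 - d)) ∨ (∀ x ∈ A, x ∈ S (i - d) ↔ x ∈ S (i + 1 - d)) := by
  rcases Nat.lt_or_ge i d with hi | hi
  · left; intro x _; rw [Nat.sub_eq_zero_of_le hi.le, Nat.sub_eq_zero_of_le (by omega)]
  · rw [show i + 1 - d = i - d + 1 by omega]; exact h.batch _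

theorem cost_sub (h : IsExchange H A B m c S) (i d : ℕ) :
    (S (i - d) ∪ S (i + 1 - d)).card ≤ c := by
  rcases Nat.lt_or_ge i d with hi | hi
  · rw [Nat.sub_eq_zero_of_le hi.le, Nat.sub_eq_zero_of_le (by omega), Finset.union_self]
    exact (Finset.card_le_card Finset.subset_union_left).trans (h.cost 0)
  · rw [show i + 1 - d = i - d + 1 by omega]; exact h.cost _

end IsExchange

/-- The edges of `H` in the cluster `r`. -/
def inCluster (H : SimpleGraph V) (cl : V → V) (r : V) : SimpleGraph V where
  Adj x y := H.Adj x y ∧ cl x = r ∧ cl y = r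
  symm := ⟨fun _ _ h => ⟨h.1.symm, h.2.2, h.2.1⟩⟩
  loopless := ⟨fun _ h => h.1.ne rfl⟩

namespace CoverInstance

variable [Fintype V] (I : CoverInstance V) (cl : V → V) (k : ℕ)

open scoped Classical in
/-- The vertices of `β \ α` with neighbours in `α \ β` in other clusters. -/
noncomputable def early : Finset V :=
  (I.β \ I.α).filter fun x => ∃ y, I.exchange.Adj x y ∧ cl y ≠ cl x

/-- The vertices of the cluster `r` that have to be removed. -/
noncomputable def oldPart (r : V) : Finset V := (I.α \ I.β).filter fun x => cl x = r

/-- The vertices of the cluster `r` that have to be added, except for the early ones. -/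
noncomputable def newPart (r : V) : Finset V :=
  ((I.β \ I.α) \ I.early cl).filter fun x => cl x = r

/-- When the cluster `r` starts to be exchanged: shrinking clusters before growing ones. -/
noncomputable def start (r : V) : ℕ :=
  if (I.newPart cl r).card ≤ (I.oldPart cl r).card then 1 else 2 * k + 2

/-- The vertices of the cluster `r` that change their membership and are present at time `i`. -/
noncomputable def clusterSchedule (r : V) (i : ℕ) : Finset V :=
  exchangeSchedule (inCluster I.exchange cl r) (I.oldPart cl r) (I.newPart cl r) k
    (i - I.start cl k r)

/-- Add the early vertices, then exchange the shrinking clusters in parallel, then the growing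
ones. -/
noncomputable def schedule (i : ℕ) : Finset V :=
  Finset.univ.filter fun v => (v ∈ I.α ∧ v ∈ I.β) ∨ (v ∈ I.early cl ∧ 1 ≤ i) ∨
    v ∈ I.clusterSchedule cl k (cl v) i

variable {I cl k}

theorem mem_schedule {i : ℕ} {v : V} : v ∈ I.schedule cl k i ↔ (v ∈ I.α ∧ v ∈ I.β) ∨
    (v ∈ I.early cl ∧ 1 ≤ i) ∨ v ∈ I.clusterSchedule cl k (cl v) i := by
  simp [schedule]

theorem mem_early {v : V} : v ∈ I.early cl ↔
    (v ∈ I.β ∧ v ∉ I.α) ∧ ∃ y, I.exchange.Adj v y ∧ cl y ≠ cl v := by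
  simp [early]

theorem mem_oldPart {r v : V} : v ∈ I.oldPart cl r ↔ (v ∈ I.α ∧ v ∉ I.β) ∧ cl v = r := by
  simp [oldPart]

theorem mem_newPart {r v : V} : v ∈ I.newPart cl r ↔
    ((v ∈ I.β ∧ v ∉ I.α) ∧ v ∉ I.early cl) ∧ cl v = r := by
  simp [newPart]

/-! ### Validity and cost of the parallel schedule. -/

section Correctness

theorem isExchange_cluster (hcact : IsCactus I.exchange) (hk : 0 < k) (r : V) :
    IsExchange (inCluster I.exchange cl r) (I.oldPart cl r) (I.newPart cl r) (2 * k + 1)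
      (max (I.oldPart cl r).card (I.newPart cl r).card + 1 +
        (((I.oldPart cl r).card + (I.newPart cl r).card) / k + 1))
      (exchangeSchedule (inCluster I.exchange cl r) (I.oldPart cl r) (I.newPart cl r) k) := by
  refine IsCactus.isExchange_exchangeSchedule (hcact.mono fun _ _ (h : I.exchange.Adj _ _ ∧ _) => h.1) ?_ hk
  rw [Finset.disjoint_left]
  intro x hx hx'
  rw [mem_oldPart] at hx
  rw [mem_newPart] at hx'
  exact hx.1.2 hx'.1.1.1

theorem clusterSchedule_subset (hcact : IsCactus I.exchange) (hk : 0 < k) {r v : V} {i : ℕ}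
    (h : v ∈ I.clusterSchedule cl k r i) :
    ((v ∈ I.α ∧ v ∉ I.β) ∨ (v ∈ I.β ∧ v ∉ I.α) ∧ v ∉ I.early cl) ∧ cl v = r := by
  have := (isExchange_cluster hcact hk r).subset _ h
  rw [Finset.mem_union, mem_oldPart, mem_newPart] at this
  tauto

theorem mem_schedule_old {v : V} {i : ℕ}
    (hv : v ∈ I.α ∧ v ∉ I.β) :
    v ∈ I.schedule cl k i ↔ v ∈ I.clusterSchedule cl k (cl v) i := by
  rw [mem_schedule, mem_early]; tauto

theorem mem_schedule_new {v : V} {i : ℕ}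
    (hv : v ∈ I.β ∧ v ∉ I.α) (hv' : v ∉ I.early cl) :
    v ∈ I.schedule cl k i ↔ v ∈ I.clusterSchedule cl k (cl v) i := by
  rw [mem_schedule]; tauto

theorem schedule_zero (hcact : IsCactus I.exchange) (hk : 0 < k) : I.schedule cl k 0 = I.α := by
  ext v
  rw [mem_schedule, clusterSchedule, Nat.zero_sub, (isExchange_cluster hcact hk _).zero,
    mem_oldPart]
  by_cases v ∈ I.β <;> simp_all

theorem schedule_last (hcact : IsCactus I.exchange) (hk : 0 < k) :
    I.schedule cl k (4 * k + 3) = I.β := by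
  ext v
  rw [mem_schedule, clusterSchedule, (isExchange_cluster hcact hk _).eq_of_le, mem_newPart]
  · have := mem_early (I := I) (cl := cl) (v := v)
    have h1 : 1 ≤ 4 * k + 3 := by omega
    tauto
  -- A cluster that starts at `2 * k + 2` ends `2 * k + 1` steps later, at exactly `4 * k + 3`.
  · unfold start
    split_ifs <;> omega

theorem adj_cases (hα : I.graph.IsVertexCover (I.α : Set V))
    (hβ : I.graph.IsVertexCover (I.β : Set V)) {x y : V} (h : I.graph.Adj x y) :
    (x ∈ I.α ∧ x ∈ I.β) ∨ (y ∈ I.α ∧ y ∈ I.β) ∨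
      ((x ∈ I.α ∧ x ∉ I.β) ∧ (y ∈ I.β ∧ y ∉ I.α) ∧ I.exchange.Adj x y) ∨
      ((y ∈ I.α ∧ y ∉ I.β) ∧ (x ∈ I.β ∧ x ∉ I.α) ∧ I.exchange.Adj y x) := by
  have h1 := hα.mem_or h
  have h2 := hβ.mem_or h
  have e1 : I.exchange.Adj x y ↔ I.graph.Adj x y ∧ ((x ∈ I.α ∧ x ∉ I.β ∧ y ∈ I.β ∧ y ∉ I.α) ∨
      (x ∈ I.β ∧ x ∉ I.α ∧ y ∈ I.α ∧ y ∉ I.β)) := Iff.rfl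
  have e2 := I.exchange.adj_comm x y
  tauto

theorem label_eq_of_not_early {a b : V} (hb : b ∈ I.β ∧ b ∉ I.α) (hE : b ∉ I.early cl)
    (hab : I.exchange.Adj a b) : cl a = cl b := by
  by_contra h
  exact hE (mem_early.2 ⟨hb, a, hab.symm, h⟩)

/-- An exchange edge between clusters is covered by `α` at time `0` and by its early end afterwards;
an edge whose `β`-end is not early lies in one cluster and is covered by the exchange there. -/
theorem isVertexCover_schedule (hα : I.graph.IsVertexCover (I.α : Set V))
    (hβ : I.graph.IsVertexCover (I.β : Set V)) (hcact : IsCactus I.exchange) (hk : 0 < k) (i : ℕ) :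
    I.graph.IsVertexCover (I.schedule cl k i : Set V) := by
  have common : ∀ v, v ∈ I.α ∧ v ∈ I.β → v ∈ I.schedule cl k i := fun v hv =>
    mem_schedule.2 (Or.inl hv)
  have key : ∀ a b, (a ∈ I.α ∧ a ∉ I.β) → (b ∈ I.β ∧ b ∉ I.α) → I.exchange.Adj a b →
      a ∈ I.schedule cl k i ∨ b ∈ I.schedule cl k i := by
    intro a b ha hb hab
    by_cases hE : b ∈ I.early cl
    · rcases Nat.eq_zero_or_pos i with rfl | hi
      · left; rw [schedule_zero hcact hk]; exact ha.1
      · right; exact mem_schedule.2 (Or.inr (Or.inl ⟨hE, hi⟩))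
    · have hl := label_eq_of_not_early hb hE hab
      rw [mem_schedule_old ha, mem_schedule_new hb hE, hl]
      exact (isExchange_cluster hcact hk (cl b)).cover _ a (mem_oldPart.2 ⟨ha, hl⟩) b
        (mem_newPart.2 ⟨⟨hb, hE⟩, rfl⟩) ⟨hab, hl, rfl⟩
  intro x y hxy
  simp only [Finset.mem_coe]
  rcases adj_cases hα hβ hxy with h | h | ⟨h1, h2, h3⟩ | ⟨h1, h2, h3⟩
  · exact Or.inl (common x h)
  · exact Or.inr (common y h)
  · exact key x y h1 h2 h3
  · exact (key y x h1 h2 h3).symm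

/-- Early vertices move only in the first step, before any cluster starts. Later changes at both
ends of an edge could only occur inside one cluster, where a batch stays on one side. -/
theorem isIndepSet_schedule (hα : I.graph.IsVertexCover (I.α : Set V))
    (hβ : I.graph.IsVertexCover (I.β : Set V)) (hcact : IsCactus I.exchange) (hk : 0 < k) (i : ℕ) :
    I.graph.IsIndepSet
      (symmDiff (I.schedule cl k i) (I.schedule cl k (i + 1)) : Finset V) := by
  have common : ∀ v, v ∈ I.α ∧ v ∈ I.β → ∀ i, v ∈ I.schedule cl k i := fun v hv _ =>
    mem_schedule.2 (Or.inl hv)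
  have key : ∀ a b, (a ∈ I.α ∧ a ∉ I.β) → (b ∈ I.β ∧ b ∉ I.α) → I.exchange.Adj a b →
      (a ∈ I.schedule cl k i ↔ a ∈ I.schedule cl k (i + 1)) ∨
      (b ∈ I.schedule cl k i ↔ b ∈ I.schedule cl k (i + 1)) := by
    intro a b ha hb hab
    by_cases hE : b ∈ I.early cl
    · rcases Nat.eq_zero_or_pos i with rfl | hi
      · left
        rw [mem_schedule_old ha, mem_schedule_old ha]
        have h1 : 1 ≤ I.start cl k (cl a) := by unfold start; split_ifs <;> omega
        simp only [clusterSchedule]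
        rw [show 0 + 1 - I.start cl k (cl a) = 0 - I.start cl k (cl a) by omega]
      · right
        exact iff_of_true (mem_schedule.2 (Or.inr (Or.inl ⟨hE, hi⟩)))
          (mem_schedule.2 (Or.inr (Or.inl ⟨hE, by omega⟩)))
    · have hl := label_eq_of_not_early hb hE hab
      rw [mem_schedule_old ha, mem_schedule_old ha,
        mem_schedule_new hb hE, mem_schedule_new hb hE, hl]
      rcases (isExchange_cluster hcact hk (cl b)).batch_sub i (I.start cl k (cl b)) with h | h
      · exact Or.inr (h b (mem_newPart.2 ⟨⟨hb, hE⟩, rfl⟩))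
      · exact Or.inl (h a (mem_oldPart.2 ⟨ha, hl⟩))
  intro x hx y hy _ hxy
  rw [Finset.mem_coe, Finset.mem_symmDiff] at hx hy
  rcases adj_cases hα hβ hxy with h | h | ⟨h1, h2, h3⟩ | ⟨h1, h2, h3⟩
  · have := common x h i; have := common x h (i + 1); tauto
  · have := common y h i; have := common y h (i + 1); tauto
  · have := key x y h1 h2 h3; tauto
  · have := key y x h1 h2 h3; tauto

/-- The labels of the covered vertices. -/
def coverLabels (I : CoverInstance V) (cl : V → V) : Finset V := (I.α ∪ I.β).image cl

/-- The order of the clusters matters here: until the growing ones start, each cluster is charged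
its old size, and from then on its new size. So the sums compare with `α` alone or with `β` alone,
and not with a sum of maxima. -/
theorem card_clusterSchedule_le (hcact : IsCactus I.exchange) (hk : 0 < k) (i : ℕ) :
    (∀ r, (I.clusterSchedule cl k r i ∪ I.clusterSchedule cl k r (i + 1)).card ≤
      (I.oldPart cl r).card + 2 + ((I.oldPart cl r).card + (I.newPart cl r).card) / k) ∨
    (∀ r, (I.clusterSchedule cl k r i ∪ I.clusterSchedule cl k r (i + 1)).card ≤
      (I.newPart cl r).card + 2 + ((I.oldPart cl r).card + (I.newPart cl r).card) / k) := by
  rcases Nat.lt_or_ge i (2 * k + 2) with hi | hi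
  · left
    intro r
    have hex := isExchange_cluster (cl := cl) hcact hk r
    by_cases hle : (I.newPart cl r).card ≤ (I.oldPart cl r).card
    · have := hex.cost_sub i (I.start cl k r)
      rw [max_eq_left hle] at this
      simp only [clusterSchedule]
      omega
    · simp only [clusterSchedule, start, hle, if_false]
      rw [Nat.sub_eq_zero_of_le hi.le, Nat.sub_eq_zero_of_le (by omega), Finset.union_self,
        hex.zero]
      generalize (_ : ℕ) / k = d
      omega
  · right
    intro r
    have hex := isExchange_cluster (cl := cl) hcact hk r
    by_cases hle : (I.newPart cl r).card ≤ (I.oldPart cl r).card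
    · simp only [clusterSchedule, start, hle, if_true]
      rw [hex.eq_of_le _ (by omega), hex.eq_of_le _ (by omega), Finset.union_self]
      generalize (_ : ℕ) / k = d
      omega
    · have := hex.cost_sub i (I.start cl k r)
      rw [max_eq_right (by omega)] at this
      simp only [clusterSchedule]
      omega

theorem card_schedule_le (hcact : IsCactus I.exchange) (hk : 0 < k) (i : ℕ) :
    (I.schedule cl k i ∪ I.schedule cl k (i + 1)).card ≤
      max I.α.card I.β.card + ((I.early cl).card + 2 * (I.coverLabels cl).card +
        (I.α ∪ I.β).card / k) := by
  set R := I.coverLabels cl with hR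
  let U : V → Finset V := fun r => I.clusterSchedule cl k r i ∪ I.clusterSchedule cl k r (i + 1)
  have hsub : I.schedule cl k i ∪ I.schedule cl k (i + 1) ⊆
      ((I.α ∩ I.β) ∪ I.early cl) ∪ R.biUnion U := by
    intro v hv
    rw [Finset.mem_union, mem_schedule, mem_schedule] at hv
    rw [Finset.mem_union, Finset.mem_union, Finset.mem_inter, Finset.mem_biUnion]
    have aux : ∀ j, v ∈ I.clusterSchedule cl k (cl v) j → cl v ∈ R := fun j hj => by
      have := (clusterSchedule_subset hcact hk hj).1
      refine Finset.mem_image_of_mem _ (Finset.mem_union.2 ?_)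
      tauto
    rcases hv with (h | h | h) | (h | h | h)
    · exact Or.inl (Or.inl h)
    · exact Or.inl (Or.inr h.1)
    · exact Or.inr ⟨_, aux _ h, Finset.mem_union_left _ h⟩
    · exact Or.inl (Or.inl h)
    · exact Or.inl (Or.inr h.1)
    · exact Or.inr ⟨_, aux _ h, Finset.mem_union_right _ h⟩
  have hc1 : (I.schedule cl k i ∪ I.schedule cl k (i + 1)).card ≤
      (I.α ∩ I.β).card + (I.early cl).card + ∑ r ∈ R, (U r).card :=
    (Finset.card_le_card hsub).trans ((Finset.card_union_le _ _).trans
      (add_le_add (Finset.card_union_le _ _) Finset.card_biUnion_le))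
  have hold : ∑ r ∈ R, (I.oldPart cl r).card = (I.α \ I.β).card := by
    refine (Finset.card_eq_sum_card_fiberwise fun x hx => ?_).symm
    exact Finset.mem_image_of_mem _ (Finset.mem_union_left _
      (Finset.mem_sdiff.1 (Finset.mem_coe.1 hx)).1)
  have hnew : ∑ r ∈ R, (I.newPart cl r).card ≤ (I.β \ I.α).card := by
    have : ∑ r ∈ R, (I.newPart cl r).card = ((I.β \ I.α) \ I.early cl).card := by
      refine (Finset.card_eq_sum_card_fiberwise fun x hx => ?_).symm
      exact Finset.mem_image_of_mem _ (Finset.mem_union_right _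
        (Finset.mem_sdiff.1 (Finset.mem_sdiff.1 (Finset.mem_coe.1 hx)).1).1)
    rw [this]
    exact Finset.card_le_card Finset.sdiff_subset
  have cA : (I.α \ I.β).card + (I.α ∩ I.β).card = I.α.card := Finset.card_sdiff_add_card_inter _ _
  have cB : (I.β \ I.α).card + (I.α ∩ I.β).card = I.β.card := by
    rw [Finset.inter_comm]; exact Finset.card_sdiff_add_card_inter _ _
  have hAB : (I.α \ I.β).card + (I.β \ I.α).card ≤ (I.α ∪ I.β).card := by
    rw [← Finset.card_union_of_disjoint]
    · refine Finset.card_le_card fun x hx => ?_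
      simp only [Finset.mem_union, Finset.mem_sdiff] at hx ⊢
      tauto
    · rw [Finset.disjoint_left]
      intro x hx hx'
      exact (Finset.mem_sdiff.1 hx).2 (Finset.mem_sdiff.1 hx').1
  have hdiv : ∑ r ∈ R, ((I.oldPart cl r).card + (I.newPart cl r).card) / k ≤
      (I.α ∪ I.β).card / k := by
    rw [Nat.le_div_iff_mul_le hk, Finset.sum_mul]
    refine (Finset.sum_le_sum fun r _ => Nat.div_mul_le_self _ _).trans ?_
    rw [Finset.sum_add_distrib]
    omega
  rcases card_clusterSchedule_le (cl := cl) hcact hk i with h | h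
  · have := Finset.sum_le_sum fun r (_ : r ∈ R) => h r
    rw [Finset.sum_add_distrib, Finset.sum_add_distrib, Finset.sum_const, smul_eq_mul] at this
    have := le_max_left I.α.card I.β.card
    simp only [U] at hc1
    omega
  · have := Finset.sum_le_sum fun r (_ : r ∈ R) => h r
    rw [Finset.sum_add_distrib, Finset.sum_add_distrib, Finset.sum_const, smul_eq_mul] at this
    have := le_max_right I.α.card I.β.card
    simp only [U] at hc1
    omega

end Correctness

/-- Two consecutive vertices of a walk cannot both be uncovered, so steps of length at most two lead
from one covered vertex to the next. -/
theorem coverGraph_reachable (hα : I.graph.IsVertexCover (I.α : Set V)) {x y : V}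
    (h : I.graph.Reachable x y) (hx : x ∈ I.α ∪ I.β) (hy : y ∈ I.α ∪ I.β) :
    I.coverGraph.Reachable x y := by
  obtain ⟨p⟩ := h
  obtain ⟨n, hn⟩ : ∃ n, p.length ≤ n := ⟨_, le_rfl⟩
  rw [Finset.mem_union] at hx hy
  induction n using Nat.strong_induction_on generalizing x with
  | _ n ih =>
    cases p with
    | nil => exact .refl _
    | @cons _ z _ hxz p =>
      rw [Walk.length_cons] at hn
      by_cases hz : z ∈ I.α ∨ z ∈ I.β
      · have hadj : I.coverGraph.Adj x z := ⟨hxz.ne, hx, hz, Or.inl hxz⟩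
        exact hadj.reachable.trans (ih (n - 1) (by omega) hz p (by omega))
      · cases p with
        | nil => exact (hz hy).elim
        | @cons _ w _ hzw p =>
          rw [Walk.length_cons] at hn
          have hw : w ∈ I.α ∨ w ∈ I.β := Or.inl ((hα.mem_or hzw).resolve_left fun h => hz (Or.inl h))
          have hrec := ih (n - 2) (by omega) hw p (by omega)
          by_cases hxw : x = w
          · exact hxw ▸ hrec
          · have hadj : I.coverGraph.Adj x w := ⟨hxw, hx, hw, Or.inr ⟨z, hxz, hzw⟩⟩
            exact hadj.reachable.trans hrec

/-- Each early vertex is the end of a crossing edge from `α`. -/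
theorem card_early_le (hcact : IsCactus I.exchange) (hJ : BoundaryConnected I.exchange cl) :
    (I.early cl).card ≤ 2 * (openLabels I.exchange cl).card := by
  refine le_trans ?_ (hcact.card_cutPairs_le I.α hJ)
  refine (Finset.card_le_card fun b hb => ?_).trans
    (Finset.card_image_le (s := cutPairs I.exchange I.α cl) (f := Prod.snd))
  obtain ⟨hb, a, hab, hne⟩ := mem_early.1 hb
  have hab' := hab.2
  exact Finset.mem_image.2 ⟨(a, b), mem_cutPairs.2 ⟨by tauto, hb.2, hab.symm, hne⟩, rfl⟩

theorem openLabels_subset : openLabels I.exchange cl ⊆ I.coverLabels cl := by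
  intro r hr
  obtain ⟨x, y, hxy, -, rfl⟩ := mem_openLabels.1 hr
  refine Finset.mem_image_of_mem _ (Finset.mem_union.2 ?_)
  have := hxy.2
  tauto

/-- Vertices outside of `α ∪ β` are isolated in the cover graph, hence form clusters of their own.
So cluster sizes count covered vertices only, and the error is relative to the covers and not to
`n`. -/
theorem cluster_subset_cover (hcl : IsClustering I.exchange I.coverGraph cl k) {w x : V}
    (hw : w ∈ I.α ∪ I.β) (hx : cl x = cl w) : x ∈ I.α ∪ I.β := by
  have hr : I.coverGraph.Reachable x w := by
    have h1 := (hcl.reachable x).mono (clusterGraph_le _ _)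
    have h2 := (hcl.reachable w).mono (clusterGraph_le _ _)
    rw [hx] at h1
    exact h1.trans h2.symm
  obtain ⟨p⟩ := hr
  cases p with
  | nil => exact hw
  | cons h p => exact Finset.mem_union.2 h.2.1

/-- If all clusters have at least `k` covered vertices, there are at most `|α ∪ β| / k` of them;
early vertices contribute two per cluster, rounding two per cluster, and chunks one further `|α ∪ β|
/ k`. A smaller cluster is a component of the cover graph, hence all of `α ∪ β`, and then only the
rounding term `2` is left. -/
theorem error_le (hα : I.graph.IsVertexCover (I.α : Set V)) (hcact : IsCactus I.exchange)
    (hconn : ∀ x ∈ I.α ∪ I.β, ∀ y ∈ I.α ∪ I.β, I.graph.Reachable x y)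
    (hcl : IsClustering I.exchange I.coverGraph cl k) :
    (I.early cl).card + 2 * (I.coverLabels cl).card + (I.α ∪ I.β).card / k ≤ 2 ∨
      k * ((I.early cl).card + 2 * (I.coverLabels cl).card + (I.α ∪ I.β).card / k) ≤
        5 * (I.α ∪ I.β).card := by
  set W := I.α ∪ I.β with hW
  by_cases hbig : ∀ w ∈ W, k ≤ {z | cl z = cl w}.ncard
  · right
    have hcard : (I.coverLabels cl).card * k ≤ W.card := by
      rw [← smul_eq_mul, Finset.card_eq_sum_card_image cl W]
      refine Finset.card_nsmul_le_sum _ _ _ fun r hr => ?_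
      obtain ⟨w, hw, rfl⟩ := Finset.mem_image.1 hr
      refine (hbig w hw).trans ?_
      rw [← Set.ncard_coe_finset]
      refine Set.ncard_le_ncard (fun z hz => ?_) (Set.toFinite _)
      have hz : cl z = cl w := hz
      simp only [Finset.coe_filter, Set.mem_ofPred_eq]
      exact ⟨cluster_subset_cover hcl hw hz, hz⟩
    have h1 := card_early_le hcact hcl.boundaryConnected
    have h2 := Finset.card_le_card (openLabels_subset (I := I) (cl := cl))
    have h3 := Nat.mul_div_le W.card k
    nlinarith
  · left
    push Not at hbig
    obtain ⟨w, hw, hlt⟩ := hbig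
    have hall : ∀ x ∈ W, cl x = cl w := by
      intro x hx
      obtain ⟨p⟩ := coverGraph_reachable hα (hconn w hw x hx) hw hx
      have key : ∀ {a b : V} (p : I.coverGraph.Walk a b), cl a = cl w → cl b = cl w := by
        intro a b p
        induction p with
        | nil => exact id
        | @cons a b _ h _ ih =>
          intro ha
          refine ih ?_
          by_contra hb
          have := hcl.card a b h (by rw [ha]; exact fun h => hb h.symm)
          rw [ha] at this
          omega
      exact key p rfl
    have hWk : W.card < k := by
      refine lt_of_le_of_lt ?_ hlt
      rw [← Set.ncard_coe_finset]
      exact Set.ncard_le_ncard (fun x hx => hall x hx) (Set.toFinite _)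
    have hlab : I.coverLabels cl ⊆ {cl w} := by
      intro r hr
      obtain ⟨x, hx, rfl⟩ := Finset.mem_image.1 hr
      exact Finset.mem_singleton.2 (hall x hx)
    have hearly : I.early cl = ∅ := by
      refine Finset.eq_empty_of_forall_notMem fun b hb => ?_
      obtain ⟨hb, a, hab, hne⟩ := mem_early.1 hb
      have := hab.2
      exact hne ((hall a (Finset.mem_union.2 (by tauto))).trans
        (hall b (Finset.mem_union.2 (by tauto))).symm)
    have h1 := Finset.card_le_card hlab
    rw [Finset.card_singleton] at h1
    rw [hearly, Nat.div_eq_of_lt hWk, Finset.card_empty]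
    omega

theorem isApproximationSchedule_schedule (hα : I.graph.IsVertexCover (I.α : Set V))
    (hβ : I.graph.IsVertexCover (I.β : Set V)) (hcact : IsCactus I.exchange) (hk : 0 < k)
    (hconn : ∀ x ∈ I.α ∪ I.β, ∀ y ∈ I.α ∪ I.β, I.graph.Reachable x y)
    (hcl : IsClustering I.exchange I.coverGraph cl k) {ε : ℝ} (hε : 0 < ε) (hεk : 10 ≤ ε * k) :
    IsApproximationSchedule I.graph I.α I.β (4 * k + 3) (1 + ε) 3 (I.schedule cl k) where
  isVertexCover i _ := isVertexCover_schedule hα hβ hcact hk i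
  first := schedule_zero hcact hk
  last := schedule_last hcact hk
  batch i _ := isIndepSet_schedule hα hβ hcact hk i
  cost i _ := by
    have h1 := card_schedule_le (cl := cl) hcact hk i
    set M := max I.α.card I.β.card
    set err := (I.early cl).card + 2 * (I.coverLabels cl).card + (I.α ∪ I.β).card / k
    have h1' : ((I.schedule cl k i ∪ I.schedule cl k (i + 1)).card : ℝ) ≤ M + err := by
      exact_mod_cast h1
    have hM : (0 : ℝ) ≤ M := by positivity
    rcases error_le hα hcact hconn hcl with h | h
    · have h' : (err : ℝ) ≤ 2 := by exact_mod_cast h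
      nlinarith
    · have hW : (I.α ∪ I.β).card ≤ 2 * M := by
        have := Finset.card_union_le I.α I.β
        have := le_max_left I.α.card I.β.card
        have := le_max_right I.α.card I.β.card
        omega
      change k * err ≤ _ at h
      have h' : (k : ℝ) * err ≤ 10 * M := by
        have : k * err ≤ 10 * M := by omega
        exact_mod_cast this
      have hk' : (0 : ℝ) < k := by exact_mod_cast hk
      have h'' : (k : ℝ) * err ≤ k * (ε * M) := by nlinarith
      have := le_of_mul_le_mul_left h'' hk'
      linarith

/-- The members of the cluster of `v` lie within `2 * D`, and whether one of them is early is seen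
within `T + 2`. The exchange in a cluster is a fixed choice depending only on its data, so all
members choose the same one. No promise on the instances is made, because nodes evaluate the
schedule on instances that merely look right nearby. -/
theorem isLocal_schedule {cl : CoverInstance V → V → V} {T D : ℕ} (hcl : IsLocal T cl)
    (hT : 2 ≤ T) (hD : ∀ I v, Within I.graph D v (cl I v)) (k i : ℕ) :
    IsLocal (T + 2 * D + 2) fun I v => v ∈ I.schedule (cl I) k i := by
  have early_iff : ∀ I J v, Agree (T + 2) I J v → v ∈ I.early (cl I) → v ∈ J.early (cl J) := by
    intro I J v h hv
    obtain ⟨hv, y, hy, hne⟩ := mem_early.1 hv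
    have h0 := h v (.refl _ _ _)
    have hw := isLocalGraph_exchange.2 I v y hy
    refine mem_early.2 ⟨by rwa [← h0.1, ← h0.2.1], y,
      isLocalGraph_exchange.1 I J v y (h.mono (by omega)) hy, ?_⟩
    rwa [← hcl I J y (h.of_within hw (by omega)), ← hcl I J v (h.mono (by omega))]
  intro I J v h
  have hv := h v (.refl _ _ _)
  have hlab : cl I v = cl J v := hcl I J v (h.mono (by omega))
  have near : ∀ I J, Agree (T + 2 * D + 2) I J v → ∀ x, cl I x = cl I v →
      Agree (T + 2) I J x := by
    intro I J h x hx
    refine h.of_within ((hD I v).trans ?_) (d := D + D) (by omega)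
    rw [← hx]
    exact (hD I x).symm
  have lab : ∀ I J, Agree (T + 2 * D + 2) I J v → ∀ x, cl I x = cl I v → cl J x = cl J v := by
    intro I J h x hx
    rw [← hcl I J x ((near I J h x hx).mono (by omega)), hx, hcl I J v (h.mono (by omega))]
  have old : ∀ I J, Agree (T + 2 * D + 2) I J v →
      I.oldPart (cl I) (cl I v) ⊆ J.oldPart (cl J) (cl J v) := by
    intro I J h x hx
    obtain ⟨hx, hx'⟩ := mem_oldPart.1 hx
    have := near I J h x hx' x (.refl _ _ _)
    exact mem_oldPart.2 ⟨by rwa [← this.1, ← this.2.1], lab I J h x hx'⟩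
  have new : ∀ I J, Agree (T + 2 * D + 2) I J v →
      I.newPart (cl I) (cl I v) ⊆ J.newPart (cl J) (cl J v) := by
    intro I J h x hx
    obtain ⟨⟨hx, hxE⟩, hx'⟩ := mem_newPart.1 hx
    have hag := near I J h x hx'
    have := hag x (.refl _ _ _)
    exact mem_newPart.2 ⟨⟨by rwa [← this.1, ← this.2.1],
      fun hE => hxE (early_iff J I x hag.symm hE)⟩, lab I J h x hx'⟩
  have adj : ∀ I J, Agree (T + 2 * D + 2) I J v →
      inCluster I.exchange (cl I) (cl I v) ≤ inCluster J.exchange (cl J) (cl J v) := by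
    intro I J h x y hxy
    obtain ⟨hxy, hx, hy⟩ := hxy
    exact ⟨isLocalGraph_exchange.1 I J x y ((near I J h x hx).mono (by omega)) hxy,
      lab I J h x hx, lab I J h y hy⟩
  have e1 := (old I J h).antisymm (old J I h.symm)
  have e2 := (new I J h).antisymm (new J I h.symm)
  have e3 := (adj I J h).antisymm (adj J I h.symm)
  have e4 : v ∈ I.early (cl I) ↔ v ∈ J.early (cl J) :=
    ⟨early_iff I J v (h.mono (by omega)), early_iff J I v (h.symm.mono (by omega))⟩
  refine propext ?_
  change v ∈ I.schedule (cl I) k i ↔ v ∈ J.schedule (cl J) k i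
  rw [mem_schedule, mem_schedule, hv.1, hv.2.1, e4]
  simp only [clusterSchedule, start]
  rw [e1, e2, e3]

end CoverInstance

end Schedule

/-! ### Collecting views -/

section Views

open SimpleGraph

variable {V W : Type*}

namespace CoverInstance

/-- The memberships of a vertex. -/
noncomputable def input (I : CoverInstance V) (v : V) : Bool × Bool :=
  open scoped Classical in (decide (v ∈ I.α), decide (v ∈ I.β))

theorem input_eq_input {I : CoverInstance V} {J : CoverInstance W} {v : V} {w : W} :
    I.input v = J.input w ↔ (v ∈ I.α ↔ w ∈ J.α) ∧ (v ∈ I.β ↔ w ∈ J.β) := by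
  simp [input]

/-- The image of an instance. -/
def map (e : V ↪ W) (I : CoverInstance V) : CoverInstance W :=
  ⟨I.graph.map e, I.α.map e, I.β.map e⟩

theorem map_adj {e : V ↪ W} {I : CoverInstance V} {x : V} {y : W} :
    (I.map e).graph.Adj (e x) y ↔ ∃ z, e z = y ∧ I.graph.Adj x z := by
  simp only [map, SimpleGraph.map_adj]
  constructor
  · rintro ⟨u, w, huw, hu, rfl⟩
    obtain rfl := e.injective hu
    exact ⟨w, rfl, huw⟩
  · rintro ⟨z, rfl, h⟩
    exact ⟨x, z, h, rfl, rfl⟩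

theorem within_map {e : V ↪ W} {I : CoverInstance V} {r : ℕ} {x : V} {y : W} :
    Within (I.map e).graph r (e x) y ↔ ∃ z, e z = y ∧ Within I.graph r x z := by
  induction r generalizing x with
  | zero =>
    constructor
    · intro h
      exact ⟨x, h.eq_of_zero, .refl _ _ _⟩
    · rintro ⟨z, rfl, h⟩
      rw [h.eq_of_zero]
      exact .refl _ _ _
  | succ r ih =>
    rw [Within.succ_iff]
    constructor
    · rintro (rfl | ⟨w, hw, h⟩)
      · exact ⟨x, rfl, .refl _ _ _⟩
      · obtain ⟨w, rfl, hxw⟩ := map_adj.1 hw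
        obtain ⟨z, rfl, hz⟩ := ih.1 h
        exact ⟨z, rfl, Within.succ_iff.2 (Or.inr ⟨w, hxw, hz⟩)⟩
    · rintro ⟨z, rfl, h⟩
      rcases Within.succ_iff.1 h with rfl | ⟨w, hw, hz⟩
      · exact Or.inl rfl
      · exact Or.inr ⟨e w, map_adj.2 ⟨w, rfl, hw⟩, ih.2 ⟨z, rfl, hz⟩⟩

theorem input_map (e : V ↪ W) (I : CoverInstance V) (v : V) :
    (I.map e).input (e v) = I.input v := by
  simp [input_eq_input, map]

theorem isVertexCover_map {e : V ↪ W} {G : SimpleGraph V} {α : Finset V}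
    (hα : G.IsVertexCover (α : Set V)) : (G.map e).IsVertexCover (α.map e : Set W) := by
  intro x y hxy
  rw [SimpleGraph.map_adj] at hxy
  obtain ⟨u, w, huw, rfl, rfl⟩ := hxy
  simpa using hα huw

theorem exchange_map_le (e : V ↪ W) (I : CoverInstance V) :
    (I.map e).exchange ≤ I.exchange.map e := by
  rintro x y ⟨hxy, h⟩
  simp only [map, SimpleGraph.map_adj] at hxy h
  obtain ⟨u, w, huw, rfl, rfl⟩ := hxy
  rw [SimpleGraph.map_adj]
  refine ⟨u, w, ⟨huw, ?_⟩, rfl, rfl⟩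
  simpa using h

theorem reachable_map {e : V ↪ W} {I : CoverInstance V} (h : I.graph.Connected) {x y : V} :
    (I.map e).graph.Reachable (e x) (e y) := by
  obtain ⟨p⟩ := h x y
  obtain ⟨q, -⟩ := within_map.2 ⟨y, rfl, p, le_rfl⟩
  exact ⟨q⟩

end CoverInstance

/-- Labelled vertices and edges, given by identifiers. -/
@[ext]
structure View where
  /-- the vertices with their inputs -/
  labels : Set (ℕ × (Bool × Bool))
  /-- the edges -/
  edges : Set (ℕ × ℕ)

namespace CoverInstance

/-- What `v` can learn within `T` rounds. -/
def view (I : CoverInstance V) (ident : V → ℕ) (T : ℕ) (v : V) : View where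
  labels := {p | ∃ x, Within I.graph T v x ∧ p = (ident x, I.input x)}
  edges := {p | ∃ x y, (∃ j < T, Within I.graph j v x) ∧ I.graph.Adj x y ∧ p = (ident x, ident y)}

/-- Views mention identifiers only, and the vertices added by the embedding are isolated, so a node
cannot distinguish its network from the copy inside `Fin N`. -/
theorem view_map (e : V ↪ W) (I : CoverInstance V) (ident : W → ℕ) (T : ℕ) (v : V) :
    (I.map e).view ident T (e v) = I.view (ident ∘ e) T v := by
  ext p
  · simp only [view, Set.mem_ofPred_eq, within_map]
    constructor
    · rintro ⟨_, ⟨x, rfl, hx⟩, rfl⟩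
      exact ⟨x, hx, by rw [input_map]; rfl⟩
    · rintro ⟨x, hx, rfl⟩
      exact ⟨e x, ⟨x, rfl, hx⟩, by rw [input_map]; rfl⟩
  · simp only [view, Set.mem_ofPred_eq, within_map]
    constructor
    · rintro ⟨_, y, ⟨j, hj, x, rfl, hx⟩, hy, rfl⟩
      obtain ⟨y, rfl, hxy⟩ := map_adj.1 hy
      exact ⟨x, y, ⟨j, hj, hx⟩, hxy, rfl⟩
    · rintro ⟨x, y, ⟨j, hj, hx⟩, hy, rfl⟩
      exact ⟨e x, e y, ⟨j, hj, x, rfl, hx⟩, map_adj.2 ⟨y, rfl, hy⟩, rfl⟩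

section

variable {I J : CoverInstance V} {ident : V → ℕ} {T : ℕ} {v : V}

theorem input_eq_of_view_eq (hid : Function.Injective ident)
    (h : I.view ident T v = J.view ident T v) {x : V} (hx : Within I.graph T v x) :
    I.input x = J.input x := by
  have : (ident x, I.input x) ∈ (J.view ident T v).labels := h ▸ ⟨x, hx, rfl⟩
  obtain ⟨y, -, hy⟩ := this
  rw [Prod.mk.injEq] at hy
  obtain rfl := hid hy.1
  exact hy.2

theorem adj_of_view_eq (hid : Function.Injective ident)
    (h : I.view ident T v = J.view ident T v) {x y : V} {j : ℕ} (hj : j < T)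
    (hx : Within I.graph j v x) (hxy : I.graph.Adj x y) : J.graph.Adj x y := by
  have : (ident x, ident y) ∈ (J.view ident T v).edges := h ▸ ⟨x, y, ⟨j, hj, hx⟩, hxy, rfl⟩
  obtain ⟨x', y', -, hadj, hy⟩ := this
  rw [Prod.mk.injEq] at hy
  obtain rfl := hid hy.1
  obtain rfl := hid hy.2
  exact hadj

theorem within_of_view_eq (hid : Function.Injective ident)
    (h : I.view ident T v = J.view ident T v) {x : V} {j : ℕ} (hj : j ≤ T)
    (hx : Within I.graph j v x) : Within J.graph j v x := by
  induction j generalizing x with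
  | zero => rw [hx.eq_of_zero]; exact .refl _ _ _
  | succ j ih =>
    rcases Within.succ_iff.1 hx.symm with rfl | ⟨z, hz, hzv⟩
    · exact .refl _ _ _
    · exact (ih (by omega) hzv.symm).trans
        (.of_adj (adj_of_view_eq hid h (by omega) hzv.symm hz.symm))

/-- One round more than the radius is needed, because the edges at a vertex are seen only if it is
at distance less than the number of rounds. -/
theorem agree_of_view_eq (hid : Function.Injective ident) {R : ℕ}
    (h : I.view ident (R + 1) v = J.view ident (R + 1) v) : Agree R I J v := by
  intro x hx
  obtain ⟨h1, h2⟩ := input_eq_input.1 (input_eq_of_view_eq hid h (hx.mono (by omega)))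
  refine ⟨h1, h2, fun y => ⟨adj_of_view_eq hid h (by omega) hx, ?_⟩⟩
  exact adj_of_view_eq hid h.symm (by omega) (within_of_view_eq hid h (by omega) hx)

end

open scoped Classical in
/-- Compute `F` on some instance that explains the view. -/
noncomputable def evalView {X : Type*} [Inhabited X] {N : ℕ}
    (F : CoverInstance (Fin N) → Fin N → X) (T i : ℕ) (w : View) : X :=
  if h : ∃ p : CoverInstance (Fin N) × Fin N, p.2.val = i ∧ p.1.view Fin.val T p.2 = w then
    F h.choose.1 h.choose.2 else default

/-- The chosen instance may differ from the real one far away, but `F` depends on the view alone. -/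
theorem evalView_eq {X : Type*} [Inhabited X] {N T : ℕ} {F : CoverInstance (Fin N) → Fin N → X}
    (hF : ∀ I J u, I.view Fin.val T u = J.view Fin.val T u → F I u = F J u)
    (I : CoverInstance (Fin N)) (u : Fin N) :
    evalView F T u (I.view Fin.val T u) = F I u := by
  have h : ∃ p : CoverInstance (Fin N) × Fin N,
      p.2.val = u ∧ p.1.view Fin.val T p.2 = I.view Fin.val T u := ⟨(I, u), rfl, rfl⟩
  rw [evalView, dif_pos h]
  obtain ⟨h1, h2⟩ := h.choose_spec
  have h1 := Fin.val_injective h1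
  rw [h1] at h2 ⊢
  exact hF _ _ _ h2

end CoverInstance

/-- The algorithm that collects views for `T N` rounds and then computes `F N`. -/
noncomputable def LocalAlgorithm.gather {X : Type} [Inhabited X] (T : ℕ → ℕ)
    (F : ∀ N, CoverInstance (Fin N) → Fin N → X) : LocalAlgorithm (Bool × Bool) X where
  State := ℕ × ℕ × View
  Msg := View
  init N i b := (N, i, ⟨{(i, b)}, ∅⟩)
  send s _ := s.2.2
  receive s M := (s.1, s.2.1,
    ⟨s.2.2.labels ∪ {p | ∃ m ∈ M, p ∈ m.2.labels},
      s.2.2.edges ∪ {p | ∃ m ∈ M, p ∈ m.2.edges ∨ p = (s.2.1, m.1)}⟩)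
  output s := CoverInstance.evalView (F s.1) (T s.1) s.2.1 s.2.2
  rounds := T

theorem LocalAlgorithm.stateAt_gather {X : Type} [Inhabited X] (T : ℕ → ℕ)
    (F : ∀ N, CoverInstance (Fin N) → Fin N → X) (I : CoverInstance V) (N : ℕ) (ident : V → ℕ)
    (t : ℕ) (v : V) : (gather T F).stateAt I.graph N ident I.input t v =
      (N, ident v, I.view ident t v) := by
  induction t generalizing v with
  | zero =>
    refine Prod.ext rfl (Prod.ext rfl (View.ext ?_ ?_))
    · ext p
      change p = _ ↔ ∃ x, _
      constructor
      · rintro rfl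
        exact ⟨v, .refl _ _ _, rfl⟩
      · rintro ⟨x, hx, rfl⟩
        rw [hx.eq_of_zero]
    · ext p
      change False ↔ ∃ x y, _
      simp
  | succ t ih =>
    rw [stateAt]
    simp only [ih]
    refine Prod.ext rfl (Prod.ext rfl (View.ext ?_ ?_))
    · ext p
      constructor
      · rintro (⟨x, hx, rfl⟩ | ⟨_, ⟨w, hw, rfl⟩, x, hx, rfl⟩)
        · exact ⟨x, hx.mono (by omega), rfl⟩
        · exact ⟨x, Within.succ_iff.2 (Or.inr ⟨w, hw.symm, hx⟩), rfl⟩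
      · rintro ⟨x, hx, rfl⟩
        rcases Within.succ_iff.1 hx with rfl | ⟨w, hw, hx⟩
        · exact Or.inl ⟨v, .refl _ _ _, rfl⟩
        · exact Or.inr ⟨_, ⟨w, hw.symm, rfl⟩, x, hx, rfl⟩
    · ext p
      constructor
      · rintro (⟨x, y, ⟨j, hj, hx⟩, hxy, rfl⟩ |
          ⟨_, ⟨w, hw, rfl⟩, ⟨x, y, ⟨j, hj, hx⟩, hxy, rfl⟩ | rfl⟩)
        · exact ⟨x, y, ⟨j, by omega, hx⟩, hxy, rfl⟩
        · exact ⟨x, y, ⟨j + 1, by omega, Within.succ_iff.2 (Or.inr ⟨w, hw.symm, hx⟩)⟩, hxy, rfl⟩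
        · exact ⟨v, w, ⟨0, by omega, .refl _ _ _⟩, hw.symm, rfl⟩
      · rintro ⟨x, y, ⟨j, hj, hx⟩, hxy, rfl⟩
        cases j with
        | zero =>
          obtain rfl := hx.eq_of_zero
          exact Or.inr ⟨_, ⟨y, hxy.symm, rfl⟩, Or.inr rfl⟩
        | succ j =>
          rcases Within.succ_iff.1 hx with rfl | ⟨w, hw, hx⟩
          · exact Or.inr ⟨_, ⟨y, hxy.symm, rfl⟩, Or.inr rfl⟩
          · exact Or.inr ⟨_, ⟨w, hw.symm, rfl⟩, Or.inl ⟨x, y, ⟨j, by omega, hx⟩, hxy, rfl⟩⟩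

theorem LocalAlgorithm.run_gather {X : Type} [Inhabited X] {T : ℕ → ℕ}
    {F : ∀ N, CoverInstance (Fin N) → Fin N → X} {N : ℕ}
    (hF : ∀ I J u, I.view Fin.val (T N) u = J.view Fin.val (T N) u → F N I u = F N J u)
    (I : CoverInstance V) (e : V ↪ Fin N) (v : V) :
    (gather T F).run I.graph N (fun v => e v) I.input v = F N (I.map e) (e v) := by
  have h := stateAt_gather T F I N (fun v => e v) (T N) v
  change (gather T F).output ((gather T F).stateAt _ _ _ _ (T N) v) = _
  rw [h, ← CoverInstance.evalView_eq hF, CoverInstance.view_map]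
  rfl

end Views

/-! ### Transport of schedules -/

section Transport

open SimpleGraph

variable {V W : Type*} [DecidableEq V] [DecidableEq W]

theorem IsApproximationSchedule.comap [Fintype V] {e : V ↪ W} {G : SimpleGraph V} {α β : Finset V}
    {ℓ : ℕ} {η c : ℝ} {S : ℕ → Finset W}
    (h : IsApproximationSchedule (G.map e) (α.map e) (β.map e) ℓ η c S) :
    IsApproximationSchedule G α β ℓ η c fun i => Finset.univ.filter fun v => e v ∈ S i := by
  have hadj : ∀ {x y}, G.Adj x y → (G.map e).Adj (e x) (e y) := fun {x y} hxy => by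
    rw [SimpleGraph.map_adj]
    exact ⟨x, y, hxy, rfl, rfl⟩
  have h' := h
  rw [IsApproximationSchedule, Finset.card_map, Finset.card_map] at h'
  refine ⟨fun i hi x y hxy => ?_, ?_, ?_, fun i hi => le_trans ?_ (h'.cost i hi), fun i hi => ?_⟩
  · simpa using h.isVertexCover i hi (hadj hxy)
  · ext v; simp [h.first]
  · ext v; simp [h.last]
  · rw [Nat.cast_le, ← Finset.card_map e]
    refine Finset.card_le_card fun x hx => ?_
    simp only [Finset.mem_map, Finset.mem_union, Finset.mem_filter, Finset.mem_univ,
      true_and] at hx ⊢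
    obtain ⟨v, hv, rfl⟩ := hx
    exact hv
  · intro x hx y hy hne hxy
    refine h.batch i hi (x := e x) ?_ (y := e y) ?_ (e.injective.ne hne) (hadj hxy)
    · rw [Finset.mem_coe, Finset.mem_symmDiff] at hx ⊢
      simpa using hx
    · rw [Finset.mem_coe, Finset.mem_symmDiff] at hy ⊢
      simpa using hy

/-- Add all of `β`, then remove all of `α \ β`. -/
def unionSchedule (α β : Finset V) : ℕ → Finset V
  | 0 => α
  | 1 => α ∪ β
  | _ + 2 => β

/-- Each of the two batches avoids a vertex cover, hence is independent. This settles the cases in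
which the bound on the rounds may force zero communication. -/
theorem isApproximationSchedule_unionSchedule {G : SimpleGraph V} {α β : Finset V}
    (hα : G.IsVertexCover (α : Set V)) (hβ : G.IsVertexCover (β : Set V)) {ε : ℝ}
    (h : 1 ≤ ε ∨ 0 < ε ∧ (α ∪ β).card ≤ 3) :
    IsApproximationSchedule G α β 2 (1 + ε) 3 (unionSchedule α β) := by
  have hcard : ((α ∪ β).card : ℝ) ≤ (1 + ε) * (max α.card β.card : ℕ) + 3 := by
    rcases h with h | ⟨h, h3⟩
    · have h1 : ((α ∪ β).card : ℝ) ≤ 2 * (max α.card β.card : ℕ) := by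
        have := Finset.card_union_le α β
        exact_mod_cast (by omega : (α ∪ β).card ≤ 2 * max α.card β.card)
      have h2 : (0 : ℝ) ≤ (max α.card β.card : ℕ) := Nat.cast_nonneg _
      nlinarith
    · have h3 : ((α ∪ β).card : ℝ) ≤ 3 := by exact_mod_cast h3
      have : (0 : ℝ) ≤ (1 + ε) * (max α.card β.card : ℕ) := by positivity
      linarith
  refine ⟨fun i _ => ?_, rfl, rfl, fun i hi => ?_, fun i hi => ?_⟩
  · match i with
    | 0 => exact hα
    | 1 =>
      intro x y hxy
      rcases hα hxy with hx | hx
      · exact Or.inl (by simp_all [unionSchedule])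
      · exact Or.inr (by simp_all [unionSchedule])
    | _ + 2 => exact hβ
  · match i with
    | 0 => simpa [unionSchedule] using hcard
    | 1 => simpa [unionSchedule] using hcard
  · match i with
    | 0 =>
      intro x hx y hy _ hxy
      have := hα hxy
      simp only [unionSchedule, Finset.coe_symmDiff, Finset.coe_union, Set.mem_symmDiff,
        Set.mem_union, Finset.mem_coe] at hx hy this
      tauto
    | 1 =>
      intro x hx y hy _ hxy
      have := hβ hxy
      simp only [unionSchedule, Finset.coe_symmDiff, Finset.coe_union, Set.mem_symmDiff,
        Set.mem_union, Finset.mem_coe] at hx hy this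
      tauto

end Transport

/-! ### The algorithm -/

section Main

open SimpleGraph

/-- The cluster scale for precision `ε`, as a binary exponent. -/
noncomputable def scaleExponent (ε : ℝ) : ℕ := Nat.clog 2 (10 * ⌈1 / ε⌉₊)

theorem ten_le_mul_scale {ε : ℝ} (hε : 0 < ε) : 10 ≤ ε * (2 ^ scaleExponent ε : ℕ) := by
  have h1 : ((10 * ⌈1 / ε⌉₊ : ℕ) : ℝ) ≤ (2 ^ scaleExponent ε : ℕ) := by
    exact_mod_cast Nat.le_pow_clog one_lt_two _
  have h2 := Nat.le_ceil (1 / ε)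
  push_cast at h1 ⊢
  calc (10 : ℝ) = ε * (10 * (1 / ε)) := by field_simp
    _ ≤ _ := by gcongr; linarith

theorem scale_le {ε : ℝ} (hε : 0 < ε) : 2 ^ scaleExponent ε ≤ 20 * ⌈1 / ε⌉₊ := by
  have h1 : 1 ≤ ⌈1 / ε⌉₊ := Nat.one_le_ceil_iff.2 (by positivity)
  have h2 := Nat.pow_pred_clog_lt_self one_lt_two (x := 10 * ⌈1 / ε⌉₊) (by omega)
  have h3 : 0 < Nat.clog 2 (10 * ⌈1 / ε⌉₊) := Nat.clog_pos one_lt_two (by omega)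
  rw [scaleExponent, ← Nat.succ_pred_eq_of_pos h3, pow_succ]
  omega

/-- A bound for the number of colours left after colour reduction, for identifiers from a space of
size at most `n ^ c`. -/
def paletteBound (c : ℕ) : ℕ := 2 * 2 ^ (c + 4)

/-- A locality radius of the clustering of scale `2 ^ j`. -/
noncomputable def clusterRadius (c N j : ℕ) : ℕ :=
  2 + 40 * (2 * paletteBound c + 1) * (colorRounds (paletteBound c) N + 2 * paletteBound c + 1) *
    2 ^ j

/-- A bound for the distance of a vertex from its cluster label, at scale `2 ^ j`. -/
def clusterDiam (c j : ℕ) : ℕ := 10 * (2 * paletteBound c + 1) * 2 ^ j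

theorem clusterRadius_add_le {c n N j : ℕ} (hn : 2 ≤ n) (hN : N ≤ n ^ c) :
    clusterRadius c N j + 2 * clusterDiam c j + 3 ≤
      (5 + 60 * (2 * paletteBound c + 1) * (2 * paletteBound c + 2)) * (logStar n * 2 ^ j) := by
  have h1 : colorRounds (paletteBound c) N ≤ logStar n := colorRounds_le_logStar hn hN
  have h2 := one_le_logStar hn
  have h3 : 1 ≤ 2 ^ j := Nat.one_le_two_pow
  unfold clusterRadius clusterDiam
  generalize 2 ^ j = K at *
  generalize logStar n = s at *
  generalize colorRounds (paletteBound c) N = t at *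
  generalize 2 * paletteBound c = p at *
  have h4 : K ≤ s * K := Nat.le_mul_of_pos_left _ h2
  have h5 : 1 ≤ s * K := h3.trans h4
  have h6 : t + p + 1 ≤ s * (p + 2) := by nlinarith
  have h7 : 40 * (p + 1) * (t + p + 1) * K ≤ 40 * (p + 1) * (s * (p + 2)) * K := by gcongr
  have h8 : (p + 1) * K ≤ (p + 1) * (p + 2) * (s * K) :=
    Nat.mul_le_mul (Nat.le_mul_of_pos_right _ (by omega)) h4
  linarith

open scoped Classical in
/-- The schedule that the nodes of a network of known identifiers compute. -/
noncomputable def fullSchedule (ε : ℝ) (c N : ℕ) (I : CoverInstance (Fin N)) :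
    ℕ → Finset (Fin N) :=
  if 1 ≤ ε ∨ N ≤ 1 then unionSchedule I.α I.β
  else I.schedule (CoverInstance.clustering Fin.val (colorRounds (paletteBound c) N)
    (paletteBound c) (scaleExponent ε) I) (2 ^ scaleExponent ε)

open scoped Classical in
/-- The number of batches of `fullSchedule`. -/
noncomputable def fullLength (ε : ℝ) (N : ℕ) : ℕ :=
  if 1 ≤ ε ∨ N ≤ 1 then 2 else 4 * 2 ^ scaleExponent ε + 3

open scoped Classical in
/-- The number of rounds in which `fullSchedule` is computed. -/
noncomputable def fullRounds (ε : ℝ) (c N : ℕ) : ℕ :=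
  if 1 ≤ ε ∨ N ≤ 1 then 0
  else clusterRadius c N (scaleExponent ε) + 2 * clusterDiam c (scaleExponent ε) + 3

theorem fullLength_le {ε : ℝ} (hε : 0 < ε) (N : ℕ) : fullLength ε N ≤ 100 * ⌈1 / ε⌉₊ := by
  have h1 : 1 ≤ ⌈1 / ε⌉₊ := Nat.one_le_ceil_iff.2 (by positivity)
  have h2 := scale_le hε
  unfold fullLength
  split_ifs <;> omega

/-- For `ε ≥ 1` or a trivial identifier space no round is used, since the bound can drop below one.
Otherwise `n ≥ 2`, so `logStar n` is positive and absorbs the constants. -/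
theorem fullRounds_le {ε : ℝ} (hε : 0 < ε) {c n N : ℕ} (hN : N ≤ n ^ c) :
    (fullRounds ε c N : ℝ) ≤
      40 * (5 + 60 * (2 * paletteBound c + 1) * (2 * paletteBound c + 2) : ℕ) * logStar n / ε := by
  unfold fullRounds
  split_ifs with h
  · rw [Nat.cast_zero]
    positivity
  · push Not at h
    have hn2 : 2 ≤ n := by
      by_contra hlt
      have : n ^ c ≤ 1 ^ c := Nat.pow_le_pow_left (by omega) c
      rw [one_pow] at this
      omega
    have h1 := clusterRadius_add_le (j := scaleExponent ε) hn2 hN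
    generalize 5 + 60 * (2 * paletteBound c + 1) * (2 * paletteBound c + 2) = M at *
    have h2 : ((2 ^ scaleExponent ε : ℕ) : ℝ) ≤ 40 / ε := by
      have h3 : ((2 ^ scaleExponent ε : ℕ) : ℝ) ≤ (20 * ⌈1 / ε⌉₊ : ℕ) := by
        exact_mod_cast scale_le hε
      have h4 := Nat.ceil_lt_add_one (a := 1 / ε) (by positivity)
      -- Since `ε < 1`, rounding up `1 / ε` at most doubles it.
      have h5 : 1 ≤ 1 / ε := by rw [le_div_iff₀ hε]; linarith
      push_cast at h3 ⊢
      calc _ ≤ 20 * (⌈1 / ε⌉₊ : ℝ) := h3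
        _ ≤ 20 * (2 * (1 / ε)) := by gcongr; linarith
        _ = 40 / ε := by ring
    calc _ ≤ ((M * (logStar n * 2 ^ scaleExponent ε) : ℕ) : ℝ) := by exact_mod_cast h1
      _ = M * (logStar n * (2 ^ scaleExponent ε : ℕ)) := by push_cast; ring
      _ ≤ M * (logStar n * (40 / ε)) := by gcongr
      _ = _ := by ring

theorem fullSchedule_eq_of_view_eq {ε : ℝ} {c N : ℕ}
    (hq : palette N (colorRounds (paletteBound c) N) ≤ paletteBound c ∨ N ≤ 1)
    {I J : CoverInstance (Fin N)} {u : Fin N}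
    (h : I.view Fin.val (fullRounds ε c N) u = J.view Fin.val (fullRounds ε c N) u) (i : ℕ) :
    u ∈ fullSchedule ε c N I i ↔ u ∈ fullSchedule ε c N J i := by
  unfold fullSchedule
  unfold fullRounds at h
  split_ifs at h ⊢ with hc
  · obtain ⟨h1, h2⟩ := CoverInstance.input_eq_input.1
      (CoverInstance.input_eq_of_view_eq Fin.val_injective h (.refl _ _ _))
    match i with
    | 0 => exact h1
    | 1 => simp [unionSchedule, h1, h2]
    | _ + 2 => exact h2
  · push Not at hc
    have hq := hq.resolve_right (by omega)
    have hloc := CoverInstance.isLocal_schedule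
      (CoverInstance.isLocal_clustering Fin.val_injective Fin.isLt hq (scaleExponent ε)) (by omega)
      (CoverInstance.within_clustering Fin.val_injective Fin.isLt hq (scaleExponent ε))
      (2 ^ scaleExponent ε) i
    exact (hloc I J u (CoverInstance.agree_of_view_eq Fin.val_injective h)).to_iff

theorem isApproximationSchedule_fullSchedule {ε : ℝ} (hε : 0 < ε) {c N : ℕ}
    (hq : palette N (colorRounds (paletteBound c) N) ≤ paletteBound c ∨ N ≤ 1)
    {I : CoverInstance (Fin N)} (hα : I.graph.IsVertexCover (I.α : Set (Fin N)))
    (hβ : I.graph.IsVertexCover (I.β : Set (Fin N))) (hcact : IsCactus I.exchange)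
    (hconn : ∀ x ∈ I.α ∪ I.β, ∀ y ∈ I.α ∪ I.β, I.graph.Reachable x y) :
    IsApproximationSchedule I.graph I.α I.β (fullLength ε N) (1 + ε) 3
      (fullSchedule ε c N I) := by
  unfold fullSchedule fullLength
  split_ifs with hc
  · refine isApproximationSchedule_unionSchedule hα hβ (hc.imp_right fun hN => ⟨hε, ?_⟩)
    exact (Finset.card_le_univ _).trans (by rw [Fintype.card_fin]; omega)
  · push Not at hc
    exact CoverInstance.isApproximationSchedule_schedule hα hβ hcact (by positivity) hconn
      (CoverInstance.isClustering_clustering Fin.val_injective Fin.isLt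
        (hq.resolve_right (by omega)) _ _) hε (ten_le_mul_scale hε)

end Main

theorem corollary12 :
    ∃ L : ℕ, ∀ c : ℕ, ∃ C : ℝ, ∀ ε : ℝ, 0 < ε →
      ∃ A : LocalAlgorithm (Bool × Bool) (List Bool),
        ∀ (V : Type*) [Fintype V] [DecidableEq V] (G : SimpleGraph V), G.Connected →
          (IsCycleGraph G ∨ G.IsTree ∨ G.IsAcyclic ∨ IsChordal G ∨ IsCactus G ∨
            IsEvenHoleFree G ∨ IsClawFree G) →
          ∀ α β : Finset V, G.IsVertexCover (α : Set V) → G.IsVertexCover (β : Set V) →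
          ∀ (N : ℕ) (ident : V → ℕ), Function.Injective ident → (∀ v, ident v < N) →
            N ≤ Fintype.card V ^ c →
            (A.rounds N : ℝ) ≤ C * logStar (Fintype.card V) / ε ∧
            ∃ (ℓ : ℕ) (S : ℕ → Finset V), ℓ ≤ L * ⌈1 / ε⌉₊ ∧
              IsApproximationSchedule G α β ℓ (1 + ε) 3 S ∧
              ∀ v, A.run G N ident (fun w => (decide (w ∈ α), decide (w ∈ β))) v =
                (List.range (ℓ + 1)).map (fun i => decide (v ∈ S i)) := by
  refine ⟨100, fun c =>
    ⟨40 * (5 + 60 * (2 * paletteBound c + 1) * (2 * paletteBound c + 2) : ℕ), fun ε hε =>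
    ⟨.gather (fullRounds ε c) fun N I u =>
      (List.range (fullLength ε N + 1)).map fun i => decide (u ∈ fullSchedule ε c N I i), ?_⟩⟩⟩
  intro V _ _ G hG hclass α β hα hβ N ident hinj hlt hN
  -- The nodes know `N` but not `n`; the number of colouring rounds is a function of `N`, and `n`
  -- enters only in its analysis.
  have hq : palette N (colorRounds (paletteBound c) N) ≤ paletteBound c ∨ N ≤ 1 := by
    by_cases hn : 2 ≤ Fintype.card V
    · exact Or.inl (palette_colorRounds_le hn hN)
    · refine Or.inr (hN.trans ?_)
      exact (Nat.pow_le_pow_left (by omega : Fintype.card V ≤ 1) c).trans (one_pow c).le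
  let e : V ↪ Fin N := ⟨fun v => ⟨ident v, hlt v⟩, fun v w h => hinj (by simpa using h)⟩
  let I : CoverInstance V := ⟨G, α, β⟩
  refine ⟨fullRounds_le hε hN, fullLength ε N,
    fun i => Finset.univ.filter fun v => e v ∈ fullSchedule ε c N (I.map e) i,
    fullLength_le hε N, ?_, fun v => ?_⟩
  -- The copy in `Fin N` may be disconnected and outside of the graph class. Only the cactus
  -- property of the exchange graph and the reachability between covered vertices are carried over.
  · refine IsApproximationSchedule.comap (isApproximationSchedule_fullSchedule hε hq
      (I := I.map e) (CoverInstance.isVertexCover_map hα) (CoverInstance.isVertexCover_map hβ)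
      (((isCactus_exchangeGraph hα hβ hclass).map e).mono (I.exchange_map_le e)) ?_)
    intro x hx y hy
    have hmem : ∀ x ∈ (I.map e).α ∪ (I.map e).β, ∃ v, e v = x := by
      intro x hx
      simp only [CoverInstance.map, Finset.mem_union, Finset.mem_map] at hx
      rcases hx with ⟨v, -, hv⟩ | ⟨v, -, hv⟩ <;> exact ⟨v, hv⟩
    obtain ⟨x, rfl⟩ := hmem x hx
    obtain ⟨y, rfl⟩ := hmem y hy
    exact CoverInstance.reachable_map hG
  · have hrun := LocalAlgorithm.run_gather (T := fullRounds ε c) (N := N)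
      (F := fun N I u =>
        (List.range (fullLength ε N + 1)).map fun i => decide (u ∈ fullSchedule ε c N I i))
      (fun I J u h => List.map_congr_left fun i _ =>
        decide_eq_decide.2 (fullSchedule_eq_of_view_eq hq h i)) I e v
    have hinput : I.input = fun w => (decide (w ∈ α), decide (w ∈ β)) := by
      funext w
      simp [CoverInstance.input, I]
    rw [hinput] at hrun
    refine hrun.trans (List.map_congr_left fun i _ => ?_)
    simp
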